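/- **Notation.** Let $\omega=e^{2\pi i/3}$, $\kappa_j=e^{\pi i(j-1)/3}$, $\mathcal Q=\{\kappa_1,\dots,\kappa_6\}$, $\mathbb D=\{|k|<1\}$, $$l_j(k)=i\tfrac{\omega^jk+(\omega^jk)^{-1}}{2\sqrt3},\quad z_j(k)=i\tfrac{(\omega^jk)^2+(\omega^jk)^{-2}}{4\sqrt3},\quad \theta_{ij}=(l_i-l_j)x+(z_i-z_j)t,\quad \tilde r(k)=\tfrac{\omega^2-k^2}{1-\omega^2k^2},$$ $$\mathcal A=\begin{pmatrix}0&0&1\\1&0&0\\0&1&0\end{pmatrix},\qquad \mathcal B=\begin{pmatrix}0&1&0\\1&0&0\\0&0&1\end{pmatrix}.$$ For $1\le j\le 6$ let $\Gamma_j=\{r\,i\kappa_j:0\le r\le1\}\cup\{-r\,i\kappa_j:r\ge1\}$, oriented away from the origin. The unit circle is divided by the points $i\kappa_j$ into six arcs: $\Gamma_8$ consists of the arcs with $\arg k\in(-\frac\pi6,\frac\pi6)$ (counterclockwise) and $(\frac{5\pi}6,\frac{7\pi}6)$ (clockwise), $\Gamma_7$ of $(\frac\pi2,\frac{5\pi}6)$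 (counterclockwise) and $(\frac{3\pi}2,\frac{11\pi}6)$ (clockwise), $\Gamma_9$ of $(\frac{7\pi}6,\frac{3\pi}2)$ (counterclockwise) and $(\frac\pi6,\frac\pi2)$ (clockwise). Let $\Gamma=\bigcup_{j=1}^6\Gamma_j\cup\partial\mathbb D$, $\hat\Gamma_j=\Gamma_j\cup\partial\mathbb D$ and $\Gamma_\star=\{i\kappa_j\}_{j=1}^6\cup\{0\}$. Let $D_2=\{|k|>1,\ |\arg k|<\frac\pi6\}\cup\{|k|<1,\ |\arg k|>\frac{5\pi}6\}$ and $D_{\rm reg}=D_2\cap(\{|k|>1,\operatorname{Im}k>0\}\cup\{|k|<1,\operatorname{Im}k<0\})$. **Scattering data.** Let $\{r_1,r_2,\mathsf Z,\{c_{k_0}\}_{k_0\in\mathsf Z}\}$ satisfy: (i) $r_1\in C^\infty(\hat\Gamma_1)$ and $r_2\in C^\infty(\hat\Gamma_4\setminus\{\pm\omega^2\})$ (at $\pm i$: the derivatives $\partial_k^m$ along each subcontour exist, with limits at $\pm i$ that agree for all subcontours). (ii) $r_1$ is bounded on $\partial\mathbb D$ and nonzero on $\mathcal Q$; $r_2$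 has simple poles at $\pm\omega^2$ and simple zeros at $\pm\omega$; $r_1(\pm1)=1$, $r_2(\pm1)=-1$. (iii) $\sup_{k\in\Gamma_1}(1+|k|)^N|\partial_k^mr_1(k)|<\infty$ and $\sup_{k\in\Gamma_4}(1+|k|)^N|\partial_k^mr_2(k)|<\infty$ for all integers $0\le m\le N$. (iv) $r_1(\frac1{\omega k})+r_2(\omega k)+r_1(\omega^2k)r_2(\frac1k)=0$ for $k\in\partial\mathbb D\setminus\{\pm\omega\}$, and, with nonvanishing denominators, $$r_2(k)=\frac{r_1(\omega k)r_1(\omega^2k)-r_1(\frac1k)}{1-r_1(\omega k)r_1(\frac1{\omega k})}\ \ (k\in\partial\mathbb D\setminus\{\pm\omega^2\}),\qquad r_1(k)=\frac{r_2(\omega k)r_2(\omega^2k)-r_2(\frac1k)}{1-r_2(\omega k)r_2(\frac1{\omega k})}\ \ (k\in\partial\mathbb D\setminus\mathcal Q).$$ (v) $r_2(k)=\tilde r(k)\overline{r_1(\bar k^{-1})}$ for $k\in\hat\Gamma_4\setminus\{0,\pm\omega^2\}$. (vi) $\mathsf Z$ is a finite subset of $D_{\rm reg}\cup(-1,0)\cup(1,\infty)$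 and $c_{k_0}\in\mathbb C$. (vii) $i(\omega^2k_0^2-\omega)c_{k_0}\ge0$ for every $k_0\in\mathsf Z\cap\mathbb R$. Let $T=\sup\{t\ge0: e^{|k|^2t/4}r_1(1/k)\text{ and its derivatives are rapidly decreasing as }\Gamma_1\ni k\to\infty\}$. **Jump matrix.** With $f(k)=1+r_1(k)r_2(k)+r_1(\frac1{\omega^2k})r_2(\frac1{\omega^2k})$, let $v=v_j$ on $\Gamma_j$, where $$v_1=\begin{pmatrix}1&-r_1(k)e^{-\theta_{21}}&0\\ r_1(\frac1k)e^{\theta_{21}}&1-r_1(k)r_1(\frac1k)&0\\0&0&1\end{pmatrix},\quad v_2=\begin{pmatrix}1&0&0\\0&1-r_2(\omega k)r_2(\frac1{\omega k})&-r_2(\frac1{\omega k})e^{-\theta_{32}}\\0&r_2(\omega k)e^{\theta_{32}}&1\end{pmatrix},$$ $$v_3=\begin{pmatrix}1-r_1(\omega^2k)r_1(\frac1{\omega^2k})&0&r_1(\frac1{\omega^2k})e^{-\theta_{31}}\\0&1&0\\-r_1(\omega^2k)e^{\theta_{31}}&0&1\end{pmatrix},\quad v_4=\begin{pmatrix}1-r_2(k)r_2(\frac1k)&-r_2(\frac1k)e^{-\theta_{21}}&0\\r_2(k)e^{\theta_{21}}&1&0\\0&0&1\end{pmatrix},$$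 $$v_5=\begin{pmatrix}1&0&0\\0&1&-r_1(\omega k)e^{-\theta_{32}}\\0&r_1(\frac1{\omega k})e^{\theta_{32}}&1-r_1(\omega k)r_1(\frac1{\omega k})\end{pmatrix},\quad v_6=\begin{pmatrix}1&0&r_2(\omega^2k)e^{-\theta_{31}}\\0&1&0\\-r_2(\frac1{\omega^2k})e^{\theta_{31}}&0&1-r_2(\omega^2k)r_2(\frac1{\omega^2k})\end{pmatrix},$$ $$v_7=\begin{pmatrix}1&-r_1(k)e^{-\theta_{21}}&r_2(\omega^2k)e^{-\theta_{31}}\\-r_2(k)e^{\theta_{21}}&1+r_1(k)r_2(k)&(r_2(\frac1{\omega k})-r_2(k)r_2(\omega^2k))e^{-\theta_{32}}\\r_1(\omega^2k)e^{\theta_{31}}&(r_1(\frac1{\omega k})-r_1(k)r_1(\omega^2k))e^{\theta_{32}}&f(\omega^2k)\end{pmatrix},$$ $$v_8=\begin{pmatrix}f(k)&r_1(k)e^{-\theta_{21}}&(r_1(\frac1{\omega^2k})-r_1(k)r_1(\omega k))e^{-\theta_{31}}\\r_2(k)e^{\theta_{21}}&1&-r_1(\omega k)e^{-\theta_{32}}\\(r_2(\frac1{\omega^2k})-r_2(\omega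 k)r_2(k))e^{\theta_{31}}&-r_2(\omega k)e^{\theta_{32}}&1+r_1(\omega k)r_2(\omega k)\end{pmatrix},$$ $$v_9=\begin{pmatrix}1+r_1(\omega^2k)r_2(\omega^2k)&(r_2(\frac1k)-r_2(\omega k)r_2(\omega^2k))e^{-\theta_{21}}&-r_2(\omega^2k)e^{-\theta_{31}}\\(r_1(\frac1k)-r_1(\omega k)r_1(\omega^2k))e^{\theta_{21}}&f(\omega k)&r_1(\omega k)e^{-\theta_{32}}\\-r_1(\omega^2k)e^{\theta_{31}}&r_2(\omega k)e^{\theta_{32}}&1\end{pmatrix}.$$ For $\epsilon>0$ and $k_0\in\mathsf Z$ let $D_\epsilon(k_0)=\{|k-k_0|<\epsilon\}$, and let $D_\epsilon(k_0)^*$, $D_\epsilon(k_0)^{-1}$, $D_\epsilon(k_0)^{-*}$ be its images under $k\mapsto\bar k$, $k^{-1}$, $\bar k^{-1}$. Let $\partial\mathcal D$ be the union over $k_0\in\mathsf Z$ and $j=0,1,2$ of the circles $\omega^j\partial D_\epsilon(k_0)$, $\omega^j\partial D_\epsilon(k_0)^*$ (oriented counterclockwise) and $\omega^j\partial D_\epsilon(k_0)^{-1}$,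 $\omega^j\partial D_\epsilon(k_0)^{-*}$ (oriented clockwise), where $\epsilon>0$ is so small that these circles intersect neither each other nor $\Gamma$ (for real $k_0$ the circles coincide in pairs). Put $\tilde\Gamma=\Gamma\cup\partial\mathcal D$. On $\partial\mathcal D$ the jump matrix is defined as follows, $E_{ij}$ denoting the matrix units: $$v=\begin{cases}I-\dfrac{c_{k_0}e^{-\theta_{31}(x,t,k_0)}}{k-k_0}\dfrac{k^2-\omega}{k_0^2-\omega}E_{13},&k\in\partial D_\epsilon(k_0),\ k_0\in\mathsf Z\setminus\mathbb R,\\[2mm] I-\dfrac{\bar c_{k_0}e^{\theta_{32}(x,t,\bar k_0)}}{k-\bar k_0}\dfrac{k^2-1}{\omega^2(\omega^2-\bar k_0^2)}E_{32},&k\in\partial D_\epsilon(k_0)^*,\ k_0\in\mathsf Z\setminus\mathbb R,\\[2mm] I-\dfrac{c_{k_0}e^{-\theta_{21}(x,t,k_0)}}{k-k_0}\dfrac{k^2-\omega}{k_0^2-\omega}E_{12},&k\in\partial D_\epsilon(k_0),\ k_0\in\mathsf Z\cap\mathbb R,\end{cases}$$ extended to all of $\partial\mathcal D$ by $v(k)=\mathcal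 Av(\omega k)\mathcal A^{-1}=\mathcal Bv(k^{-1})^{-1}\mathcal B$. **Lemma (vanishing lemma).** Let $(x,t)\in\mathbb R\times[0,T)$. Suppose that $\tilde n^h:\mathbb C\setminus\tilde\Gamma\to\mathbb C^{1\times3}$ satisfies: (a) $\tilde n^h$ is analytic in $\mathbb C\setminus\tilde\Gamma$; (b) the limits $\tilde n^h_\pm$ of $\tilde n^h$ as $k$ approaches $\tilde\Gamma\setminus(\Gamma_\star\cup\mathcal Q)$ from the left ($+$) and right ($-$) exist, are continuous, and satisfy $\tilde n^h_+=\tilde n^h_-v$ there; (c) $\tilde n^h(k)=O(1)$ as $k\to k_\star$, for each $k_\star\in\Gamma_\star\cup\mathcal Q$; (d) $\tilde n^h(k)=\tilde n^h(\omega k)\mathcal A^{-1}=\tilde n^h(k^{-1})\mathcal B$ for $k\in\mathbb C\setminus\tilde\Gamma$; (e) $\tilde n^h(k)=O(k^{-1})$ as $k\to\infty$. Then $\tilde n^h$ vanishes identically on $\mathbb C\setminus\tilde\Gamma$. -/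

import Mathlib

open Filter Topology Set
open scoped Matrix ContDiff

noncomputable section

namespace Bsq

/-! ### Basic constants and phase functions -/

/-- `ω = e^{2πi/3}`. -/
def om : ℂ := Complex.exp (2 * Real.pi * Complex.I / 3)

/-- The sixth roots of unity `κ_j = e^{πi(j-1)/3}`, `j = 1, …, 6`. -/
def kap (j : ℕ) : ℂ := Complex.exp (Real.pi * Complex.I * ((j : ℂ) - 1) / 3)

/-- `𝒬 = {κ_1, …, κ_6}`. -/
def Qset : Set ℂ := {k | ∃ j ∈ Finset.Icc 1 6, k = kap j}

/-- `l_j(k) = i (ω^j k + (ω^j k)⁻¹) / (2√3)`. -/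
def lfun (j : ℕ) (k : ℂ) : ℂ :=
  Complex.I * (om ^ j * k + (om ^ j * k)⁻¹) / (2 * (Real.sqrt 3 : ℂ))

/-- `z_j(k) = i ((ω^j k)^2 + (ω^j k)^{-2}) / (4√3)`. -/
def zfun (j : ℕ) (k : ℂ) : ℂ :=
  Complex.I * ((om ^ j * k) ^ 2 + ((om ^ j * k) ^ 2)⁻¹) / (4 * (Real.sqrt 3 : ℂ))

/-- `θ_{ij}(x,t,k) = (l_i(k) - l_j(k)) x + (z_i(k) - z_j(k)) t`. -/
def theta (i j : ℕ) (x t : ℝ) (k : ℂ) : ℂ :=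
  (lfun i k - lfun j k) * x + (zfun i k - zfun j k) * t

/-- `r̃(k) = (ω² - k²) / (1 - ω² k²)`. -/
def rtilde (k : ℂ) : ℂ := (om ^ 2 - k ^ 2) / (1 - om ^ 2 * k ^ 2)

/-- The matrix `𝒜`. -/
def matA : Matrix (Fin 3) (Fin 3) ℂ := !![0, 0, 1; 1, 0, 0; 0, 1, 0]

/-- The matrix `ℬ`. -/
def matB : Matrix (Fin 3) (Fin 3) ℂ := !![0, 1, 0; 1, 0, 0; 0, 0, 1]

/-! ### The contour `Γ` and the open sets containing the zeros -/

/-- The unit circle `∂𝔻`. -/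
def unitCircle : Set ℂ := Metric.sphere (0 : ℂ) 1

/-- For `j = 1, …, 6`, `Γ_j` is the union of the segment `[0, iκ_j]` and of the half-line
`{-r iκ_j : r ≥ 1}`. In particular `Γ_1 = [0,i] ∪ (-i)[1,∞)`, `Γ_4 = [0,-i] ∪ i[1,∞)`. -/
def GammaRay (j : ℕ) : Set ℂ :=
  {k | ∃ r : ℝ, 0 ≤ r ∧ r ≤ 1 ∧ k = r * (Complex.I * kap j)} ∪
  {k | ∃ r : ℝ, 1 ≤ r ∧ k = r * (-(Complex.I * kap j))}

/-- The contour `Γ`: six half-lines from the origin together with the unit circle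
(`Γ_7 ∪ Γ_8 ∪ Γ_9 = ∂𝔻`). -/
def Gamma : Set ℂ := unitCircle ∪ ⋃ j ∈ Finset.Icc 1 6, GammaRay j

/-- The set `Γ_⋆ = {iκ_1, …, iκ_6} ∪ {0}` of intersection points of `Γ`. -/
def GammaStar : Set ℂ := {k | ∃ j ∈ Finset.Icc 1 6, k = Complex.I * kap j} ∪ {0}

/-- The open set `D_2`. -/
def D2 : Set ℂ :=
  {k | 1 < ‖k‖ ∧ |Complex.arg k| < Real.pi / 6} ∪
  {k | ‖k‖ < 1 ∧ 5 * Real.pi / 6 < |Complex.arg k|}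

/-- `D_reg`. -/
def Dreg : Set ℂ := D2 ∩ ({k | 1 < ‖k‖ ∧ 0 < k.im} ∪ {k | ‖k‖ < 1 ∧ k.im < 0})

/-! ### Scattering data -/

/-- The `m`-th derivative `∂_k^m f` along the curve `γ`, with parameter in `J`:
the derivative with respect to `k = γ(s)` is `(d/ds) / γ'(s)`. -/
def contourDeriv (γ : ℝ → ℂ) (J : Set ℝ) (f : ℂ → ℂ) : ℕ → ℝ → ℂ
  | 0 => fun s => f (γ s)
  | m + 1 => fun s => derivWithin (contourDeriv γ J f m) J s / derivWithin γ J s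

/-- Smoothness (up to the included end points) along the curve `γ` restricted to `J`. -/
def SmoothAlong (γ : ℝ → ℂ) (J : Set ℝ) (f : ℂ → ℂ) : Prop :=
  ContDiffOn ℝ ∞ (fun s => f (γ s)) J

/-- Parametrization of the half-line in the direction `d`. -/
def rayPar (d : ℂ) : ℝ → ℂ := fun s => s * d

/-- Parametrization of the unit circle. -/
def circPar : ℝ → ℂ := fun φ => Complex.exp (φ * Complex.I)

/-- Parameters of the points of the unit circle other than `±ω²`. -/
def circJ : Set ℝ := {φ | circPar φ ≠ om ^ 2 ∧ circPar φ ≠ -om ^ 2}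

/-- The defining properties of scattering data `{r₁, r₂, Z, {c_{k₀}}_{k₀ ∈ Z}}`.
Only the values of `r₁` on `Γ_1 ∪ ∂𝔻`, those of `r₂` on `(Γ_4 ∪ ∂𝔻) \ {±ω²}`, and those of `c`
on `Z` matter. -/
structure IsScatteringData (r1 r2 : ℂ → ℂ) (Z : Finset ℂ) (c : ℂ → ℂ) : Prop where
  /- `r₁` is smooth on `Γ_1 ∪ ∂𝔻`: it is smooth along each of the subcontours, and at `±i` the
  limits of the derivatives along the different subcontours agree. -/
  r1_circ : SmoothAlong circPar univ r1
  r1_in : SmoothAlong (rayPar Complex.I) (Icc 0 1) r1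
  r1_out : SmoothAlong (rayPar (-Complex.I)) (Ici 1) r1
  r1_at_i : ∀ m, contourDeriv (rayPar Complex.I) (Icc 0 1) r1 m 1
    = contourDeriv circPar univ r1 m (Real.pi / 2)
  r1_at_neg_i : ∀ m, contourDeriv (rayPar (-Complex.I)) (Ici 1) r1 m 1
    = contourDeriv circPar univ r1 m (-(Real.pi / 2))
  /- `r₂` is smooth on `(Γ_4 ∪ ∂𝔻) \ {ω², -ω²}`. -/
  r2_circ : SmoothAlong circPar circJ r2
  r2_in : SmoothAlong (rayPar (-Complex.I)) (Icc 0 1) r2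
  r2_out : SmoothAlong (rayPar Complex.I) (Ici 1) r2
  r2_at_i : ∀ m, contourDeriv (rayPar Complex.I) (Ici 1) r2 m 1
    = contourDeriv circPar circJ r2 m (Real.pi / 2)
  r2_at_neg_i : ∀ m, contourDeriv (rayPar (-Complex.I)) (Icc 0 1) r2 m 1
    = contourDeriv circPar circJ r2 m (-(Real.pi / 2))
  /- Behavior on the unit circle and at the sixth roots of unity. -/
  r1_bdd : ∃ C : ℝ, ∀ k ∈ unitCircle, ‖r1 k‖ ≤ C
  r1_kap : ∀ j ∈ Finset.Icc 1 6, r1 (kap j) ≠ 0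
  r2_pole : ∀ p : ℂ, p = om ^ 2 ∨ p = -om ^ 2 →
    ∃ a : ℂ, a ≠ 0 ∧ Tendsto (fun k => (k - p) * r2 k) (𝓝[unitCircle \ {p}] p) (𝓝 a)
  r2_zero : ∀ p : ℂ, p = om ∨ p = -om → r2 p = 0 ∧
    ∃ a : ℂ, a ≠ 0 ∧ Tendsto (fun k => r2 k / (k - p)) (𝓝[unitCircle \ {p}] p) (𝓝 a)
  r1_one : r1 1 = 1
  r1_neg_one : r1 (-1) = 1
  r2_one : r2 1 = -1
  r2_neg_one : r2 (-1) = -1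
  /- Rapid decrease of `r₁` on `Γ_1` and of `r₂` on `Γ_4`. -/
  r1_decay : ∀ N : ℕ, ∀ m ≤ N, ∃ C : ℝ,
    (∀ s ∈ Icc (0 : ℝ) 1,
      (1 + s) ^ N * ‖contourDeriv (rayPar Complex.I) (Icc 0 1) r1 m s‖ ≤ C) ∧
    (∀ s ∈ Ici (1 : ℝ),
      (1 + s) ^ N * ‖contourDeriv (rayPar (-Complex.I)) (Ici 1) r1 m s‖ ≤ C)
  r2_decay : ∀ N : ℕ, ∀ m ≤ N, ∃ C : ℝ,
    (∀ s ∈ Icc (0 : ℝ) 1,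
      (1 + s) ^ N * ‖contourDeriv (rayPar (-Complex.I)) (Icc 0 1) r2 m s‖ ≤ C) ∧
    (∀ s ∈ Ici (1 : ℝ),
      (1 + s) ^ N * ‖contourDeriv (rayPar Complex.I) (Ici 1) r2 m s‖ ≤ C)
  /- The relation on the unit circle and its two quotient forms (whose denominators do not
  vanish). -/
  circ_rel : ∀ k ∈ unitCircle, k ≠ om → k ≠ -om →
    r1 (1 / (om * k)) + r2 (om * k) + r1 (om ^ 2 * k) * r2 (1 / k) = 0
  circ_rel_r2 : ∀ k ∈ unitCircle, k ≠ om ^ 2 → k ≠ -om ^ 2 →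
    1 - r1 (om * k) * r1 (1 / (om * k)) ≠ 0 ∧
    r2 k = (r1 (om * k) * r1 (om ^ 2 * k) - r1 (1 / k)) /
      (1 - r1 (om * k) * r1 (1 / (om * k)))
  circ_rel_r1 : ∀ k ∈ unitCircle, k ∉ Qset →
    1 - r2 (om * k) * r2 (1 / (om * k)) ≠ 0 ∧
    r1 k = (r2 (om * k) * r2 (om ^ 2 * k) - r2 (1 / k)) /
      (1 - r2 (om * k) * r2 (1 / (om * k)))
  /- The symmetry relating `r₁` and `r₂`. -/
  conj_rel : ∀ k ∈ GammaRay 4 ∪ unitCircle, k ≠ 0 → k ≠ om ^ 2 → k ≠ -om ^ 2 →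
    r2 k = rtilde k * (starRingEnd ℂ) (r1 (((starRingEnd ℂ) k)⁻¹))
  /- `Z ⊂ D_reg ∪ (-1,0) ∪ (1,∞)`. -/
  zeros_mem : ∀ k₀ ∈ Z, k₀ ∈ Dreg ∨
    ∃ a : ℝ, k₀ = a ∧ (a ∈ Ioo (-1 : ℝ) 0 ∨ a ∈ Ioi (1 : ℝ))
  /- The positivity condition `i(ω² k₀² - ω) c_{k₀} ≥ 0` at the real zeros. -/
  pos : ∀ k₀ ∈ Z, k₀.im = 0 →
    ∃ a : ℝ, 0 ≤ a ∧ Complex.I * (om ^ 2 * k₀ ^ 2 - om) * c k₀ = a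

/-- `T = sup {t ≥ 0 | e^{|k|² t/4} r₁(1/k) and all its derivatives are rapidly decreasing as
Γ_1 ∋ k → ∞}`, where the unbounded part of `Γ_1` is `k = -is`, `s ≥ 1`. -/
def Tmax (r1 : ℂ → ℂ) : EReal :=
  sSup ((fun t : ℝ => (t : EReal)) '' {t : ℝ | 0 ≤ t ∧ ∀ N m : ℕ, ∃ C : ℝ, ∀ s ∈ Ici (1 : ℝ),
    s ^ N * ‖contourDeriv (rayPar (-Complex.I)) (Ici 1)
      (fun k => (Real.exp (‖k‖ ^ 2 * t / 4) : ℂ) * r1 (1 / k)) m s‖ ≤ C})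

/-! ### The jump matrix -/

/-- `f(k) = 1 + r₁(k) r₂(k) + r₁(1/(ω²k)) r₂(1/(ω²k))`. -/
def ffun (r1 r2 : ℂ → ℂ) (k : ℂ) : ℂ :=
  1 + r1 k * r2 k + r1 (1 / (om ^ 2 * k)) * r2 (1 / (om ^ 2 * k))

/-- The jump matrices `v_1, …, v_9`. -/
def vmat (r1 r2 : ℂ → ℂ) (x t : ℝ) (j : ℕ) (k : ℂ) : Matrix (Fin 3) (Fin 3) ℂ :=
  let ep21 := Complex.exp (theta 2 1 x t k)
  let em21 := Complex.exp (-theta 2 1 x t k)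
  let ep31 := Complex.exp (theta 3 1 x t k)
  let em31 := Complex.exp (-theta 3 1 x t k)
  let ep32 := Complex.exp (theta 3 2 x t k)
  let em32 := Complex.exp (-theta 3 2 x t k)
  let a := om * k
  let b := om ^ 2 * k
  match j with
  | 1 => !![1, -r1 k * em21, 0;
            r1 (1 / k) * ep21, 1 - r1 k * r1 (1 / k), 0;
            0, 0, 1]
  | 2 => !![1, 0, 0;
            0, 1 - r2 a * r2 (1 / a), -r2 (1 / a) * em32;
            0, r2 a * ep32, 1]
  | 3 => !![1 - r1 b * r1 (1 / b), 0, r1 (1 / b) * em31;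
            0, 1, 0;
            -r1 b * ep31, 0, 1]
  | 4 => !![1 - r2 k * r2 (1 / k), -r2 (1 / k) * em21, 0;
            r2 k * ep21, 1, 0;
            0, 0, 1]
  | 5 => !![1, 0, 0;
            0, 1, -r1 a * em32;
            0, r1 (1 / a) * ep32, 1 - r1 a * r1 (1 / a)]
  | 6 => !![1, 0, r2 b * em31;
            0, 1, 0;
            -r2 (1 / b) * ep31, 0, 1 - r2 b * r2 (1 / b)]
  | 7 => !![1, -r1 k * em21, r2 b * em31;
            -r2 k * ep21, 1 + r1 k * r2 k, (r2 (1 / a) - r2 k * r2 b) * em32;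
            r1 b * ep31, (r1 (1 / a) - r1 k * r1 b) * ep32, ffun r1 r2 b]
  | 8 => !![ffun r1 r2 k, r1 k * em21, (r1 (1 / b) - r1 k * r1 a) * em31;
            r2 k * ep21, 1, -r1 a * em32;
            (r2 (1 / b) - r2 a * r2 k) * ep31, -r2 a * ep32, 1 + r1 a * r2 a]
  | 9 => !![1 + r1 b * r2 b, (r2 (1 / k) - r2 a * r2 b) * em21, -r2 b * em31;
            (r1 (1 / k) - r1 a * r1 b) * ep21, ffun r1 r2 a, r1 a * em32;
            -r1 b * ep31, r2 a * ep32, 1]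
  | _ => 1

/-- The matrix `Q_1` attached to a nonreal `k₀ ∈ Z` with residue constant `c`. -/
def Q1 (k₀ c : ℂ) (x t : ℝ) (k : ℂ) : Matrix (Fin 3) (Fin 3) ℂ :=
  !![1, 0, -(c * Complex.exp (-theta 3 1 x t k₀) / (k - k₀)) *
        ((k ^ 2 - om) / (k₀ ^ 2 - om));
     0, 1, 0;
     0, 0, 1]

/-- The matrix `Q_7` attached to a nonreal `k₀ ∈ Z` with residue constant `c`. -/
def Q7 (k₀ c : ℂ) (x t : ℝ) (k : ℂ) : Matrix (Fin 3) (Fin 3) ℂ :=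
  let kb := (starRingEnd ℂ) k₀
  !![1, 0, 0;
     0, 1, 0;
     0, -((starRingEnd ℂ) c * Complex.exp (theta 3 2 x t kb) / (k - kb)) *
        ((k ^ 2 - 1) / (om ^ 2 * (om ^ 2 - kb ^ 2))), 1]

/-- The matrix `P_1` attached to a real `k₀ ∈ Z` with residue constant `c`. -/
def P1 (k₀ c : ℂ) (x t : ℝ) (k : ℂ) : Matrix (Fin 3) (Fin 3) ℂ :=
  !![1, -(c * Complex.exp (-theta 2 1 x t k₀) / (k - k₀)) *
        ((k ^ 2 - om) / (k₀ ^ 2 - om)), 0;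
     0, 1, 0;
     0, 0, 1]

/-- Extension of the jump matrix `W`, given on the circle `∂D_ε(p)`, to `ω^j ∂D_ε(p)`
(`inv = false`) and to `ω^j ∂D_ε(p)^{-1}` (`inv = true`) by means of the symmetries
`v(k) = 𝒜 v(ωk) 𝒜⁻¹ = ℬ v(k⁻¹)⁻¹ ℬ`. -/
def extendJump (W : ℂ → Matrix (Fin 3) (Fin 3) ℂ) (j : ℕ) (inv : Bool) (k : ℂ) :
    Matrix (Fin 3) (Fin 3) ℂ :=
  matA⁻¹ ^ j *
    (if inv then matB * (W (((om ^ j)⁻¹ * k)⁻¹))⁻¹ * matB else W ((om ^ j)⁻¹ * k)) *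
    matA ^ j

/-! ### Oriented contours and boundary values -/

/-- An oriented piece of contour. Near each point of `carrier`, the set `left` (resp. `right`)
coincides with the left (resp. right) side of the contour. -/
structure OrientedArc where
  carrier : Set ℂ
  left : Set ℂ
  right : Set ℂ

/-- The part of `Γ_j` inside the unit disk, without its end points, oriented outward. -/
def innerRay (j : ℕ) : OrientedArc where
  carrier := {k | ∃ r : ℝ, 0 < r ∧ r < 1 ∧ k = r * (Complex.I * kap j)}
  left := {k | 0 < (k / (Complex.I * kap j)).im}
  right := {k | (k / (Complex.I * kap j)).im < 0}

/-- The part of `Γ_j` outside the unit disk, without its end point, oriented outward. -/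
def outerRay (j : ℕ) : OrientedArc where
  carrier := {k | ∃ r : ℝ, 1 < r ∧ k = r * (-(Complex.I * kap j))}
  left := {k | 0 < (k / (-(Complex.I * kap j))).im}
  right := {k | (k / (-(Complex.I * kap j))).im < 0}

/-- The arc `{e^{iφ} : α < φ < β}`, without the sixth roots of unity, counterclockwise. -/
def arcCCW (α β : ℝ) : OrientedArc where
  carrier := {k | ∃ φ : ℝ, α < φ ∧ φ < β ∧ k = circPar φ} \ Qset
  left := Metric.ball 0 1
  right := (Metric.closedBall 0 1)ᶜ

/-- The arc `{e^{iφ} : α < φ < β}`, without the sixth roots of unity, clockwise. -/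
def arcCW (α β : ℝ) : OrientedArc where
  carrier := {k | ∃ φ : ℝ, α < φ ∧ φ < β ∧ k = circPar φ} \ Qset
  left := (Metric.closedBall 0 1)ᶜ
  right := Metric.ball 0 1

/-- The map `k ↦ ω^j k` (`inv = false`) or `k ↦ ω^j k⁻¹` (`inv = true`). -/
def symMap (j : ℕ) (inv : Bool) (k : ℂ) : ℂ := om ^ j * (if inv then k⁻¹ else k)

/-- The circle `ω^j ∂D_ε(p)` (counterclockwise) or `ω^j ∂D_ε(p)^{-1}` (clockwise). -/
def smallCircle (ε : ℝ) (p : ℂ) (j : ℕ) (inv : Bool) : OrientedArc where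
  carrier := symMap j inv '' Metric.sphere p ε
  left := if inv then (symMap j inv '' Metric.closedBall p ε)ᶜ
    else symMap j inv '' Metric.ball p ε
  right := if inv then symMap j inv '' Metric.ball p ε
    else (symMap j inv '' Metric.closedBall p ε)ᶜ

/-- The points `k₀` and `k̄₀`, `k₀ ∈ Z`. Note that `D_ε(k₀)^* = D_ε(k̄₀)`. -/
def centers (Z : Finset ℂ) : Set ℂ := {p | p ∈ Z ∨ (starRingEnd ℂ) p ∈ Z}

/-- `∂𝒟`: the union of all small circles. -/
def bdryD (Z : Finset ℂ) (ε : ℝ) : Set ℂ :=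
  {k | ∃ p ∈ centers Z, ∃ j : Fin 3, ∃ inv : Bool, k ∈ (smallCircle ε p j inv).carrier}

/-- The contour `Γ̃ = Γ ∪ ∂𝒟`. -/
def GammaTilde (Z : Finset ℂ) (ε : ℝ) : Set ℂ := Gamma ∪ bdryD Z ε

/-- `ε > 0` is so small that the small circles intersect neither each other nor `Γ`. -/
def AdmissibleRadius (Z : Finset ℂ) (ε : ℝ) : Prop :=
  0 < ε ∧ Disjoint (bdryD Z ε) Gamma ∧
  ∀ p ∈ centers Z, ∀ p' ∈ centers Z, ∀ j j' : Fin 3, ∀ inv inv' : Bool,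
    (p, j, inv) ≠ (p', j', inv') →
      Disjoint (smallCircle ε p j inv).carrier (smallCircle ε p' j' inv').carrier

/-- The limits `n_±` of `n` as the arc `S` is approached from the left (`+`) and from the
right (`-`) within the complement of the full contour `Γt` exist at every point of `S`, they are
continuous on `S`, and `n_+ = n_- v` on `S`. -/
def HasJump (Γt : Set ℂ) (n : ℂ → Fin 3 → ℂ) (S : OrientedArc)
    (v : ℂ → Matrix (Fin 3) (Fin 3) ℂ) : Prop :=
  ∃ np nm : ℂ → Fin 3 → ℂ, ContinuousOn np S.carrier ∧ ContinuousOn nm S.carrier ∧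
    ∀ k ∈ S.carrier,
      Tendsto n (𝓝[S.left \ Γt] k) (𝓝 (np k)) ∧
      Tendsto n (𝓝[S.right \ Γt] k) (𝓝 (nm k)) ∧
      np k = nm k ᵥ* v k

/-! ### The homogeneous Riemann-Hilbert problem -/

/-- `n = ñ^h(x,t,·)` solves the homogeneous version of the Riemann-Hilbert problem for `ñ`.
The values of `n` on the contour `Γ̃` are irrelevant. -/
structure IsHomogeneousSolution (r1 r2 : ℂ → ℂ) (Z : Finset ℂ) (c : ℂ → ℂ) (ε x t : ℝ)
    (n : ℂ → Fin 3 → ℂ) : Prop where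
  analytic : DifferentiableOn ℂ n (GammaTilde Z ε)ᶜ
  /- Jumps across `Γ_1, …, Γ_6`. -/
  jump_inner : ∀ j ∈ Finset.Icc 1 6,
    HasJump (GammaTilde Z ε) n (innerRay j) (vmat r1 r2 x t j)
  jump_outer : ∀ j ∈ Finset.Icc 1 6,
    HasJump (GammaTilde Z ε) n (outerRay j) (vmat r1 r2 x t j)
  /- Jumps across the two arcs of each of `Γ_7`, `Γ_8`, `Γ_9`. -/
  jump_seven : HasJump (GammaTilde Z ε) n (arcCCW (Real.pi / 2) (5 * Real.pi / 6))
    (vmat r1 r2 x t 7)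
  jump_seven' : HasJump (GammaTilde Z ε) n (arcCW (3 * Real.pi / 2) (11 * Real.pi / 6))
    (vmat r1 r2 x t 7)
  jump_eight : HasJump (GammaTilde Z ε) n (arcCCW (-(Real.pi / 6)) (Real.pi / 6))
    (vmat r1 r2 x t 8)
  jump_eight' : HasJump (GammaTilde Z ε) n (arcCW (5 * Real.pi / 6) (7 * Real.pi / 6))
    (vmat r1 r2 x t 8)
  jump_nine : HasJump (GammaTilde Z ε) n (arcCCW (7 * Real.pi / 6) (3 * Real.pi / 2))
    (vmat r1 r2 x t 9)
  jump_nine' : HasJump (GammaTilde Z ε) n (arcCW (Real.pi / 6) (Real.pi / 2))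
    (vmat r1 r2 x t 9)
  /- Jumps across the small circles. -/
  jump_Q1 : ∀ k₀ ∈ Z, k₀.im ≠ 0 → ∀ (j : Fin 3) (inv : Bool),
    HasJump (GammaTilde Z ε) n (smallCircle ε k₀ j inv)
      (extendJump (Q1 k₀ (c k₀) x t) j inv)
  jump_Q7 : ∀ k₀ ∈ Z, k₀.im ≠ 0 → ∀ (j : Fin 3) (inv : Bool),
    HasJump (GammaTilde Z ε) n (smallCircle ε ((starRingEnd ℂ) k₀) j inv)
      (extendJump (Q7 k₀ (c k₀) x t) j inv)
  jump_P1 : ∀ k₀ ∈ Z, k₀.im = 0 → ∀ (j : Fin 3) (inv : Bool),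
    HasJump (GammaTilde Z ε) n (smallCircle ε k₀ j inv)
      (extendJump (P1 k₀ (c k₀) x t) j inv)
  /- Boundedness at the exceptional points of the contour. -/
  bounded : ∀ k₁ ∈ GammaStar ∪ Qset,
    n =O[𝓝[(GammaTilde Z ε)ᶜ] k₁] (fun _ => (1 : ℂ))
  /- The `𝒜`- and `ℬ`-symmetries. -/
  symm_A : ∀ k ∉ GammaTilde Z ε, n k = n (om * k) ᵥ* matA⁻¹
  symm_B : ∀ k ∉ GammaTilde Z ε, n k = n k⁻¹ ᵥ* matB
  /- The homogeneous condition at infinity. -/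
  infinity : n =O[Bornology.cobounded ℂ ⊓ 𝓟 (GammaTilde Z ε)ᶜ] (fun k => k⁻¹)

end Bsq

end

/-! The proof is an energy argument: a form built from the solution is holomorphic in a sector, and
Cauchy's theorem plays its boundary values off against each other.

Let s(k) = (k - 1/k)/(2i) (`sfn`), which is Im k on the unit circle. The symmetry between r₁ and r₂
becomes r₂(k) s(ωk) = s(ω²k) conj r₁(k) there, so the weights s(ωk), s(ω²k), s(k) turn the jump
matrix into a hermitian form. The form `hform` pairs the solution at k with the conjugate of its
value at k̄, so it is holomorphic in k. Its first two components are crossed because ℬ swaps them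
when k̄ is replaced by 1/k̄, the point that meets k at the circle. The solution is first continued
from outside the small circles into them (`continued`), which trades those jumps for simple poles at
the points of Z and their conjugates. Then let G(k) = `hsum`, the form at k plus its companion at
-1/k, for |k| > 1 and 0 < arg k < π/6.

Five facts about G carry the proof. (1) Nonreal zeros: the polar terms at p and p̄ are proportional
and cancel in the form, so G has only removable singularities (`poleQ_add_poleP`,
`exists_tendsto_herm`). (2) Real half-line: the regular part has imaginary part a nonnegative
multiple of the squared modulus of the third component. A real zero adds a simple pole whose residue
is real and nonpositive by the positivity condition, hence a nonnegative imaginary part in the upper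
half-plane (`exists_herm_im_lower_bound`). (3) Ray arg k = π/6: the jump relations and the two
symmetries make the two summands of G complex conjugate in the limit, so G is real there
(`ray_form_eq`, `exists_tendsto_ray`). (4) Arc: Re G ≤ 0, with equality only if the boundary values
of the solution vanish (`circle_form_neg`, `exists_tendsto_arc`). (5) Infinity: G = O(1/k), because
the weights are O(k) and each of the two factors is O(1/k).

In the coordinate w = log k the sector is a half-strip, and the imaginary part of Cauchy's theorem
says that the integral of Re G over the arc equals that of Im G over the real edge, up to limits.
The first is ≤ 0, the second ≥ 0, so Re G = 0 on the arc (`re_limit_eq_zero_of_halfStrip`) and the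
solution has limit 0 there. Extended by zero across the arc it stays holomorphic, hence vanishes
nearby; the identity theorem propagates this through both sectors around the real axis, and the 𝒜-
and ℬ-symmetries reach every other component.

Fact (4) is linear algebra. Let M have rows (1, a₁, b₃), (b₁, 1, a₂), (a₃, b₂, 1), where aⱼ are the
values of r₁ at k, ωk, ω²k and bⱼ those at the inverse points, and let D be the diagonal matrix of
weights, of signature (+, -, +) on the arc from 1 to e^{iπ/3}. The circle relation says that M D M*
is diagonal. Its entries Nⱼ do not vanish inside the arc, their relative signs are read off at the
two ends, and the signature of D then gives N₁ > 0 > N₂ (`circle_signs`). Completing squares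
finishes (`arc_form_neg`). -/

noncomputable section

/-! ### Continuous functions holomorphic off a line or a circle -/

namespace Bsq

/-- A continuous function that is holomorphic off a vertical line is holomorphic. -/
theorem differentiableOn_of_off_vertical_line {E : Type*} [NormedAddCommGroup E] [NormedSpace ℂ E]
    [CompleteSpace E] {U : Set ℂ} (hU : IsOpen U) {f : ℂ → E} (hc : ContinuousOn f U) (a : ℝ)
    (hd : ∀ z ∈ U, z.re ≠ a → DifferentiableAt ℂ f z) : DifferentiableOn ℂ f U := by
  refine (Complex.isConservativeOn_and_continuousOn_iff_isDifferentiableOn hU).1 ⟨?_, hc⟩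
  intro z w hzw
  rw [← add_eq_zero_iff_eq_neg, Complex.wedgeIntegral_add_wedgeIntegral_eq]
  have hzw' : ((uIcc z.re w.re) ×ℂ (uIcc z.im w.im)) ⊆ U := hzw
  -- Cauchy's theorem for a subrectangle needs holomorphy only in the open interior and continuity
  -- up to the boundary, so the exceptional line may be one of its sides.
  have key : ∀ x₁ ∈ (uIcc z.re w.re), ∀ x₂ ∈ (uIcc z.re w.re),
      a ∉ Ioo (min x₁ x₂) (max x₁ x₂) →
      (∫ x : ℝ in x₁..x₂, f (x + z.im * Complex.I)) -
      (∫ x : ℝ in x₁..x₂, f (x + w.im * Complex.I)) +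
      Complex.I • (∫ y : ℝ in z.im..w.im, f (x₂ + y * Complex.I)) -
      Complex.I • (∫ y : ℝ in z.im..w.im, f (x₁ + y * Complex.I)) = 0 := by
    intro x₁ h₁ x₂ h₂ ha
    have hsub : (uIcc x₁ x₂) ⊆ (uIcc z.re w.re) := uIcc_subset_uIcc h₁ h₂
    have := Complex.integral_boundary_rect_eq_zero_of_continuousOn_of_differentiableOn f
      (⟨x₁, z.im⟩ : ℂ) (⟨x₂, w.im⟩ : ℂ)
      (hc.mono fun u hu => hzw' ⟨hsub hu.1, hu.2⟩) (by
        intro u hu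
        refine (hd u (hzw' ⟨hsub ?_, ?_⟩) ?_).differentiableWithinAt
        · exact Ioo_subset_Icc_self hu.1
        · exact Ioo_subset_Icc_self hu.2
        · rintro rfl
          exact ha hu.1)
    simpa using this
  -- If the line crosses the rectangle, cut along it: the integrals over the common side cancel.
  by_cases ha : a ∈ (uIcc z.re w.re)
  · have h1 := key z.re left_mem_uIcc a ha (by
      rintro ⟨h1, h2⟩
      rcases le_total z.re a with h | h <;> simp [h] at h1 h2)
    have h2 := key a ha w.re right_mem_uIcc (by
      rintro ⟨h1, h2⟩
      rcases le_total w.re a with h | h <;> simp [h] at h1 h2)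
    have hint : ∀ y ∈ (uIcc z.im w.im), ∀ x₁ ∈ (uIcc z.re w.re), ∀ x₂ ∈ (uIcc z.re w.re),
        IntervalIntegrable (fun x : ℝ => f (x + y * Complex.I)) MeasureTheory.volume x₁ x₂ := by
      intro y hy x₁ h₁ x₂ h₂
      apply ContinuousOn.intervalIntegrable
      refine hc.comp (by fun_prop) ?_
      intro x hx
      refine hzw' ⟨?_, ?_⟩
      · simpa using uIcc_subset_uIcc h₁ h₂ hx
      · simpa using hy
    rw [← intervalIntegral.integral_add_adjacent_intervals
        (hint _ left_mem_uIcc _ left_mem_uIcc _ ha) (hint _ left_mem_uIcc _ ha _ right_mem_uIcc),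
      ← intervalIntegral.integral_add_adjacent_intervals
        (hint _ right_mem_uIcc _ left_mem_uIcc _ ha) (hint _ right_mem_uIcc _ ha _ right_mem_uIcc)]
    rw [← add_zero (0 : E)]
    nth_rewrite 1 [← h1]
    rw [← h2]
    abel
  · refine key z.re left_mem_uIcc w.re right_mem_uIcc fun h => ha ?_
    exact Ioo_subset_Icc_self h

/-- A continuous function that is holomorphic off a circle is holomorphic. -/
theorem differentiableOn_of_off_sphere {E : Type*} [NormedAddCommGroup E] [NormedSpace ℂ E]
    [CompleteSpace E] {U : Set ℂ} (hU : IsOpen U) {f : ℂ → E} (hc : ContinuousOn f U) (p : ℂ)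
    {ε : ℝ} (hε : 0 < ε)
    (hd : ∀ z ∈ U, dist z p ≠ ε → DifferentiableAt ℂ f z) : DifferentiableOn ℂ f U := by
  intro q hq
  refine DifferentiableAt.differentiableWithinAt ?_
  by_cases hqp : dist q p = ε
  swap
  · exact hd q hq hqp
  have hne : q - p ≠ 0 := by
    rw [sub_ne_zero]; rintro rfl; rw [dist_self] at hqp; exact hε.ne hqp
  set V : Set ℂ := (fun w => p + Complex.exp w) ⁻¹' U with hV
  have hVo : IsOpen V := hU.preimage (by fun_prop)
  -- In the coordinate w with z = p + exp w the circle is the vertical line Re w = log ε.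
  have hg : DifferentiableOn ℂ (fun w => f (p + Complex.exp w)) V := by
    refine differentiableOn_of_off_vertical_line hVo
      (hc.comp (by fun_prop) (fun w hw => hw)) (Real.log ε) ?_
    intro z hz hre
    have : DifferentiableAt ℂ f (p + Complex.exp z) := by
      refine hd _ hz ?_
      rw [dist_eq_norm, add_sub_cancel_left, Complex.norm_exp]
      intro h
      exact hre (by rw [← h, Real.log_exp])
    exact DifferentiableAt.comp (f := fun w => p + Complex.exp w) (g := f) z this (by fun_prop)
  set w₀ := Complex.log (q - p) with hw₀
  have hexp : Complex.exp w₀ = q - p := Complex.exp_log hne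
  -- A local inverse of w ↦ p + exp w near q. Dividing by q - p keeps the argument of the logarithm
  -- near 1, away from the branch cut, wherever q lies on the circle.
  set e : ℂ → ℂ := fun z => Complex.log ((z - p) / (q - p)) + w₀ with he
  have heq : e q = w₀ := by simp [he, div_self hne]
  have hed : DifferentiableAt ℂ e q := by
    have : DifferentiableAt ℂ (fun z => Complex.log ((z - p) / (q - p))) q := by
      refine DifferentiableAt.clog (by fun_prop) ?_
      rw [div_self hne]; exact Complex.one_mem_slitPlane
    exact this.add_const _
  have hw₀V : w₀ ∈ V := by simp [hV, hexp, hq]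
  have hcomp : DifferentiableAt ℂ (fun z => f (p + Complex.exp (e z))) q := by
    have h1 : DifferentiableAt ℂ (fun w => f (p + Complex.exp w)) (e q) := by
      rw [heq]; exact hg.differentiableAt (hVo.mem_nhds hw₀V)
    exact DifferentiableAt.comp (f := e) q h1 hed
  refine hcomp.congr_of_eventuallyEq ?_
  have : ∀ᶠ z in 𝓝 q, z ≠ p := by
    apply eventually_ne_nhds
    exact sub_ne_zero.1 hne
  filter_upwards [this] with z hz
  have : (z - p) / (q - p) ≠ 0 := div_ne_zero (sub_ne_zero.2 hz) hne
  simp only [he]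
  rw [Complex.exp_add, Complex.exp_log this, hexp, div_mul_cancel₀ _ hne]
  congr 1
  ring

end Bsq

/-! ### Cauchy's theorem on a half-strip -/

namespace Bsq

open MeasureTheory in
/-- A continuous nonpositive bounded function with nonnegative integral vanishes. -/
theorem eq_zero_of_integral_nonneg_of_nonpos {b B : ℝ} (hb : 0 < b) {l : ℝ → ℝ}
    (hc : ContinuousOn l (Ioo 0 b)) (hB : ∀ φ ∈ Ioo 0 b, ‖l φ‖ ≤ B)
    (hneg : ∀ φ ∈ Ioo 0 b, l φ ≤ 0) (hint : 0 ≤ ∫ φ in (0 : ℝ)..b, l φ) :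
    ∀ φ ∈ Ioo 0 b, l φ = 0 := by
  rw [intervalIntegral.integral_of_le hb.le, integral_Ioc_eq_integral_Ioo] at hint
  have hI : IntegrableOn l (Ioo 0 b) := by
    refine IntegrableOn.of_bound (C := B) (by simp)
      (hc.aestronglyMeasurable measurableSet_Ioo) ?_
    exact (ae_restrict_iff' measurableSet_Ioo).2 (Eventually.of_forall hB)
  have h0 : ∫ φ in Ioo 0 b, -l φ = 0 := by
    refine le_antisymm ?_ (setIntegral_nonneg measurableSet_Ioo fun φ hφ => by
      simpa using hneg φ hφ)
    rw [integral_neg]; linarith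
  have hae : (fun φ => -l φ) =ᵐ[volume.restrict (Ioo 0 b)] 0 := by
    refine (setIntegral_eq_zero_iff_of_nonneg_ae ?_ hI.neg).1 h0
    exact (ae_restrict_iff' measurableSet_Ioo).2 (Eventually.of_forall fun φ hφ => by
      simpa using hneg φ hφ)
  have := Measure.eqOn_open_of_ae_eq hae isOpen_Ioo hc.neg continuousOn_const
  intro φ hφ
  simpa using this hφ

/-- The open half-strip `{0 < Re w, 0 < Im w < b}`. -/
def halfStrip (b : ℝ) : Set ℂ := {w | 0 < w.re ∧ 0 < w.im ∧ w.im < b}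

theorem isOpen_halfStrip (b : ℝ) : IsOpen (halfStrip b) :=
  (isOpen_lt continuous_const Complex.continuous_re).inter
    ((isOpen_lt continuous_const Complex.continuous_im).inter
      (isOpen_lt Complex.continuous_im continuous_const))

/-- Compactness of [δ, R]: finitely many local bounds are merged by taking the largest constant and
the smallest height. -/
theorem exists_uniform_lower_bound {g : ℂ → ℂ} {δ R : ℝ} (hδ : 0 < δ)
    (hbot : ∀ ρ : ℝ, 0 < ρ → ∃ C : ℝ, ∀ᶠ w in 𝓝 (ρ : ℂ), 0 < w.im → -C * w.im ≤ (g w).im) :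
    ∃ C : ℝ, ∃ η₀ > 0, ∀ ρ ∈ Icc δ R, ∀ η : ℝ, 0 < η → η < η₀ →
      -C * η ≤ (g (ρ + η * Complex.I)).im := by
  refine isCompact_Icc.induction_on (p := fun K : Set ℝ => ∃ C : ℝ, ∃ η₀ > 0, ∀ ρ ∈ K, ∀ η : ℝ,
    0 < η → η < η₀ → -C * η ≤ (g (ρ + η * Complex.I)).im) ?_ ?_ ?_ ?_
  · exact ⟨0, 1, one_pos, fun ρ h => h.elim⟩
  · rintro K K' hK ⟨C, η₀, h0, h⟩
    exact ⟨C, η₀, h0, fun ρ hρ => h ρ (hK hρ)⟩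
  · rintro K K' ⟨C, η₀, h0, h⟩ ⟨C', η₀', h0', h'⟩
    refine ⟨max C C', min η₀ η₀', lt_min h0 h0', ?_⟩
    rintro ρ (hρ | hρ) η hη hη'
    · refine le_trans ?_ (h ρ hρ η hη (hη'.trans_le (min_le_left _ _)))
      have := le_max_left C C'
      nlinarith
    · refine le_trans ?_ (h' ρ hρ η hη (hη'.trans_le (min_le_right _ _)))
      have := le_max_right C C'
      nlinarith
  · intro ρ hρ
    obtain ⟨C, hC⟩ := hbot ρ (hδ.trans_le hρ.1)
    obtain ⟨r, hr, hrC⟩ := Metric.eventually_nhds_iff.1 hC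
    refine ⟨Metric.ball ρ (r / 2), mem_nhdsWithin_of_mem_nhds (Metric.ball_mem_nhds _ (by positivity)),
      C, r / 2, by positivity, ?_⟩
    intro ρ' hρ' η hη hη'
    have := @hrC (ρ' + η * Complex.I) (by
      rw [dist_eq_norm]
      have : (ρ' + η * Complex.I - ρ : ℂ) = ((ρ' - ρ : ℝ) : ℂ) + ((η : ℝ) : ℂ) * Complex.I := by
        push_cast; ring
      rw [this]
      refine (norm_add_le _ _).trans_lt ?_
      rw [norm_mul, Complex.norm_I, mul_one, Complex.norm_real, Complex.norm_real,
        Real.norm_of_nonneg hη.le]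
      rw [Metric.mem_ball, Real.dist_eq] at hρ'
      rw [Real.norm_eq_abs]
      linarith) (by simpa using hη)
    simpa using this

open MeasureTheory in
/-- Boundary uniqueness for a holomorphic function on a half-strip which decays at infinity, is
real on the upper edge, has nonnegative imaginary part on the lower edge (in a weak sense), and
has nonpositive real part on the vertical edge. -/
theorem re_limit_eq_zero_of_halfStrip {g : ℂ → ℂ} {s : Set ℂ} (hs : s.Countable) {b : ℝ}
    (hb : 0 < b)
    (hc : ContinuousOn g {w | 0 < w.re ∧ 0 < w.im ∧ w.im ≤ b})
    (hd : ∀ w ∈ halfStrip b, w ∉ s → DifferentiableAt ℂ g w)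
    (htop : ∀ ρ : ℝ, 0 < ρ → (g (ρ + b * Complex.I)).im = 0)
    (hbot : ∀ ρ : ℝ, 0 < ρ → ∃ C : ℝ, ∀ᶠ w in 𝓝 (ρ : ℂ), 0 < w.im → -C * w.im ≤ (g w).im)
    (hinf : ∃ C R : ℝ, ∀ w ∈ halfStrip b, R ≤ w.re → ‖g w‖ ≤ C * Real.exp (-w.re))
    (hbdd : ∃ B : ℝ, ∃ δ > 0, ∀ w ∈ halfStrip b, w.re < δ → ‖g w‖ ≤ B)
    {l : ℝ → ℂ}
    (hlim : ∀ φ ∈ Ioo 0 b, Tendsto g (𝓝[halfStrip b] (φ * Complex.I)) (𝓝 (l φ)))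
    (hneg : ∀ φ ∈ Ioo 0 b, (l φ).re ≤ 0) : ∀ φ ∈ Ioo 0 b, (l φ).re = 0 := by
  obtain ⟨C', R₀, hinf⟩ := hinf
  obtain ⟨B, δ₀, hδ₀, hbdd⟩ := hbdd
  have hmem : ∀ ρ φ : ℝ, 0 < ρ → φ ∈ Ioo 0 b → (ρ + φ * Complex.I : ℂ) ∈ halfStrip b := by
    intro ρ φ hρ hφ
    simpa [halfStrip] using ⟨hρ, hφ.1, hφ.2⟩
  have hcv : ∀ ρ : ℝ, 0 < ρ → ContinuousOn (fun φ : ℝ => g (ρ + φ * Complex.I)) (Ioc 0 b) := by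
    intro ρ hρ
    refine hc.comp (by fun_prop) ?_
    intro φ hφ
    simpa using ⟨hρ, hφ.1, hφ.2⟩
  -- Imaginary part of Cauchy's theorem on [δ, R] × [η, b]. On vertical sides dw = i dφ, so the real
  -- part of g appears there; the top side drops out because g is real on it. The bottom stays at
  -- height η > 0, since g need not extend to the real edge.
  have hrect : ∀ δ R η : ℝ, 0 < δ → δ < R → 0 < η → η < b →
      (∫ ρ in δ..R, (g (ρ + η * Complex.I)).im) + (∫ φ in η..b, (g (R + φ * Complex.I)).re) -
        ∫ φ in η..b, (g (δ + φ * Complex.I)).re = 0 := by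
    intro δ R η hδ hR hη hηb
    have h := Complex.integral_boundary_rect_eq_zero_of_differentiable_on_off_countable g
      (⟨δ, η⟩ : ℂ) (⟨R, b⟩ : ℂ) s hs (by
        refine hc.mono ?_
        rintro w ⟨h1, h2⟩
        simp only [uIcc_of_le hR.le, uIcc_of_le hηb.le, mem_preimage, mem_Icc] at h1 h2
        exact ⟨hδ.trans_le h1.1, hη.trans_le h2.1, h2.2⟩) (by
        rintro w ⟨⟨h1, h2⟩, h3⟩
        simp only [min_eq_left hR.le, max_eq_right hR.le, min_eq_left hηb.le,
          max_eq_right hηb.le, mem_preimage, mem_Ioo] at h1 h2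
        exact hd w ⟨hδ.trans h1.1, hη.trans h2.1, h2.2⟩ h3)
    have hv : ∀ ρ : ℝ, 0 < ρ →
        IntervalIntegrable (fun φ : ℝ => g (ρ + φ * Complex.I)) volume η b := by
      intro ρ hρ
      refine ((hcv ρ hρ).mono ?_).intervalIntegrable
      rw [uIcc_of_le hηb.le]
      exact fun x hx => ⟨hη.trans_le hx.1, hx.2⟩
    have hh : ∀ φ : ℝ, 0 < φ → φ ≤ b →
        IntervalIntegrable (fun ρ : ℝ => g (ρ + φ * Complex.I)) volume δ R := by
      intro φ hφ hφb
      refine (hc.comp (by fun_prop) ?_).intervalIntegrable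
      intro x hx
      rw [uIcc_of_le hR.le] at hx
      simpa using ⟨hδ.trans_le hx.1, hφ, hφb⟩
    have him := congrArg Complex.im h
    simp only [smul_eq_mul, Complex.add_im, Complex.sub_im, Complex.mul_im, Complex.I_re,
      Complex.I_im, zero_mul, one_mul, zero_add, Complex.zero_im] at him
    have e1 : ∀ φ : ℝ, 0 < φ → φ ≤ b → (∫ ρ in δ..R, g (ρ + φ * Complex.I)).im =
        ∫ ρ in δ..R, (g (ρ + φ * Complex.I)).im := fun φ h1 h2 =>
      (Complex.imCLM.intervalIntegral_comp_comm (hh φ h1 h2)).symm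
    have e2 : ∀ ρ : ℝ, 0 < ρ → (∫ φ in η..b, g (ρ + φ * Complex.I)).re =
        ∫ φ in η..b, (g (ρ + φ * Complex.I)).re := fun ρ h1 =>
      (Complex.reCLM.intervalIntegral_comp_comm (hv ρ h1)).symm
    rw [e1 η hη hηb.le, e1 b hb le_rfl, e2 R (hδ.trans hR), e2 δ hδ] at him
    have h0 : ∫ ρ in δ..R, (g (ρ + b * Complex.I)).im = 0 := by
      rw [intervalIntegral.integral_congr (g := fun _ => (0 : ℝ))]
      · simp
      · intro ρ hρ
        rw [uIcc_of_le hR.le] at hρ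
        exact htop ρ (hδ.trans_le hρ.1)
    rw [h0] at him
    linarith
  have hB : ∀ δ : ℝ, 0 < δ → δ < δ₀ → ∀ φ ∈ Ioo 0 b, ‖(g (δ + φ * Complex.I)).re‖ ≤ B := by
    intro δ hδ hδ' φ hφ
    refine (Complex.abs_re_le_norm _).trans (hbdd _ (hmem δ φ hδ hφ) (by simpa using hδ'))
  have hBnn : 0 ≤ B := by
    have := hB (δ₀ / 2) (by positivity) (by linarith) (b / 2) ⟨by positivity, by linarith⟩
    exact (norm_nonneg _).trans this
  have hIoc : ∀ δ : ℝ, 0 < δ → ∀ η : ℝ, 0 ≤ η → η ≤ b → δ < δ₀ →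
      IntervalIntegrable (fun φ : ℝ => (g (δ + φ * Complex.I)).re) volume 0 η := by
    intro δ hδ η hη hηb hδ'
    rw [intervalIntegrable_iff_integrableOn_Ioo_of_le hη]
    refine IntegrableOn.of_bound (C := B) (by simp) ?_ ?_
    · refine ContinuousOn.aestronglyMeasurable ?_ measurableSet_Ioo
      refine Complex.continuous_re.comp_continuousOn ((hcv δ hδ).mono ?_)
      exact fun x hx => ⟨hx.1, hx.2.le.trans hηb⟩
    · refine (ae_restrict_iff' measurableSet_Ioo).2 (Eventually.of_forall fun φ hφ => ?_)
      exact hB δ hδ hδ' φ ⟨hφ.1, hφ.2.trans_le hηb⟩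
  -- First η → 0: the bottom side costs at most |C| η (R - δ), and the piece of the left side below
  -- height η at most B η. Then R → ∞: the right side is O(e^{-R}).
  have hJ : ∀ δ : ℝ, 0 < δ → δ < δ₀ → 0 ≤ ∫ φ in (0 : ℝ)..b, (g (δ + φ * Complex.I)).re := by
    intro δ hδ hδ'
    have hR : ∀ R : ℝ, δ < R → R₀ ≤ R →
        -(b * (C' * Real.exp (-R))) ≤ ∫ φ in (0 : ℝ)..b, (g (δ + φ * Complex.I)).re := by
      intro R hδR hR
      obtain ⟨C, η₀, hη₀, hC⟩ := exists_uniform_lower_bound (R := R) hδ hbot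
      have hη : ∀ η : ℝ, 0 < η → η < min η₀ b → -(b * (C' * Real.exp (-R))) - (|C| * (R - δ) + B) * η ≤
          ∫ φ in (0 : ℝ)..b, (g (δ + φ * Complex.I)).re := by
        intro η hη hη'
        have hηb := hη'.trans_le (min_le_right _ _)
        have hηη := hη'.trans_le (min_le_left _ _)
        have h1 := hrect δ R η hδ hδR hη hηb
        have h2 : -(|C| * η * (R - δ)) ≤ ∫ ρ in δ..R, (g (ρ + η * Complex.I)).im := by
          have : ∫ ρ in δ..R, (-(|C| * η)) = -(|C| * η * (R - δ)) := by
            rw [intervalIntegral.integral_const, smul_eq_mul]; ring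
          rw [← this]
          refine intervalIntegral.integral_mono_on hδR.le (by simp) ?_ ?_
          · refine (Complex.continuous_im.comp_continuousOn
              (hc.comp (f := fun ρ : ℝ => (ρ + η * Complex.I : ℂ)) (by fun_prop) ?_)).intervalIntegrable
            intro x hx
            rw [uIcc_of_le hδR.le] at hx
            simpa using ⟨hδ.trans_le hx.1, hη, hηb.le⟩
          · intro ρ hρ
            refine le_trans ?_ (hC ρ hρ η hη hηη)
            have := le_abs_self C
            nlinarith
        have h3 : ‖∫ φ in η..b, (g (R + φ * Complex.I)).re‖ ≤ C' * Real.exp (-R) * |b - η| := by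
          refine intervalIntegral.norm_integral_le_of_norm_le_const_ae ?_
          -- The decay is known only in the open strip, while the interval of integration contains
          -- the endpoint b.
          have hne : ∀ᵐ φ : ℝ, φ ≠ b := by simp [ae_iff]
          filter_upwards [hne] with φ hφb hφ
          rw [uIoc_of_le hηb.le] at hφ
          refine (Complex.abs_re_le_norm _).trans ?_
          have := hinf (R + φ * Complex.I)
            (hmem R φ (hδ.trans hδR) ⟨hη.trans hφ.1, lt_of_le_of_ne hφ.2 hφb⟩) (by simpa using hR)
          simpa using this
        have h3' : C' * Real.exp (-R) * |b - η| ≤ b * (C' * Real.exp (-R)) := by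
          rw [abs_of_pos (by linarith)]
          have h5 : 0 ≤ C' * Real.exp (-R) := by
            have := hinf (R + (b / 2 : ℝ) * Complex.I)
              (hmem R (b / 2) (hδ.trans hδR) ⟨by positivity, by linarith⟩) (by simpa using hR)
            have h6 := (norm_nonneg _).trans this
            simpa using h6
          nlinarith
        have h4 : ‖∫ φ in (0 : ℝ)..η, (g (δ + φ * Complex.I)).re‖ ≤ B * |η - 0| := by
          refine intervalIntegral.norm_integral_le_of_norm_le_const ?_
          intro φ hφ
          rw [uIoc_of_le hη.le] at hφ
          exact hB δ hδ hδ' φ ⟨hφ.1, hφ.2.trans_lt hηb⟩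
        rw [sub_zero, abs_of_pos hη, Real.norm_eq_abs] at h4
        rw [Real.norm_eq_abs] at h3
        have h5 : (∫ φ in (0 : ℝ)..η, (g (δ + φ * Complex.I)).re) +
            ∫ φ in η..b, (g (δ + φ * Complex.I)).re =
            ∫ φ in (0 : ℝ)..b, (g (δ + φ * Complex.I)).re := by
          refine intervalIntegral.integral_add_adjacent_intervals (hIoc δ hδ η hη.le hηb.le hδ') ?_
          exact (hIoc δ hδ η hη.le hηb.le hδ').symm.trans (hIoc δ hδ b hb.le le_rfl hδ')
        have h6 := neg_abs_le (∫ φ in (0 : ℝ)..η, (g (δ + φ * Complex.I)).re)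
        have h7 := neg_abs_le (∫ φ in η..b, (g (R + φ * Complex.I)).re)
        linarith
      have hlimη : Tendsto (fun η : ℝ => -(b * (C' * Real.exp (-R))) - (|C| * (R - δ) + B) * η)
          (𝓝[>] 0) (𝓝 (-(b * (C' * Real.exp (-R))) - (|C| * (R - δ) + B) * 0)) :=
        (Continuous.tendsto (by fun_prop) 0).mono_left nhdsWithin_le_nhds
      have := le_of_tendsto hlimη (b := ∫ φ in (0 : ℝ)..b, (g (δ + φ * Complex.I)).re) (by
        filter_upwards [Ioo_mem_nhdsGT (show (0 : ℝ) < min η₀ b from lt_min hη₀ hb)] with η h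
        exact hη η h.1 h.2)
      simpa using this
    have hlimR : Tendsto (fun R : ℝ => -(b * (C' * Real.exp (-R)))) atTop (𝓝 (-(b * (C' * 0)))) :=
      ((Real.tendsto_exp_neg_atTop_nhds_zero.const_mul C').const_mul b).neg
    have := le_of_tendsto hlimR (b := ∫ φ in (0 : ℝ)..b, (g (δ + φ * Complex.I)).re) (by
      filter_upwards [eventually_gt_atTop δ, eventually_ge_atTop R₀] with R h1 h2
      exact hR R h1 h2)
    simpa using this
  have hpath : ∀ φ ∈ Ioo 0 b, Tendsto (fun δ : ℝ => g (δ + φ * Complex.I)) (𝓝[>] 0) (𝓝 (l φ)) := by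
    intro φ hφ
    refine (hlim φ hφ).comp (tendsto_nhdsWithin_iff.2 ⟨?_, ?_⟩)
    · have : Tendsto (fun δ : ℝ => (δ + φ * Complex.I : ℂ)) (𝓝 0) (𝓝 ((0 : ℝ) + φ * Complex.I)) :=
        Continuous.tendsto (by fun_prop) 0
      simpa using this.mono_left (nhdsWithin_le_nhds (s := Ioi 0))
    · filter_upwards [self_mem_nhdsWithin] with δ hδ
      exact hmem δ φ hδ hφ
  have hlB : ∀ φ ∈ Ioo 0 b, ‖(l φ).re‖ ≤ B := by
    intro φ hφ
    refine le_of_tendsto (((Complex.continuous_re.tendsto _).comp (hpath φ hφ)).norm) ?_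
    filter_upwards [Ioo_mem_nhdsGT hδ₀] with δ hδ
    exact hB δ hδ.1 hδ.2 φ hφ
  -- Limits that exist through the whole two-dimensional strip automatically depend continuously on
  -- the boundary point.
  have hlc : ContinuousOn l (Ioo 0 b) := by
    have h1 : ContinuousOn (extendFrom (halfStrip b) g) ((fun φ : ℝ => (φ * Complex.I : ℂ)) '' Ioo 0 b) := by
      refine continuousOn_extendFrom ?_ ?_
      · rintro _ ⟨φ, hφ, rfl⟩
        refine mem_closure_of_tendsto (f := fun δ : ℝ => (δ + φ * Complex.I : ℂ)) (b := 𝓝[>] (0:ℝ)) ?_ ?_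
        · have : Tendsto (fun δ : ℝ => (δ + φ * Complex.I : ℂ)) (𝓝 0) (𝓝 ((0 : ℝ) + φ * Complex.I)) :=
            Continuous.tendsto (by fun_prop) 0
          simpa using this.mono_left (nhdsWithin_le_nhds (s := Ioi 0))
        · filter_upwards [self_mem_nhdsWithin] with δ hδ
          exact hmem δ φ hδ hφ
      · rintro _ ⟨φ, hφ, rfl⟩
        exact ⟨_, hlim φ hφ⟩
    refine (h1.comp (f := fun φ : ℝ => (φ * Complex.I : ℂ)) (by fun_prop)
      (mapsTo_image _ _)).congr ?_
    intro φ hφ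
    refine (extendFrom_eq ?_ (hlim φ hφ)).symm
    refine mem_closure_of_tendsto (f := fun δ : ℝ => (δ + φ * Complex.I : ℂ)) (b := 𝓝[>] (0:ℝ)) ?_ ?_
    · have : Tendsto (fun δ : ℝ => (δ + φ * Complex.I : ℂ)) (𝓝 0) (𝓝 ((0 : ℝ) + φ * Complex.I)) :=
        Continuous.tendsto (by fun_prop) 0
      simpa using this.mono_left (nhdsWithin_le_nhds (s := Ioi 0))
    · filter_upwards [self_mem_nhdsWithin] with δ hδ
      exact hmem δ φ hδ hφ
  have hDCT : Tendsto (fun δ : ℝ => ∫ φ in (0 : ℝ)..b, (g (δ + φ * Complex.I)).re) (𝓝[>] 0)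
      (𝓝 (∫ φ in (0 : ℝ)..b, (l φ).re)) := by
    have hne : ∀ᵐ φ : ℝ, φ ≠ b := by simp [ae_iff]
    refine intervalIntegral.tendsto_integral_filter_of_dominated_convergence (fun _ => B) ?_ ?_ ?_ ?_
    · filter_upwards [Ioo_mem_nhdsGT hδ₀] with δ hδ
      rw [uIoc_of_le hb.le]
      exact (Complex.continuous_re.comp_continuousOn (hcv δ hδ.1)).aestronglyMeasurable
        measurableSet_Ioc
    · filter_upwards [Ioo_mem_nhdsGT hδ₀] with δ hδ
      filter_upwards [hne] with φ hφb hφ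
      rw [uIoc_of_le hb.le] at hφ
      exact hB δ hδ.1 hδ.2 φ ⟨hφ.1, lt_of_le_of_ne hφ.2 hφb⟩
    · simp
    · filter_upwards [hne] with φ hφb hφ
      rw [uIoc_of_le hb.le] at hφ
      exact (Complex.continuous_re.tendsto _).comp (hpath φ ⟨hφ.1, lt_of_le_of_ne hφ.2 hφb⟩)
  have hfin : 0 ≤ ∫ φ in (0 : ℝ)..b, (l φ).re := by
    refine ge_of_tendsto hDCT ?_
    filter_upwards [Ioo_mem_nhdsGT hδ₀] with δ hδ
    exact hJ δ hδ.1 hδ.2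
  exact eq_zero_of_integral_nonneg_of_nonpos hb (Complex.continuous_re.comp_continuousOn hlc) hlB
    hneg hfin

end Bsq

namespace Bsq

/-! ### The cube root of unity and the contour -/

theorem om_eq : om = ⟨-1 / 2, Real.sqrt 3 / 2⟩ := by
  have h : om = Complex.exp (((2 * Real.pi / 3 : ℝ) : ℂ) * Complex.I) := by
    rw [om]; congr 1; push_cast; ring
  have e : 2 * Real.pi / 3 = Real.pi - Real.pi / 3 := by ring
  rw [h]
  apply Complex.ext
  · rw [Complex.exp_ofReal_mul_I_re, e, Real.cos_pi_sub, Real.cos_pi_div_three]; norm_num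
  · rw [Complex.exp_ofReal_mul_I_im, e, Real.sin_pi_sub, Real.sin_pi_div_three]

theorem om_re : om.re = -1 / 2 := by rw [om_eq]

theorem om_im : om.im = Real.sqrt 3 / 2 := by rw [om_eq]

theorem om_ne_zero : om ≠ 0 := Complex.exp_ne_zero _

theorem om_cube : om ^ 3 = 1 := by
  rw [om, ← Complex.exp_nat_mul, ← Complex.exp_two_pi_mul_I]
  congr 1; push_cast; ring

theorem om_sq_add : om ^ 2 = -1 - om := by
  have h3 : Real.sqrt 3 * Real.sqrt 3 = 3 := Real.mul_self_sqrt (by norm_num)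
  rw [om_eq, sq]
  apply Complex.ext
  · simp; linarith
  · simp; ring

theorem conj_om : (starRingEnd ℂ) om = om ^ 2 := by
  rw [om_sq_add, om_eq]
  apply Complex.ext <;> simp; norm_num

theorem norm_om : ‖om‖ = 1 := by
  have h : ‖om‖ ^ 3 = 1 := by rw [← norm_pow, om_cube, norm_one]
  exact (pow_eq_one_iff_of_nonneg (norm_nonneg _) (by norm_num)).1 h

theorem om_mul_re (k : ℂ) : (om * k).re = -(k.re + Real.sqrt 3 * k.im) / 2 := by
  rw [Complex.mul_re, om_re, om_im]; ring

theorem om_sq_mul_re (k : ℂ) : (om ^ 2 * k).re = -(k.re - Real.sqrt 3 * k.im) / 2 := by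
  rw [om_sq_add, sub_mul, Complex.sub_re, om_mul_re]; simp; ring

theorem sqrt_three_sq : Real.sqrt 3 ^ 2 = 3 := Real.sq_sqrt (by norm_num)

theorem cube_re (k : ℂ) : (k ^ 3).re = 4 * (k.re * (om * k).re * (om ^ 2 * k).re) := by
  rw [om_mul_re, om_sq_mul_re]
  have h3 := sqrt_three_sq
  have : (k ^ 3).re = k.re ^ 3 - 3 * k.re * k.im ^ 2 := by
    simp only [pow_succ, pow_zero, one_mul, Complex.mul_re, Complex.mul_im]; ring
  rw [this]
  linear_combination (k.re * k.im ^ 2) * h3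

theorem kap_one : kap 1 = 1 := by simp [kap]

theorem kap_three : kap 3 = om := by
  rw [kap, om]; congr 1; push_cast; ring

theorem kap_five : kap 5 = om ^ 2 := by
  rw [kap, om, ← Complex.exp_nat_mul]; congr 1; push_cast; ring

theorem kap_add_three (j : ℕ) : kap (j + 3) = -kap j := by
  have h : Real.pi * Complex.I * (((j + 3 : ℕ) : ℂ) - 1) / 3 =
      Real.pi * Complex.I * ((j : ℂ) - 1) / 3 + Real.pi * Complex.I := by push_cast; ring
  rw [kap, h, Complex.exp_add, Complex.exp_pi_mul_I, kap]; ring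

theorem kap_four : kap 4 = -1 := by rw [kap_add_three 1, kap_one]

theorem kap_six : kap 6 = -om := by rw [kap_add_three 3, kap_three]

theorem kap_two : kap 2 = -om ^ 2 := by
  rw [← kap_five, kap_add_three 2, neg_neg]

theorem norm_kap (j : ℕ) : ‖kap j‖ = 1 := by
  have h : kap j = Complex.exp (((Real.pi * ((j : ℝ) - 1) / 3 : ℝ) : ℂ) * Complex.I) := by
    rw [kap]; congr 1; push_cast; ring
  rw [h, Complex.norm_exp_ofReal_mul_I]

theorem kap_cube (j : ℕ) : kap j ^ 3 = 1 ∨ kap j ^ 3 = -1 := by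
  rw [← sq_eq_one_iff, ← pow_mul, kap, ← Complex.exp_nat_mul]
  have : ((3 * 2 : ℕ) : ℂ) * (Real.pi * Complex.I * ((j : ℂ) - 1) / 3) =
      (((j : ℤ) - 1 : ℤ) : ℂ) * (2 * Real.pi * Complex.I) := by push_cast; ring
  rw [this]
  exact Complex.exp_int_mul_two_pi_mul_I _

/-- Γ_i contains the inner segment in direction iκ_i but the outer half-line in the opposite
direction. Together with Γ_j, where κ_j = -κ_i, it fills a full line. -/
theorem mul_I_mem_Gamma (y : ℝ) (i j : ℕ) (hi : i ∈ Finset.Icc 1 6) (hj : j ∈ Finset.Icc 1 6)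
    (hij : kap j = -kap i) : (y : ℂ) * (Complex.I * kap i) ∈ Gamma := by
  refine Or.inr (mem_iUnion₂.2 ?_)
  rcases le_total 0 y with h | h <;> rcases le_total |y| 1 with h' | h'
  · exact ⟨i, hi, Or.inl ⟨y, h, by rwa [abs_of_nonneg h] at h', rfl⟩⟩
  · exact ⟨j, hj, Or.inr ⟨y, by rwa [abs_of_nonneg h] at h', by rw [hij]; ring⟩⟩
  · exact ⟨j, hj, Or.inl ⟨-y, by linarith, by rwa [abs_of_nonpos h] at h', by
      rw [hij]; push_cast; ring⟩⟩
  · exact ⟨i, hi, Or.inr ⟨-y, by rwa [abs_of_nonpos h] at h', by push_cast; ring⟩⟩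

/-- The six rays form the three lines on which k, ωk or ω²k is purely imaginary, and by `cube_re`
the product of those three real parts is Re k³ / 4. In this form the invariance of Γ under rotation
by ω and under inversion is immediate. -/
theorem mem_Gamma_iff (k : ℂ) : k ∈ Gamma ↔ ‖k‖ = 1 ∨ (k ^ 3).re = 0 := by
  constructor
  · rintro (h | h)
    · left; simpa [unitCircle] using h
    · right
      obtain ⟨j, -, h⟩ := mem_iUnion₂.1 h
      have : ∃ r : ℝ, k = r * (Complex.I * kap j) := by
        rcases h with ⟨r, -, -, h⟩ | ⟨r, -, h⟩
        · exact ⟨r, h⟩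
        · exact ⟨-r, by rw [h]; push_cast; ring⟩
      obtain ⟨r, rfl⟩ := this
      have hI : Complex.I ^ 3 = -Complex.I := by
        rw [pow_succ, Complex.I_sq]; ring
      rw [mul_pow, mul_pow, hI]
      rcases kap_cube j with h | h <;> rw [h, ← Complex.ofReal_pow, Complex.re_ofReal_mul] <;> simp
  · rintro (h | h)
    · left; simpa [unitCircle] using h
    · rw [cube_re] at h
      have hk : ∀ u v : ℂ, u * v = 1 → (u * k).re = 0 → k = ((u * k).im : ℂ) * (Complex.I * v) := by
        intro u v huv h0
        have : u * k = (u * k).im * Complex.I := by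
          apply Complex.ext <;> simp_all
        calc k = (u * v) * k := by rw [huv, one_mul]
          _ = v * (u * k) := by ring
          _ = _ := by rw [this]; simp; ring
      have h' : k.re = 0 ∨ (om * k).re = 0 ∨ (om ^ 2 * k).re = 0 := by
        simpa [or_assoc] using h
      rcases h' with h | h | h
      · rw [hk 1 1 (by ring) (by simpa using h), ← kap_one]
        exact mul_I_mem_Gamma _ 1 4 (by simp) (by simp) (kap_add_three 1)
      · rw [hk om (om ^ 2) (by rw [← om_cube]; ring) h, ← kap_five]
        exact mul_I_mem_Gamma _ 5 2 (by simp) (by simp) (by rw [kap_add_three 2, neg_neg])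
      · rw [hk (om ^ 2) om (by rw [← om_cube]; ring) h, ← kap_three]
        exact mul_I_mem_Gamma _ 3 6 (by simp) (by simp) (kap_add_three 3)

/-- Each inner segment and each outer half-line touches the circle. Connectedness serves to show
that Γ cannot hide inside a small disk whose boundary avoids it. -/
theorem isPreconnected_Gamma : IsPreconnected Gamma := by
  have hcirc : IsPreconnected unitCircle :=
    isPreconnected_sphere (by rw [Complex.rank_real_complex]; norm_num) _ _
  have h1 : (1 : ℂ) ∈ unitCircle := by simp [unitCircle]
  refine isPreconnected_of_forall (1 : ℂ) ?_
  rintro y (hy | hy)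
  · exact ⟨unitCircle, fun z hz => Or.inl hz, h1, hy, hcirc⟩
  · obtain ⟨j, hj, hy⟩ := mem_iUnion₂.1 hy
    have hmem : ∀ u : ℂ, ‖u‖ = 1 → u ∈ unitCircle := fun u hu => by simp [unitCircle, hu]
    have hn : ‖Complex.I * kap j‖ = 1 := by rw [norm_mul, norm_kap, Complex.norm_I, one_mul]
    rcases hy with hy | hy
    · refine ⟨unitCircle ∪ {k | ∃ r : ℝ, 0 ≤ r ∧ r ≤ 1 ∧ k = r * (Complex.I * kap j)},
        ?_, Or.inl h1, Or.inr hy, ?_⟩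
      · refine union_subset (fun z hz => Or.inl hz) fun z hz => Or.inr ?_
        exact mem_iUnion₂.2 ⟨j, hj, Or.inl hz⟩
      · refine hcirc.union (Complex.I * kap j) (hmem _ hn) ⟨1, zero_le_one, le_rfl, by simp⟩ ?_
        have : {k : ℂ | ∃ r : ℝ, 0 ≤ r ∧ r ≤ 1 ∧ k = r * (Complex.I * kap j)} =
            (fun r : ℝ => (r : ℂ) * (Complex.I * kap j)) '' Icc 0 1 := by
          ext z; simp [and_assoc, eq_comm]
        rw [this]
        exact isPreconnected_Icc.image _ (by fun_prop)
    · refine ⟨unitCircle ∪ {k | ∃ r : ℝ, 1 ≤ r ∧ k = r * (-(Complex.I * kap j))},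
        ?_, Or.inl h1, Or.inr hy, ?_⟩
      · refine union_subset (fun z hz => Or.inl hz) fun z hz => Or.inr ?_
        exact mem_iUnion₂.2 ⟨j, hj, Or.inr hz⟩
      · refine hcirc.union (-(Complex.I * kap j)) (hmem _ (by rw [norm_neg, hn]))
          ⟨1, le_rfl, by simp⟩ ?_
        have : {k : ℂ | ∃ r : ℝ, 1 ≤ r ∧ k = r * (-(Complex.I * kap j))} =
            (fun r : ℝ => (r : ℂ) * (-(Complex.I * kap j))) '' Ici 1 := by
          ext z; simp [eq_comm]
        rw [this]
        exact isPreconnected_Ici.image _ (by fun_prop)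

/-! ### The two sectors around the real axis -/

/-- `{|k| > 1, |arg k| < π/6}`. -/
def outerSector : Set ℂ := {k | 1 < ‖k‖ ∧ (om * k).re < 0 ∧ (om ^ 2 * k).re < 0}

/-- `{|k| < 1, |arg k| > 5π/6}`. -/
def innerSector : Set ℂ := {k | ‖k‖ < 1 ∧ 0 < (om * k).re ∧ 0 < (om ^ 2 * k).re}

/-- The union of the two sectors. -/
def sectors : Set ℂ := outerSector ∪ innerSector

theorem isOpen_outerSector : IsOpen outerSector :=
  (isOpen_lt continuous_const continuous_norm).inter
    ((isOpen_lt (Complex.continuous_re.comp (by fun_prop)) continuous_const).inter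
      (isOpen_lt (Complex.continuous_re.comp (by fun_prop)) continuous_const))

theorem isOpen_innerSector : IsOpen innerSector :=
  (isOpen_lt continuous_norm continuous_const).inter
    ((isOpen_lt continuous_const (Complex.continuous_re.comp (by fun_prop))).inter
      (isOpen_lt continuous_const (Complex.continuous_re.comp (by fun_prop))))

theorem isOpen_sectors : IsOpen sectors := isOpen_outerSector.union isOpen_innerSector

theorem re_add_re_add_re (k : ℂ) : k.re + (om * k).re + (om ^ 2 * k).re = 0 := by
  rw [om_mul_re, om_sq_mul_re]; ring

theorem cube_re_pos_of_mem_outerSector {k : ℂ} (hk : k ∈ outerSector) : 0 < (k ^ 3).re := by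
  rw [cube_re]
  have := re_add_re_add_re k
  obtain ⟨-, h1, h2⟩ := hk
  have h3 : 0 < k.re := by linarith
  have := mul_pos_of_neg_of_neg h1 h2
  rw [mul_assoc]; positivity

theorem cube_re_neg_of_mem_innerSector {k : ℂ} (hk : k ∈ innerSector) : (k ^ 3).re < 0 := by
  rw [cube_re]
  have := re_add_re_add_re k
  obtain ⟨-, h1, h2⟩ := hk
  have h3 : k.re < 0 := by linarith
  have := mul_pos h1 h2
  rw [mul_assoc]; nlinarith

theorem disjoint_sectors_Gamma : Disjoint sectors Gamma := by
  rw [Set.disjoint_left]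
  rintro k (hk | hk) h
  · rcases (mem_Gamma_iff k).1 h with h | h
    · exact hk.1.ne' h
    · exact (cube_re_pos_of_mem_outerSector hk).ne' h
  · rcases (mem_Gamma_iff k).1 h with h | h
    · exact hk.1.ne h
    · exact (cube_re_neg_of_mem_innerSector hk).ne h

/-- A connected set avoiding `Γ` which meets the sectors stays in them. -/
theorem subset_sectors_of_isPreconnected {K : Set ℂ} (hK : IsPreconnected K)
    (hd : Disjoint K Gamma) (hne : (K ∩ sectors).Nonempty) : K ⊆ sectors := by
  -- The sectors with non-strict inequalities. Off Γ no inequality can be an equality, so there the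
  -- sectors are both open and closed.
  set C : Set ℂ := {k | 1 ≤ ‖k‖ ∧ (om * k).re ≤ 0 ∧ (om ^ 2 * k).re ≤ 0} ∪
    {k | ‖k‖ ≤ 1 ∧ 0 ≤ (om * k).re ∧ 0 ≤ (om ^ 2 * k).re} with hC
  have hCc : IsClosed C :=
    ((isClosed_le continuous_const continuous_norm).inter
      ((isClosed_le (Complex.continuous_re.comp (by fun_prop)) continuous_const).inter
        (isClosed_le (Complex.continuous_re.comp (by fun_prop)) continuous_const))).union
    ((isClosed_le continuous_norm continuous_const).inter
      ((isClosed_le continuous_const (Complex.continuous_re.comp (by fun_prop))).inter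
        (isClosed_le continuous_const (Complex.continuous_re.comp (by fun_prop)))))
  refine hK.subset_left_of_subset_union isOpen_sectors hCc.isOpen_compl ?_ ?_ hne
  · rw [Set.disjoint_left]
    rintro k hk h
    apply h
    rcases hk with ⟨h1, h2, h3⟩ | ⟨h1, h2, h3⟩
    · exact Or.inl ⟨h1.le, h2.le, h3.le⟩
    · exact Or.inr ⟨h1.le, h2.le, h3.le⟩
  · intro k hk
    by_cases hkC : k ∈ C
    · left
      have hG : ¬ (‖k‖ = 1 ∨ (k ^ 3).re = 0) := fun h =>
        Set.disjoint_left.1 hd hk ((mem_Gamma_iff k).2 h)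
      rw [cube_re] at hG
      push Not at hG
      obtain ⟨hn, hp⟩ := hG
      have ha : (om * k).re ≠ 0 := by rintro h; simp [h] at hp
      have hb : (om ^ 2 * k).re ≠ 0 := by rintro h; simp [h] at hp
      rcases hkC with ⟨h1, h2, h3⟩ | ⟨h1, h2, h3⟩
      · exact Or.inl ⟨lt_of_le_of_ne h1 hn.symm, lt_of_le_of_ne h2 ha, lt_of_le_of_ne h3 hb⟩
      · exact Or.inr ⟨lt_of_le_of_ne h1 hn, lt_of_le_of_ne h2 ha.symm, lt_of_le_of_ne h3 hb.symm⟩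
    · exact Or.inr hkC

theorem conj_mem_outerSector {k : ℂ} (hk : k ∈ outerSector) :
    (starRingEnd ℂ) k ∈ outerSector := by
  obtain ⟨h1, h2, h3⟩ := hk
  refine ⟨by simpa using h1, ?_, ?_⟩
  · rw [om_mul_re] ; rw [om_sq_mul_re] at h3; simp; linarith
  · rw [om_sq_mul_re]; rw [om_mul_re] at h2; simp; linarith

theorem conj_mem_innerSector {k : ℂ} (hk : k ∈ innerSector) :
    (starRingEnd ℂ) k ∈ innerSector := by
  obtain ⟨h1, h2, h3⟩ := hk
  refine ⟨by simpa using h1, ?_, ?_⟩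
  · rw [om_mul_re] ; rw [om_sq_mul_re] at h3; simp; linarith
  · rw [om_sq_mul_re]; rw [om_mul_re] at h2; simp; linarith

theorem conj_mem_sectors {k : ℂ} (hk : k ∈ sectors) : (starRingEnd ℂ) k ∈ sectors :=
  hk.imp conj_mem_outerSector conj_mem_innerSector

/-! ### Polar description of the sectors and their images under the symmetries -/

theorem mul_exp_re_aux (r a b : ℝ) :
    ((r : ℂ) * Complex.exp (a * Complex.I) * Complex.exp (b * Complex.I)).re =
      r * Real.cos (a + b) := by
  rw [mul_assoc, ← Complex.exp_add, ← add_mul, ← Complex.ofReal_add, Complex.re_ofReal_mul,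
    Complex.exp_ofReal_mul_I_re]

theorem om_eq_exp : om = Complex.exp ((2 * Real.pi / 3 : ℝ) * Complex.I) := by
  rw [om]; congr 1; push_cast; ring

theorem om_sq_eq_exp : om ^ 2 = Complex.exp ((-(2 * Real.pi / 3) : ℝ) * Complex.I) := by
  rw [← conj_om, om_eq_exp, ← Complex.exp_conj, map_mul, Complex.conj_I, Complex.conj_ofReal]
  congr 1; push_cast; ring

theorem om_mul_polar_re (r θ : ℝ) :
    (om * (r * Complex.exp (θ * Complex.I))).re = r * Real.cos (θ + 2 * Real.pi / 3) := by
  rw [mul_comm om, om_eq_exp, mul_exp_re_aux]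

theorem om_sq_mul_polar_re (r θ : ℝ) :
    (om ^ 2 * (r * Complex.exp (θ * Complex.I))).re = r * Real.cos (θ - 2 * Real.pi / 3) := by
  rw [mul_comm (om ^ 2), om_sq_eq_exp, mul_exp_re_aux]; ring_nf

theorem polar_mem_outerSector {r θ : ℝ} (hr : 1 < r) (hθ : |θ| < Real.pi / 6) :
    (r : ℂ) * Complex.exp (θ * Complex.I) ∈ outerSector := by
  have hr0 : 0 < r := by linarith
  have hpi := Real.pi_pos
  rw [abs_lt] at hθ
  refine ⟨?_, ?_, ?_⟩
  · rw [norm_mul, Complex.norm_exp_ofReal_mul_I, mul_one, Complex.norm_real,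
      Real.norm_of_nonneg hr0.le]
    exact hr
  · rw [om_mul_polar_re]
    exact mul_neg_of_pos_of_neg hr0
      (Real.cos_neg_of_pi_div_two_lt_of_lt (by linarith) (by linarith))
  · rw [om_sq_mul_polar_re, ← Real.cos_neg]
    exact mul_neg_of_pos_of_neg hr0
      (Real.cos_neg_of_pi_div_two_lt_of_lt (by linarith) (by linarith))

theorem D2_subset_sectors {k : ℂ} (hk0 : k ≠ 0) (hk : k ∈ D2) : k ∈ sectors := by
  have hp := Complex.norm_mul_exp_arg_mul_I k
  have hpi := Real.pi_pos
  rcases hk with ⟨h1, h2⟩ | ⟨h1, h2⟩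
  · left
    rw [← hp]
    exact polar_mem_outerSector h1 h2
  · right
    have hr0 : 0 < ‖k‖ := norm_pos_iff.2 hk0
    have h3 := Complex.arg_le_pi k
    have h4 := Complex.neg_pi_lt_arg k
    refine ⟨h1, ?_, ?_⟩
    · rw [← hp, om_mul_polar_re]
      refine mul_pos hr0 ?_
      rcases lt_abs.1 h2 with h | h
      · rw [← Real.cos_sub_two_pi]
        exact Real.cos_pos_of_mem_Ioo ⟨by linarith, by linarith⟩
      · exact Real.cos_pos_of_mem_Ioo ⟨by linarith, by linarith⟩
    · rw [← hp, om_sq_mul_polar_re]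
      refine mul_pos hr0 ?_
      rcases lt_abs.1 h2 with h | h
      · exact Real.cos_pos_of_mem_Ioo ⟨by linarith, by linarith⟩
      · rw [← Real.cos_add_two_pi]
        exact Real.cos_pos_of_mem_Ioo ⟨by linarith, by linarith⟩

theorem ne_zero_of_mem_Dreg {k : ℂ} (hk : k ∈ Dreg) : k ≠ 0 := by
  rintro rfl
  rcases hk.2 with h | h
  · have := h.1; simp at this; linarith
  · have := h.2; simp at this

theorem ofReal_mem_sectors {a : ℝ} (ha : a ∈ Ioo (-1 : ℝ) 0 ∨ a ∈ Ioi (1 : ℝ)) :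
    (a : ℂ) ∈ sectors := by
  rcases ha with ha | ha
  · right
    refine ⟨?_, ?_, ?_⟩
    · rw [Complex.norm_real, Real.norm_eq_abs, abs_lt]; exact ⟨ha.1, by linarith [ha.2]⟩
    · rw [om_mul_re]; simp; exact ha.2
    · rw [om_sq_mul_re]; simp; exact ha.2
  · left
    have h0 : (0 : ℝ) < a := lt_trans one_pos ha
    refine ⟨?_, ?_, ?_⟩
    · rw [Complex.norm_real, Real.norm_of_nonneg h0.le]; exact ha
    · rw [om_mul_re]; simp; linarith
    · rw [om_sq_mul_re]; simp; linarith

theorem ne_zero_of_mem_sectors {k : ℂ} (hk : k ∈ sectors) : k ≠ 0 := by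
  rintro rfl
  rcases hk with h | h
  · have := h.2.1; simp at this
  · have := h.2.1; simp at this

/-- The real parts of k, ωk, ω²k sum to 0. In a sector the last two share a sign opposite to the
first, and a rotation permutes the three numbers, which spoils this pattern. -/
theorem sectors_rotation {k : ℂ} (hk : k ∈ sectors) : om * k ∉ sectors ∧ om ^ 2 * k ∉ sectors := by
  have h1 := re_add_re_add_re k
  have e1 : om ^ 2 * (om * k) = k := by
    rw [← mul_assoc, ← pow_succ, om_cube, one_mul]
  have e2 : om * (om ^ 2 * k) = k := by rw [← mul_assoc, ← pow_succ', om_cube, one_mul]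
  have n1 : ‖om * k‖ = ‖k‖ := by rw [norm_mul, norm_om, one_mul]
  have n2 : ‖om ^ 2 * k‖ = ‖k‖ := by rw [norm_mul, norm_pow, norm_om, one_pow, one_mul]
  constructor <;> rintro (⟨a, b, c⟩ | ⟨a, b, c⟩) <;> rcases hk with ⟨d, e, f⟩ | ⟨d, e, f⟩ <;>
    simp only [e1, e2, n1, n2] at a b c <;> linarith

/-- Inversion exchanges |k| < 1 and |k| > 1 but keeps the sign of Re k³, whereas the sectors tie |k|
> 1 to a positive sign and |k| < 1 to a negative one. Assuming only the cube of q treats all ω^j k⁻¹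
at once. -/
theorem sectors_inversion {k q : ℂ} (hk : k ∈ sectors) (hq : q ^ 3 = (k ^ 3)⁻¹) :
    q ∉ sectors := by
  have hk0 := ne_zero_of_mem_sectors hk
  have hn : ‖q‖ = ‖k‖⁻¹ := by
    have : ‖q‖ ^ 3 = (‖k‖⁻¹) ^ 3 := by rw [← norm_pow, hq, norm_inv, norm_pow, inv_pow]
    exact (pow_left_inj₀ (norm_nonneg _) (by positivity) (by norm_num)).1 this
  have hre : (q ^ 3).re = (k ^ 3).re / Complex.normSq (k ^ 3) := by rw [hq, Complex.inv_re]
  have hpos : 0 < Complex.normSq (k ^ 3) := Complex.normSq_pos.2 (pow_ne_zero _ hk0)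
  intro hqs
  rcases hk with hk | hk
  · have h1 := cube_re_pos_of_mem_outerSector hk
    have h2 : 0 < (q ^ 3).re := by rw [hre]; positivity
    rcases hqs with h | h
    · have := h.1
      rw [hn] at this
      exact absurd (inv_lt_one_of_one_lt₀ hk.1) (not_lt.2 this.le)
    · exact absurd (cube_re_neg_of_mem_innerSector h) (not_lt.2 h2.le)
  · have h1 := cube_re_neg_of_mem_innerSector hk
    have h2 : (q ^ 3).re < 0 := by rw [hre]; exact div_neg_of_neg_of_pos h1 hpos
    rcases hqs with h | h
    · exact absurd (cube_re_pos_of_mem_outerSector h) (not_lt.2 h2.le)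
    · have h3 := h.1
      rw [hn] at h3
      have := (one_lt_inv₀ (norm_pos_iff.2 hk0)).2 hk.1
      linarith

/-- Every point off `Γ` is mapped into the sectors by one of the symmetries. -/
theorem exists_rotation_mem_sectors {k : ℂ}
    (hs : (1 < ‖k‖ ∧ 0 < (k ^ 3).re) ∨ (‖k‖ < 1 ∧ (k ^ 3).re < 0)) :
    k ∈ sectors ∨ om * k ∈ sectors ∨ om ^ 2 * k ∈ sectors := by
  have h1 := re_add_re_add_re k
  have e1 : om ^ 2 * (om * k) = k := by
    rw [← mul_assoc, ← pow_succ, om_cube, one_mul]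
  have e2 : om * (om ^ 2 * k) = k := by rw [← mul_assoc, ← pow_succ', om_cube, one_mul]
  have e3 : om * (om * k) = om ^ 2 * k := by ring
  have e4 : om ^ 2 * (om ^ 2 * k) = om * k := by
    rw [← mul_assoc, ← pow_add, show 2 + 2 = 3 + 1 from rfl, pow_succ, om_cube, one_mul]
  have n1 : ‖om * k‖ = ‖k‖ := by rw [norm_mul, norm_om, one_mul]
  have n2 : ‖om ^ 2 * k‖ = ‖k‖ := by rw [norm_mul, norm_pow, norm_om, one_pow, one_mul]
  rw [cube_re] at hs
  -- Three reals with zero sum and positive product: exactly two are negative.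
  have key : ∀ a b c : ℝ, a + b + c = 0 → 0 < 4 * (a * b * c) →
      (b < 0 ∧ c < 0) ∨ (c < 0 ∧ a < 0) ∨ (a < 0 ∧ b < 0) := by
    intro a b c h hp
    have hp' : 0 < a * b * c := by linarith
    rcases lt_trichotomy a 0 with ha | ha | ha
    · rcases lt_trichotomy b 0 with hb | hb | hb
      · exact Or.inr (Or.inr ⟨ha, hb⟩)
      · simp [hb] at hp'
      · refine Or.inr (Or.inl ⟨?_, ha⟩)
        by_contra hc
        have := mul_nonneg (mul_nonneg (neg_pos.2 ha).le hb.le) (not_lt.1 hc)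
        linarith
    · simp [ha] at hp'
    · rcases lt_trichotomy b 0 with hb | hb | hb
      · refine Or.inl ⟨hb, ?_⟩
        by_contra hc
        have := mul_nonneg (mul_nonneg ha.le (neg_pos.2 hb).le) (not_lt.1 hc)
        linarith
      · simp [hb] at hp'
      · exfalso
        have : c < 0 := by linarith
        have := mul_pos (mul_pos ha hb) (neg_pos.2 this)
        linarith
  simp only [sectors, mem_union, outerSector, innerSector, mem_ofPred_eq, e1, e2, e3, e4, n1, n2]
  rcases hs with ⟨hn, hp⟩ | ⟨hn, hp⟩
  · rcases key _ _ _ h1 hp with h | h | h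
    · exact Or.inl (Or.inl ⟨hn, h⟩)
    · exact Or.inr (Or.inl (Or.inl ⟨hn, h⟩))
    · exact Or.inr (Or.inr (Or.inl ⟨hn, h⟩))
  · have := key (-k.re) (-(om * k).re) (-(om ^ 2 * k).re) (by linarith) (by
      have : 4 * (-k.re * -(om * k).re * -(om ^ 2 * k).re) =
        -(4 * (k.re * (om * k).re * (om ^ 2 * k).re)) := by ring
      linarith)
    simp only [neg_neg_iff_pos] at this
    rcases this with h | h | h
    · exact Or.inl (Or.inr ⟨hn, h⟩)
    · exact Or.inr (Or.inl (Or.inr ⟨hn, h⟩))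
    · exact Or.inr (Or.inr (Or.inr ⟨hn, h⟩))

end Bsq

namespace Bsq

/-! ### The small circles -/

section Circles

variable {r1 r2 : ℂ → ℂ} {Z : Finset ℂ} {c : ℂ → ℂ} {ε : ℝ}

/-- The points `k₀`, `k̄₀`, as a finite set. -/
def centerSet (Z : Finset ℂ) : Finset ℂ := by
  classical exact Z ∪ Z.image (starRingEnd ℂ)

theorem mem_centerSet {p : ℂ} : p ∈ centerSet Z ↔ p ∈ centers Z := by
  classical
  simp only [centerSet, Finset.mem_union, Finset.mem_image, centers, mem_ofPred_eq]
  refine or_congr_right ⟨?_, fun h => ⟨_, h, Complex.conj_conj p⟩⟩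
  rintro ⟨q, hq, rfl⟩
  rwa [Complex.conj_conj]

theorem conj_mem_centers {p : ℂ} (hp : p ∈ centers Z) : (starRingEnd ℂ) p ∈ centers Z := by
  rcases hp with h | h
  · exact Or.inr (by rwa [Complex.conj_conj])
  · exact Or.inl h

theorem centers_subset_sectors (hd : IsScatteringData r1 r2 Z c) : centers Z ⊆ sectors := by
  have key : ∀ p ∈ Z, p ∈ sectors := by
    intro p hp
    rcases hd.zeros_mem p hp with h | ⟨a, rfl, ha⟩
    · exact D2_subset_sectors (ne_zero_of_mem_Dreg h) h.1
    · exact ofReal_mem_sectors ha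
  rintro p (hp | hp)
  · exact key p hp
  · simpa using conj_mem_sectors (key _ hp)

theorem symMap_zero_false (k : ℂ) : symMap 0 false k = k := by simp [symMap]

theorem sphere_subset_bdryD {p : ℂ} (hp : p ∈ centers Z) : Metric.sphere p ε ⊆ bdryD Z ε := by
  intro k hk
  exact ⟨p, hp, 0, false, k, hk, symMap_zero_false k⟩

theorem sphere_subset_GammaTilde {p : ℂ} (hp : p ∈ centers Z) :
    Metric.sphere p ε ⊆ GammaTilde Z ε :=
  (sphere_subset_bdryD hp).trans subset_union_right

/-- Admissibility speaks only of the circle. If Γ met the open disk it would, being connected and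
disjoint from the circle, lie inside it, but Γ is unbounded. -/
theorem disjoint_closedBall_Gamma (hε : AdmissibleRadius Z ε) {p : ℂ} (hp : p ∈ centers Z) :
    Disjoint (Metric.closedBall p ε) Gamma := by
  have hs : Disjoint (Metric.sphere p ε) Gamma := hε.2.1.mono_left (sphere_subset_bdryD hp)
  rw [← Metric.ball_union_sphere, disjoint_union_left]
  refine ⟨?_, hs⟩
  by_contra hne
  rw [Set.not_disjoint_iff] at hne
  obtain ⟨q, hq, hqG⟩ := hne
  have hsub : Gamma ⊆ Metric.ball p ε := by
    refine isPreconnected_Gamma.subset_left_of_subset_union Metric.isOpen_ball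
      Metric.isClosed_closedBall.isOpen_compl
      (disjoint_compl_right.mono_left Metric.ball_subset_closedBall) ?_ ⟨q, hqG, hq⟩
    intro k hk
    rcases lt_trichotomy (dist k p) ε with h | h | h
    · exact Or.inl h
    · exact (Set.disjoint_left.1 hs h hk).elim
    · exact Or.inr (by simpa using h)
  -- The point iR of Γ has distance at least R - ‖p‖ = ε from p.
  set R : ℝ := ‖p‖ + ε with hR
  have hRnn : 0 ≤ R := add_nonneg (norm_nonneg _) hε.1.le
  have hmem : (R : ℂ) * Complex.I ∈ Gamma := by
    rw [mem_Gamma_iff]; right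
    have : ((R : ℂ) * Complex.I) ^ 3 = ((R ^ 3 : ℝ) : ℂ) * -Complex.I := by
      rw [mul_pow, Complex.I_pow_three]; push_cast; ring
    rw [this, Complex.re_ofReal_mul]; simp
  have h1 := hsub hmem
  rw [Metric.mem_ball, dist_eq_norm] at h1
  have h2 := norm_sub_norm_le ((R : ℂ) * Complex.I) p
  rw [norm_mul, Complex.norm_I, mul_one, Complex.norm_real, Real.norm_of_nonneg hRnn] at h2
  linarith

theorem closedBall_subset_sectors (hd : IsScatteringData r1 r2 Z c) (hε : AdmissibleRadius Z ε)
    {p : ℂ} (hp : p ∈ centers Z) : Metric.closedBall p ε ⊆ sectors :=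
  subset_sectors_of_isPreconnected (convex_closedBall p ε).isPreconnected
    (disjoint_closedBall_Gamma hε hp)
    ⟨p, Metric.mem_closedBall_self hε.1.le, centers_subset_sectors hd hp⟩

/-- Circles around centers lie in the sectors, and their rotated or inverted copies are moved out of
them. Hence in the sectors only the unrotated, uninverted circles remain of the contour. -/
theorem mem_sphere_of_mem_sectors_of_mem_GammaTilde (hd : IsScatteringData r1 r2 Z c)
    (hε : AdmissibleRadius Z ε) {k : ℂ} (hk : k ∈ sectors) (hkG : k ∈ GammaTilde Z ε) :
    ∃ p ∈ centers Z, dist k p = ε := by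
  rcases hkG with h | ⟨p, hp, j, inv, q, hq, rfl⟩
  · exact (Set.disjoint_left.1 disjoint_sectors_Gamma hk h).elim
  have hqs : q ∈ sectors := closedBall_subset_sectors hd hε hp (Metric.sphere_subset_closedBall hq)
  cases inv
  · fin_cases j
    · exact ⟨p, hp, (congrArg (fun z => dist z p) (symMap_zero_false q)).trans hq⟩
    · exact ((sectors_rotation hqs).1 (by simpa [symMap] using hk)).elim
    · exact ((sectors_rotation hqs).2 (by simpa [symMap] using hk)).elim
  · refine (sectors_inversion hqs ?_ hk).elim
    simp only [symMap, if_true]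
    rw [mul_pow, ← pow_mul, mul_comm (j : ℕ), pow_mul, om_cube, one_pow, one_mul, inv_pow]

/-- Two circles of equal radius whose distinct centers are at most 2ε apart meet on the
perpendicular bisector of the centers, at height found by Pythagoras. So disjoint circles of equal
radius bound disjoint disks. -/
theorem two_mul_lt_dist (hε : AdmissibleRadius Z ε) {p p' : ℂ} (hp : p ∈ centers Z)
    (hp' : p' ∈ centers Z) (hne : p ≠ p') : 2 * ε < dist p p' := by
  by_contra! hle
  have hdis := hε.2.2 p hp p' hp' 0 0 false false (by simp [hne])
  have hd0 : 0 < ‖p' - p‖ := norm_pos_iff.2 (sub_ne_zero.2 hne.symm)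
  rw [dist_comm, dist_eq_norm] at hle
  have h1 : 0 ≤ ε ^ 2 / ‖p' - p‖ ^ 2 - 1 / 4 := by
    rw [sub_nonneg, le_div_iff₀ (by positivity)]
    nlinarith
  set s := Real.sqrt (ε ^ 2 / ‖p' - p‖ ^ 2 - 1 / 4) with hs
  have hs2 : s ^ 2 = ε ^ 2 / ‖p' - p‖ ^ 2 - 1 / 4 := Real.sq_sqrt h1
  have hn : ∀ a : ℝ, a ^ 2 = 1 / 4 → ‖(p' - p) * ⟨a, s⟩‖ = ε := by
    intro a ha
    have : ‖(p' - p) * ⟨a, s⟩‖ ^ 2 = ε ^ 2 := by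
      rw [norm_mul, mul_pow, Complex.sq_norm ⟨a, s⟩, Complex.normSq_mk]
      have : a * a + s * s = ε ^ 2 / ‖p' - p‖ ^ 2 := by nlinarith
      rw [this]; field_simp
    exact (pow_left_inj₀ (norm_nonneg _) hε.1.le (by norm_num)).1 this
  have hnot : ¬ Disjoint (smallCircle ε p ((0 : Fin 3) : ℕ) false).carrier
      (smallCircle ε p' ((0 : Fin 3) : ℕ) false).carrier := by
    refine Set.not_disjoint_iff.2 ⟨p + (p' - p) * ⟨1 / 2, s⟩, ⟨_, ?_, symMap_zero_false _⟩,
      ⟨_, ?_, symMap_zero_false _⟩⟩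
    · rw [Metric.mem_sphere, dist_eq_norm, add_sub_cancel_left]
      exact hn _ (by norm_num)
    · rw [Metric.mem_sphere, dist_eq_norm]
      have : p + (p' - p) * ⟨1 / 2, s⟩ - p' = (p' - p) * ⟨-1 / 2, s⟩ := by
        have e : (⟨-1 / 2, s⟩ : ℂ) = ⟨1 / 2, s⟩ - 1 := by
          apply Complex.ext <;> simp; norm_num
        rw [e]; ring
      rw [this]
      exact hn _ (by norm_num)
  exact hnot hdis

theorem notMem_closedBall_of_mem_closedBall (hε : AdmissibleRadius Z ε) {p p' k : ℂ}
    (hp : p ∈ centers Z) (hp' : p' ∈ centers Z) (hne : p' ≠ p) (hk : k ∈ Metric.closedBall p ε) :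
    k ∉ Metric.closedBall p' ε := by
  intro hk'
  have h1 := two_mul_lt_dist hε hp hp' hne.symm
  have h2 := dist_triangle_left p p' k
  rw [Metric.mem_closedBall] at hk hk'
  linarith

theorem om_pow_mul_om_mul (j : Fin 3) (q : ℂ) :
    ∃ j' : Fin 3, om * (om ^ (j : ℕ) * q) = om ^ (j' : ℕ) * q := by
  refine ⟨j + 1, ?_⟩
  rw [← mul_assoc, ← pow_succ']
  fin_cases j <;> simp [om_cube]

theorem om_pow_inv (j : Fin 3) : ∃ j' : Fin 3, (om ^ (j : ℕ))⁻¹ = om ^ (j' : ℕ) := by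
  refine ⟨-j, ?_⟩
  refine inv_eq_of_mul_eq_one_right ?_
  rw [← pow_add]
  have : (j : ℕ) + ((-j : Fin 3) : ℕ) = 0 ∨ (j : ℕ) + ((-j : Fin 3) : ℕ) = 3 := by
    revert j; decide
  rcases this with h | h <;> simp [h, om_cube]

theorem om_mul_mem_GammaTilde {k : ℂ} (hk : k ∈ GammaTilde Z ε) : om * k ∈ GammaTilde Z ε := by
  rcases hk with h | ⟨p, hp, j, inv, q, hq, rfl⟩
  · left
    rw [mem_Gamma_iff] at h ⊢
    rwa [norm_mul, norm_om, one_mul, mul_pow, om_cube, one_mul]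
  · right
    obtain ⟨j', hj'⟩ := om_pow_mul_om_mul j (if inv then q⁻¹ else q)
    exact ⟨p, hp, j', inv, q, hq, hj'.symm⟩

theorem inv_mem_GammaTilde {k : ℂ} (hk : k ∈ GammaTilde Z ε) : k⁻¹ ∈ GammaTilde Z ε := by
  rcases hk with h | ⟨p, hp, j, inv, q, hq, rfl⟩
  · left
    rw [mem_Gamma_iff] at h ⊢
    rw [norm_inv, inv_eq_one, inv_pow, Complex.inv_re, div_eq_zero_iff]
    tauto
  · right
    obtain ⟨j', hj'⟩ := om_pow_inv j
    refine ⟨p, hp, j', !inv, q, hq, ?_⟩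
    simp only [symMap, mul_inv, hj']
    cases inv <;> simp

theorem om_mul_notMem_GammaTilde {k : ℂ} (hk : k ∉ GammaTilde Z ε) :
    om * k ∉ GammaTilde Z ε := by
  intro h
  have := om_mul_mem_GammaTilde (om_mul_mem_GammaTilde h)
  rw [← mul_assoc, ← mul_assoc, ← sq, ← pow_succ, om_cube, one_mul] at this
  exact hk this

theorem inv_notMem_GammaTilde {k : ℂ} (hk : k ∉ GammaTilde Z ε) : k⁻¹ ∉ GammaTilde Z ε := by
  intro h
  have := inv_mem_GammaTilde h
  rw [inv_inv] at this
  exact hk this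

end Circles

end Bsq

namespace Bsq

/-! ### Removing the small circles -/

section Meromorphic

variable {r1 r2 : ℂ → ℂ} {Z : Finset ℂ} {c : ℂ → ℂ} {ε x t : ℝ} {n : ℂ → Fin 3 → ℂ}

/-- The scalar pole of the jump matrices attached to `p ∈ Z`. -/
def poleP (p c e k : ℂ) : ℂ := c * e / (k - p) * ((k ^ 2 - om) / (p ^ 2 - om))

/-- The scalar pole of the jump matrices attached to `p`, `p̄ ∈ Z \ ℝ`. -/
def poleQ (p c e k : ℂ) : ℂ :=
  (starRingEnd ℂ) c * e / (k - p) * ((k ^ 2 - 1) / (om ^ 2 * (om ^ 2 - p ^ 2)))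

/-- The polar term which continues the solution from outside to inside the small circle
around `p`. -/
def poleTerm (Z : Finset ℂ) (c : ℂ → ℂ) (x t : ℝ) (p k : ℂ) (u : Fin 3 → ℂ) : Fin 3 → ℂ := by
  classical exact
  if p.im = 0 then ![0, u 0 * poleP p (c p) (Complex.exp (-theta 2 1 x t p)) k, 0]
  else if p ∈ Z then ![0, 0, u 0 * poleP p (c p) (Complex.exp (-theta 3 1 x t p)) k]
  else ![0, u 2 * poleQ p (c ((starRingEnd ℂ) p)) (Complex.exp (theta 3 2 x t p)) k, 0]

theorem poleTerm_real {p : ℂ} (hp : p.im = 0) (k : ℂ) (u : Fin 3 → ℂ) :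
    poleTerm Z c x t p k u =
      ![0, u 0 * poleP p (c p) (Complex.exp (-theta 2 1 x t p)) k, 0] := by
  simp [poleTerm, hp]

theorem poleTerm_mem {p : ℂ} (hp : p.im ≠ 0) (hpZ : p ∈ Z) (k : ℂ) (u : Fin 3 → ℂ) :
    poleTerm Z c x t p k u =
      ![0, 0, u 0 * poleP p (c p) (Complex.exp (-theta 3 1 x t p)) k] := by
  simp [poleTerm, hp, hpZ]

theorem poleTerm_notMem {p : ℂ} (hp : p.im ≠ 0) (hpZ : p ∉ Z) (k : ℂ) (u : Fin 3 → ℂ) :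
    poleTerm Z c x t p k u =
      ![0, u 2 * poleQ p (c ((starRingEnd ℂ) p)) (Complex.exp (theta 3 2 x t p)) k, 0] := by
  simp [poleTerm, hp, hpZ]

theorem differentiableAt_poleP {p c e k : ℂ} (hk : k ≠ p) : DifferentiableAt ℂ (poleP p c e) k := by
  unfold poleP
  have := sub_ne_zero.2 hk
  fun_prop (disch := assumption)

theorem differentiableAt_poleQ {p c e k : ℂ} (hk : k ≠ p) : DifferentiableAt ℂ (poleQ p c e) k := by
  unfold poleQ
  have := sub_ne_zero.2 hk
  fun_prop (disch := assumption)

theorem tendsto_vec3 {α : Type*} {F : Filter α} {f g h : α → ℂ} {a b d : ℂ}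
    (hf : Tendsto f F (𝓝 a)) (hg : Tendsto g F (𝓝 b)) (hh : Tendsto h F (𝓝 d)) :
    Tendsto (fun z => ![f z, g z, h z]) F (𝓝 ![a, b, d]) := by
  rw [tendsto_pi_nhds]
  intro i
  fin_cases i
  · exact hf
  · exact hg
  · exact hh

theorem differentiableAt_vec3 {f g h : ℂ → ℂ} {z : ℂ}
    (hf : DifferentiableAt ℂ f z) (hg : DifferentiableAt ℂ g z) (hh : DifferentiableAt ℂ h z) :
    DifferentiableAt ℂ (fun z => ![f z, g z, h z]) z := by
  rw [differentiableAt_pi]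
  intro i
  fin_cases i
  · exact hf
  · exact hg
  · exact hh

theorem tendsto_poleTerm {α : Type*} {F : Filter α} {p k : ℂ} (hk : k ≠ p) {κ : α → ℂ}
    {u : α → Fin 3 → ℂ} {u₀ : Fin 3 → ℂ} (hκ : Tendsto κ F (𝓝 k)) (hu : Tendsto u F (𝓝 u₀)) :
    Tendsto (fun a => poleTerm Z c x t p (κ a) (u a)) F (𝓝 (poleTerm Z c x t p k u₀)) := by
  rw [tendsto_pi_nhds] at hu
  by_cases h1 : p.im = 0
  · simp only [poleTerm_real h1]
    exact tendsto_vec3 tendsto_const_nhds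
      ((hu 0).mul ((differentiableAt_poleP hk).continuousAt.tendsto.comp hκ)) tendsto_const_nhds
  · by_cases h2 : p ∈ Z
    · simp only [poleTerm_mem h1 h2]
      exact tendsto_vec3 tendsto_const_nhds tendsto_const_nhds
        ((hu 0).mul ((differentiableAt_poleP hk).continuousAt.tendsto.comp hκ))
    · simp only [poleTerm_notMem h1 h2]
      exact tendsto_vec3 tendsto_const_nhds
        ((hu 2).mul ((differentiableAt_poleQ hk).continuousAt.tendsto.comp hκ)) tendsto_const_nhds

theorem differentiableAt_poleTerm {p k : ℂ} (hk : k ≠ p) {u : ℂ → Fin 3 → ℂ}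
    (hu : DifferentiableAt ℂ u k) :
    DifferentiableAt ℂ (fun z => poleTerm Z c x t p z (u z)) k := by
  rw [differentiableAt_pi] at hu
  by_cases h1 : p.im = 0
  · simp only [poleTerm_real h1]
    exact differentiableAt_vec3 (differentiableAt_const _)
      ((hu 0).mul (differentiableAt_poleP hk)) (differentiableAt_const _)
  · by_cases h2 : p ∈ Z
    · simp only [poleTerm_mem h1 h2]
      exact differentiableAt_vec3 (differentiableAt_const _) (differentiableAt_const _)
        ((hu 0).mul (differentiableAt_poleP hk))
    · simp only [poleTerm_notMem h1 h2]
      exact differentiableAt_vec3 (differentiableAt_const _)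
        ((hu 2).mul (differentiableAt_poleQ hk)) (differentiableAt_const _)

theorem smallCircle_zero_false (ε : ℝ) (p : ℂ) : smallCircle ε p ((0 : Fin 3) : ℕ) false =
    ⟨Metric.sphere p ε, Metric.ball p ε, (Metric.closedBall p ε)ᶜ⟩ := by
  have : symMap 0 false = id := by ext k; exact symMap_zero_false k
  simp [smallCircle, this]

theorem extendJump_zero_false (W : ℂ → Matrix (Fin 3) (Fin 3) ℂ) (k : ℂ) :
    extendJump W ((0 : Fin 3) : ℕ) false k = W k := by
  simp [extendJump]

/-- The jump relation across the small circle around `p`, solved for the exterior limit. -/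
theorem exists_limits_of_mem_centers (hn : IsHomogeneousSolution r1 r2 Z c ε x t n) {p : ℂ}
    (hp : p ∈ centers Z) : ∃ np nm : ℂ → Fin 3 → ℂ, ∀ k ∈ Metric.sphere p ε,
      Tendsto n (𝓝[Metric.ball p ε \ GammaTilde Z ε] k) (𝓝 (np k)) ∧
      Tendsto n (𝓝[(Metric.closedBall p ε)ᶜ \ GammaTilde Z ε] k) (𝓝 (nm k)) ∧
      nm k = np k + poleTerm Z c x t p k (np k) := by
  by_cases h1 : p.im = 0
  · have hpZ : p ∈ Z := by
      rcases hp with h | h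
      · exact h
      · rwa [Complex.conj_eq_iff_im.2 h1] at h
    obtain ⟨np, nm, -, -, h⟩ := hn.jump_P1 p hpZ h1 0 false
    rw [smallCircle_zero_false] at h
    refine ⟨np, nm, fun k hk => ⟨(h k hk).1, (h k hk).2.1, ?_⟩⟩
    have hv := (h k hk).2.2
    rw [extendJump_zero_false] at hv
    rw [poleTerm_real h1]
    -- The jump is the identity plus a multiple of one matrix unit, so its inverse only flips the
    -- sign of that entry, and the component feeding the polar term is the same on both sides. The
    -- nonreal cases below work alike.
    have e0 := congrFun hv 0
    have e1 := congrFun hv 1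
    have e2 := congrFun hv 2
    simp [P1, Matrix.vecMul, dotProduct, Fin.sum_univ_three] at e0 e1 e2
    ext i
    fin_cases i
    · simp [e0]
    · simp [e0, e1, poleP]
    · simp [e2]
  · by_cases h2 : p ∈ Z
    · obtain ⟨np, nm, -, -, h⟩ := hn.jump_Q1 p h2 h1 0 false
      rw [smallCircle_zero_false] at h
      refine ⟨np, nm, fun k hk => ⟨(h k hk).1, (h k hk).2.1, ?_⟩⟩
      have hv := (h k hk).2.2
      rw [extendJump_zero_false] at hv
      rw [poleTerm_mem h1 h2]
      have e0 := congrFun hv 0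
      have e1 := congrFun hv 1
      have e2 := congrFun hv 2
      simp [Q1, Matrix.vecMul, dotProduct, Fin.sum_univ_three] at e0 e1 e2
      ext i
      fin_cases i
      · simp [e0]
      · simp [e1]
      · simp [e0, e2, poleP]
    · have h3 : (starRingEnd ℂ) p ∈ Z := hp.resolve_left h2
      obtain ⟨np, nm, -, -, h⟩ := hn.jump_Q7 _ h3 (by simpa using h1) 0 false
      rw [smallCircle_zero_false, Complex.conj_conj] at h
      refine ⟨np, nm, fun k hk => ⟨(h k hk).1, (h k hk).2.1, ?_⟩⟩
      have hv := (h k hk).2.2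
      rw [extendJump_zero_false] at hv
      rw [poleTerm_notMem h1 h2]
      have e0 := congrFun hv 0
      have e1 := congrFun hv 1
      have e2 := congrFun hv 2
      simp [Q7, Matrix.vecMul, dotProduct, Fin.sum_univ_three] at e0 e1 e2
      ext i
      fin_cases i
      · simp [e0]
      · simp [e1, e2, poleQ]
      · simp [e2]

/-- The solution, continued meromorphically from outside to inside the small circles, off
these circles. -/
def continuedOff (Z : Finset ℂ) (c : ℂ → ℂ) (ε x t : ℝ) (n : ℂ → Fin 3 → ℂ) (k : ℂ) :
    Fin 3 → ℂ := by
  classical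
  exact n k + ∑ p ∈ centerSet Z, if k ∈ Metric.ball p ε then poleTerm Z c x t p k (n k) else 0

/-- The solution, continued meromorphically from outside to inside the small circles. -/
def continued (Z : Finset ℂ) (c : ℂ → ℂ) (ε x t : ℝ) (n : ℂ → Fin 3 → ℂ) : ℂ → Fin 3 → ℂ :=
  extendFrom (GammaTilde Z ε)ᶜ (continuedOff Z c ε x t n)

theorem continuedOff_of_forall_notMem {k : ℂ} (h : ∀ p ∈ centers Z, k ∉ Metric.ball p ε) :
    continuedOff Z c ε x t n k = n k := by
  classical
  rw [continuedOff, Finset.sum_eq_zero, add_zero]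
  intro p hp
  rw [if_neg (h p (mem_centerSet.1 hp))]

theorem continuedOff_of_mem_ball (hε : AdmissibleRadius Z ε) {p k : ℂ} (hp : p ∈ centers Z)
    (hk : k ∈ Metric.ball p ε) :
    continuedOff Z c ε x t n k = n k + poleTerm Z c x t p k (n k) := by
  classical
  rw [continuedOff, Finset.sum_eq_single p, if_pos hk]
  · intro p' hp' hne
    rw [if_neg]
    intro h
    exact notMem_closedBall_of_mem_closedBall hε hp (mem_centerSet.1 hp') hne
      (Metric.ball_subset_closedBall hk) (Metric.ball_subset_closedBall h)
  · exact fun h => (h (mem_centerSet.2 hp)).elim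

theorem finite_centers (Z : Finset ℂ) : (centers Z).Finite := by
  refine (centerSet Z).finite_toSet.subset fun p hp => ?_
  exact mem_centerSet.2 hp

/-- The union of the closed disks around the centers. -/
theorem isClosed_iUnion_closedBall (S : Set ℂ) (hS : S ⊆ centers Z) (ε : ℝ) :
    IsClosed (⋃ p ∈ S, Metric.closedBall p ε) :=
  ((finite_centers Z).subset hS).isClosed_biUnion fun _ _ => Metric.isClosed_closedBall

theorem eventually_notMem_closedBall {k : ℂ} {S : Set ℂ} (hS : S ⊆ centers Z)
    (hk : ∀ p ∈ S, k ∉ Metric.closedBall p ε) :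
    ∀ᶠ z in 𝓝 k, ∀ p ∈ S, z ∉ Metric.closedBall p ε := by
  have := (isClosed_iUnion_closedBall S hS ε).isOpen_compl.mem_nhds
    (x := k) (by simpa using hk)
  filter_upwards [this] with z hz
  simpa using hz

theorem eventually_notMem_GammaTilde (hd : IsScatteringData r1 r2 Z c)
    (hε : AdmissibleRadius Z ε) {k : ℂ} (hk : k ∈ sectors)
    (hkp : ∀ p ∈ centers Z, dist k p ≠ ε) : ∀ᶠ z in 𝓝 k, z ∈ sectors ∧ z ∉ GammaTilde Z ε := by
  have h1 : ∀ᶠ z in 𝓝 k, z ∈ sectors := isOpen_sectors.mem_nhds hk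
  have h2 : ∀ᶠ z in 𝓝 k, ∀ p ∈ centers Z, dist z p ≠ ε := by
    rw [(finite_centers Z).eventually_all]
    intro p hp
    exact (continuous_id.dist continuous_const).continuousAt.eventually_ne (hkp p hp)
  filter_upwards [h1, h2] with z hz1 hz2
  refine ⟨hz1, fun h => ?_⟩
  obtain ⟨p, hp, hp'⟩ := mem_sphere_of_mem_sectors_of_mem_GammaTilde hd hε hz1 h
  exact hz2 p hp hp'

theorem differentiableAt_solution (hd : IsScatteringData r1 r2 Z c)
    (hε : AdmissibleRadius Z ε) (hn : IsHomogeneousSolution r1 r2 Z c ε x t n) {k : ℂ}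
    (hk : k ∈ sectors) (hkp : ∀ p ∈ centers Z, dist k p ≠ ε) : DifferentiableAt ℂ n k := by
  refine hn.analytic.differentiableAt ?_
  filter_upwards [eventually_notMem_GammaTilde hd hε hk hkp] with z hz
  exact hz.2

theorem eventually_continuedOff_eq_of_outside {k : ℂ}
    (hk : ∀ p ∈ centers Z, k ∉ Metric.closedBall p ε) :
    ∀ᶠ z in 𝓝 k, continuedOff Z c ε x t n z = n z := by
  filter_upwards [eventually_notMem_closedBall subset_rfl hk] with z hz
  exact continuedOff_of_forall_notMem fun p hp h => hz p hp (Metric.ball_subset_closedBall h)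

theorem eventually_continuedOff_eq_of_inside (hε : AdmissibleRadius Z ε) {p k : ℂ}
    (hp : p ∈ centers Z) (hk : k ∈ Metric.ball p ε) :
    ∀ᶠ z in 𝓝 k, continuedOff Z c ε x t n z = n z + poleTerm Z c x t p z (n z) := by
  filter_upwards [Metric.isOpen_ball.mem_nhds hk] with z hz
  exact continuedOff_of_mem_ball hε hp hz

theorem dist_ne_of_mem_ball (hε : AdmissibleRadius Z ε) {p k : ℂ} (hp : p ∈ centers Z)
    (hk : k ∈ Metric.ball p ε) : ∀ p' ∈ centers Z, dist k p' ≠ ε := by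
  intro p' hp' h
  by_cases hne : p' = p
  · subst hne; exact (Metric.mem_ball.1 hk).ne h
  · exact notMem_closedBall_of_mem_closedBall hε hp hp' hne (Metric.ball_subset_closedBall hk)
      (Metric.mem_closedBall.2 h.le)

theorem differentiableAt_continuedOff (hd : IsScatteringData r1 r2 Z c)
    (hε : AdmissibleRadius Z ε) (hn : IsHomogeneousSolution r1 r2 Z c ε x t n) {k : ℂ}
    (hk : k ∈ sectors) (hkc : k ∉ centers Z) (hkp : ∀ p ∈ centers Z, dist k p ≠ ε) :
    DifferentiableAt ℂ (continuedOff Z c ε x t n) k := by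
  have hdn := differentiableAt_solution hd hε hn hk hkp
  by_cases h : ∃ p ∈ centers Z, k ∈ Metric.ball p ε
  · obtain ⟨p, hp, hkb⟩ := h
    have hne : k ≠ p := by rintro rfl; exact hkc hp
    exact (hdn.add (differentiableAt_poleTerm hne hdn)).congr_of_eventuallyEq
      (eventually_continuedOff_eq_of_inside hε hp hkb)
  · push Not at h
    refine hdn.congr_of_eventuallyEq (eventually_continuedOff_eq_of_outside fun p hp hk' => ?_)
    rcases (Metric.mem_closedBall.1 hk').lt_or_eq with h' | h'
    · exact h p hp h'
    · exact hkp p hp h'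

/-- Needed for limits taken off the contour to be unique: a point of a small circle is approached
from the open disk, which contains no other contour points. -/
theorem sectors_subset_closure (hd : IsScatteringData r1 r2 Z c) (hε : AdmissibleRadius Z ε) :
    sectors ⊆ closure (GammaTilde Z ε)ᶜ := by
  intro k hk
  by_cases h : ∃ p ∈ centers Z, dist k p = ε
  · obtain ⟨p, hp, hkp⟩ := h
    have h1 : k ∈ closure (Metric.ball p ε) := by
      rw [closure_ball p hε.1.ne']; exact hkp.le
    have h2 : ∀ᶠ z in 𝓝 k, z ∈ sectors := isOpen_sectors.mem_nhds hk
    rw [mem_closure_iff_frequently] at h1 ⊢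
    refine (h1.and_eventually h2).mono ?_
    rintro z ⟨hz, hzs⟩ hzG
    obtain ⟨p', hp', h'⟩ := mem_sphere_of_mem_sectors_of_mem_GammaTilde hd hε hzs hzG
    exact dist_ne_of_mem_ball hε hp hz p' hp' h'
  · push Not at h
    exact subset_closure (eventually_notMem_GammaTilde hd hε hk h).self_of_nhds.2

/-- The jump relation says exactly that the interior value plus the polar term and the exterior
value have the same limit on the circle. -/
theorem tendsto_continuedOff_of_dist_eq
    (hε : AdmissibleRadius Z ε) (hn : IsHomogeneousSolution r1 r2 Z c ε x t n) {p k : ℂ}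
    (hp : p ∈ centers Z) (hkp : dist k p = ε) :
    ∃ y, Tendsto (continuedOff Z c ε x t n) (𝓝[(GammaTilde Z ε)ᶜ] k) (𝓝 y) := by
  obtain ⟨np, nm, h⟩ := exists_limits_of_mem_centers hn hp
  obtain ⟨hl, hr, he⟩ := h k hkp
  have hne : k ≠ p := by rintro rfl; rw [dist_self] at hkp; exact hε.1.ne hkp
  refine ⟨nm k, ?_⟩
  have hsub : (GammaTilde Z ε)ᶜ ⊆ (Metric.ball p ε \ GammaTilde Z ε) ∪
      ((Metric.closedBall p ε)ᶜ \ GammaTilde Z ε) := by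
    intro z hz
    rcases lt_trichotomy (dist z p) ε with h' | h' | h'
    · exact Or.inl ⟨h', hz⟩
    · exact (hz (sphere_subset_GammaTilde hp h')).elim
    · exact Or.inr ⟨by simpa using h', hz⟩
  refine Tendsto.mono_left ?_ (nhdsWithin_mono _ hsub)
  rw [nhdsWithin_union]
  refine Tendsto.sup ?_ ?_
  · rw [he]
    refine Tendsto.congr' (f₁ := fun z => n z + poleTerm Z c x t p z (n z)) ?_
      (hl.add (tendsto_poleTerm hne nhdsWithin_le_nhds hl))
    filter_upwards [self_mem_nhdsWithin] with z hz
    exact (continuedOff_of_mem_ball hε hp hz.1).symm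
  · refine Tendsto.congr' ?_ hr
    have h1 : ∀ᶠ z in 𝓝 k, ∀ p' ∈ centers Z \ {p}, z ∉ Metric.closedBall p' ε :=
      eventually_notMem_closedBall sdiff_subset fun p' hp' =>
        notMem_closedBall_of_mem_closedBall hε hp hp'.1 hp'.2 hkp.le
    filter_upwards [self_mem_nhdsWithin, nhdsWithin_le_nhds h1] with z hz hz'
    refine (continuedOff_of_forall_notMem fun p' hp' h' => ?_).symm
    by_cases hpp : p' = p
    · subst hpp; exact hz.1 (Metric.ball_subset_closedBall h')
    · exact hz' p' ⟨hp', hpp⟩ (Metric.ball_subset_closedBall h')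

/-- `continued` extends by limits, so on a circle it is the common limit from both sides. Away from
the circles extension changes nothing; the centers are left out because of the poles. -/
theorem eventually_continued_eq (hd : IsScatteringData r1 r2 Z c)
    (hε : AdmissibleRadius Z ε) (hn : IsHomogeneousSolution r1 r2 Z c ε x t n) {k : ℂ}
    (hk : k ∈ sectors) (hkp : ∀ p ∈ centers Z, dist k p ≠ ε) :
    ∀ᶠ z in 𝓝 k, z ∉ centers Z → continued Z c ε x t n z = continuedOff Z c ε x t n z := by
  have h2 : ∀ᶠ z in 𝓝 k, ∀ p ∈ centers Z, dist z p ≠ ε := by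
    rw [(finite_centers Z).eventually_all]
    intro p hp
    exact (continuous_id.dist continuous_const).continuousAt.eventually_ne (hkp p hp)
  filter_upwards [h2, eventually_notMem_GammaTilde hd hε hk hkp] with z hz1 hz2 hzc
  refine extendFrom_eq (subset_closure hz2.2) ?_
  exact (differentiableAt_continuedOff hd hε hn hz2.1 hzc hz1).continuousAt.tendsto.mono_left
    nhdsWithin_le_nhds

/-- Outside the small disks the continuation is the solution itself. -/
theorem continued_eq_of_outside (hd : IsScatteringData r1 r2 Z c)
    (hε : AdmissibleRadius Z ε) (hn : IsHomogeneousSolution r1 r2 Z c ε x t n) {k : ℂ}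
    (hks : k ∈ sectors) (hk : ∀ p ∈ centers Z, k ∉ Metric.closedBall p ε) :
    continued Z c ε x t n k = n k := by
  have h1 := (eventually_continued_eq hd hε hn hks fun p hp h =>
    hk p hp (Metric.mem_closedBall.2 h.le)).self_of_nhds fun hkc =>
      hk k hkc (Metric.mem_closedBall_self hε.1.le)
  rw [h1]
  exact (eventually_continuedOff_eq_of_outside hk).self_of_nhds

/-- Inside a small disk the continuation is the solution plus the polar term. -/
theorem continued_eq_of_inside (hd : IsScatteringData r1 r2 Z c)
    (hε : AdmissibleRadius Z ε) (hn : IsHomogeneousSolution r1 r2 Z c ε x t n) {p : ℂ}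
    (hp : p ∈ centers Z) {k : ℂ} (hk : k ∈ Metric.ball p ε) (hkp : k ≠ p) :
    continued Z c ε x t n k = n k + poleTerm Z c x t p k (n k) := by
  have hks := closedBall_subset_sectors hd hε hp (Metric.ball_subset_closedBall hk)
  have h1 := (eventually_continued_eq hd hε hn hks (dist_ne_of_mem_ball hε hp hk)).self_of_nhds
    fun hkc => notMem_closedBall_of_mem_closedBall hε hp hkc hkp
      (Metric.ball_subset_closedBall hk) (Metric.mem_closedBall_self hε.1.le)
  rw [h1]
  exact continuedOff_of_mem_ball hε hp hk

theorem continuousOn_continued (hd : IsScatteringData r1 r2 Z c)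
    (hε : AdmissibleRadius Z ε) (hn : IsHomogeneousSolution r1 r2 Z c ε x t n) :
    ContinuousOn (continued Z c ε x t n) (sectors \ centers Z) := by
  refine continuousOn_extendFrom (sdiff_subset.trans (sectors_subset_closure hd hε)) ?_
  rintro k ⟨hk, hkc⟩
  by_cases h : ∃ p ∈ centers Z, dist k p = ε
  · obtain ⟨p, hp, hkp⟩ := h
    exact tendsto_continuedOff_of_dist_eq hε hn hp hkp
  · push Not at h
    exact ⟨_, (differentiableAt_continuedOff hd hε hn hk hkc h).continuousAt.tendsto.mono_left
      nhdsWithin_le_nhds⟩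

theorem isOpen_sectors_diff_centers : IsOpen (sectors \ centers Z) :=
  isOpen_sectors.sdiff (finite_centers Z).isClosed

theorem differentiableAt_continued_of_off (hd : IsScatteringData r1 r2 Z c)
    (hε : AdmissibleRadius Z ε) (hn : IsHomogeneousSolution r1 r2 Z c ε x t n) {k : ℂ}
    (hk : k ∈ sectors \ centers Z) (hkp : ∀ p ∈ centers Z, dist k p ≠ ε) :
    DifferentiableAt ℂ (continued Z c ε x t n) k := by
  refine (differentiableAt_continuedOff hd hε hn hk.1 hk.2 hkp).congr_of_eventuallyEq ?_
  have h2 : ∀ᶠ z in 𝓝 k, z ∈ sectors \ centers Z := isOpen_sectors_diff_centers.mem_nhds hk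
  filter_upwards [eventually_continued_eq hd hε hn hk.1 hkp, h2] with z h1 h2
  exact h1 h2.2

/-- The continuation is holomorphic in the sectors, except at the centers. -/
theorem differentiableAt_continued (hd : IsScatteringData r1 r2 Z c)
    (hε : AdmissibleRadius Z ε) (hn : IsHomogeneousSolution r1 r2 Z c ε x t n) {k : ℂ}
    (hk : k ∈ sectors \ centers Z) : DifferentiableAt ℂ (continued Z c ε x t n) k := by
  by_cases h : ∃ p ∈ centers Z, dist k p = ε
  swap
  · push Not at h
    exact differentiableAt_continued_of_off hd hε hn hk h
  obtain ⟨p, hp, hkp⟩ := h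
  -- Removing the other closed disks leaves a neighbourhood of k meeting a single circle, to which
  -- the one-circle removability result applies.
  set U : Set ℂ := (sectors \ centers Z) \ ⋃ p' ∈ centers Z \ {p}, Metric.closedBall p' ε with hU
  have hUo : IsOpen U :=
    isOpen_sectors_diff_centers.sdiff (isClosed_iUnion_closedBall _ sdiff_subset ε)
  have hkU : k ∈ U := by
    refine ⟨hk, ?_⟩
    simp only [mem_iUnion, not_exists]
    intro p' hp' h'
    exact notMem_closedBall_of_mem_closedBall hε hp hp'.1 hp'.2 hkp.le h'
  refine (differentiableOn_of_off_sphere hUo ((continuousOn_continued hd hε hn).mono sdiff_subset) p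
    hε.1 ?_).differentiableAt (hUo.mem_nhds hkU)
  rintro z ⟨hz, hz'⟩ hzp
  refine differentiableAt_continued_of_off hd hε hn hz fun p' hp' h' => ?_
  by_cases hpp : p' = p
  · subst hpp; exact hzp h'
  · exact hz' (mem_iUnion₂.2 ⟨p', ⟨hp', hpp⟩, h'.le⟩)

end Meromorphic

end Bsq

namespace Bsq

/-! ### Positivity on the unit circle -/

section Signs

variable {a1 a2 a3 b1 b2 b3 : ℂ} {d1 d2 d3 : ℝ}

-- Let M have rows (1, a₁, b₃), (b₁, 1, a₂), (a₃, b₂, 1) and D = diag(d₁, d₂, d₃). The hypotheses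
-- say that the rows are orthogonal for D, so M D M* = diag(N₁, N₂, N₃). Multiplying by the adjugate
-- of M gives adj(M) diag(N) = det(M) D M*, and these are its diagonal entries.
open ComplexConjugate in
theorem cofactor_relations
    (h1 : d1 * b1 + d2 * conj a1 + d3 * (a2 * conj b3) = 0)
    (h2 : d2 * b2 + d3 * conj a2 + d1 * (a3 * conj b1) = 0)
    (h3 : d3 * b3 + d1 * conj a3 + d2 * (a1 * conj b2) = 0) :
    (1 - a2 * b2) * (d1 + d2 * (a1 * conj a1) + d3 * (b3 * conj b3)) =
      d1 * (1 - a1 * b1 - a2 * b2 - a3 * b3 + a1 * a2 * a3 + b1 * b2 * b3) ∧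
    (1 - a3 * b3) * (d1 * (b1 * conj b1) + d2 + d3 * (a2 * conj a2)) =
      d2 * (1 - a1 * b1 - a2 * b2 - a3 * b3 + a1 * a2 * a3 + b1 * b2 * b3) ∧
    (1 - a1 * b1) * (d1 * (a3 * conj a3) + d2 * (b2 * conj b2) + d3) =
      d3 * (1 - a1 * b1 - a2 * b2 - a3 * b3 + a1 * a2 * a3 + b1 * b2 * b3) := by
  have h1' := congrArg conj h1
  have h2' := congrArg conj h2
  have h3' := congrArg conj h3
  simp only [map_add, map_mul, Complex.conj_ofReal, Complex.conj_conj, map_zero] at h1' h2' h3'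
  refine ⟨?_, ?_, ?_⟩
  · linear_combination (a1 - b2 * b3) * h1 - (a1 * a2 - b3) * h3'
  · linear_combination (b1 - a2 * a3) * h1' + (a2 - b3 * b1) * h2
  · linear_combination -(b1 * b2 - a3) * h3 + (b2 - a1 * a3) * h2'

theorem ofReal_normSq_eq (z : ℂ) : ((‖z‖ ^ 2 : ℝ) : ℂ) = z * (starRingEnd ℂ) z := by
  rw [Complex.mul_conj, Complex.normSq_eq_norm_sq]

open ComplexConjugate in
/-- The quantities `N_j` do not vanish. -/
theorem norms_ne_zero (hd1 : 0 < d1) (hd2 : d2 < 0) (hd3 : 0 < d3)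
    (h1 : d1 * b1 + d2 * conj a1 + d3 * (a2 * conj b3) = 0)
    (h2 : d2 * b2 + d3 * conj a2 + d1 * (a3 * conj b1) = 0)
    (h3 : d3 * b3 + d1 * conj a3 + d2 * (a1 * conj b2) = 0)
    (n1 : 1 - a1 * b1 ≠ 0) (n2 : 1 - a2 * b2 ≠ 0) (n3 : 1 - a3 * b3 ≠ 0) :
    d1 + d2 * ‖a1‖ ^ 2 + d3 * ‖b3‖ ^ 2 ≠ 0 ∧ d1 * ‖b1‖ ^ 2 + d2 + d3 * ‖a2‖ ^ 2 ≠ 0 ∧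
      d1 * ‖a3‖ ^ 2 + d2 * ‖b2‖ ^ 2 + d3 ≠ 0 := by
  obtain ⟨c1, c2, c3⟩ := cofactor_relations h1 h2 h3
  have e1 : (d1 + d2 * (a1 * conj a1) + d3 * (b3 * conj b3) : ℂ) =
      ((d1 + d2 * ‖a1‖ ^ 2 + d3 * ‖b3‖ ^ 2 : ℝ) : ℂ) := by
    rw [← ofReal_normSq_eq, ← ofReal_normSq_eq]; push_cast; ring
  have e2 : (d1 * (b1 * conj b1) + d2 + d3 * (a2 * conj a2) : ℂ) =
      ((d1 * ‖b1‖ ^ 2 + d2 + d3 * ‖a2‖ ^ 2 : ℝ) : ℂ) := by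
    rw [← ofReal_normSq_eq, ← ofReal_normSq_eq]; push_cast; ring
  have e3 : (d1 * (a3 * conj a3) + d2 * (b2 * conj b2) + d3 : ℂ) =
      ((d1 * ‖a3‖ ^ 2 + d2 * ‖b2‖ ^ 2 + d3 : ℝ) : ℂ) := by
    rw [← ofReal_normSq_eq, ← ofReal_normSq_eq]; push_cast; ring
  rw [e1] at c1
  rw [e2] at c2
  rw [e3] at c3
  -- If det M = 0, the cofactor relations force N₁ = N₂ = 0, so the first two rows span a null
  -- subspace for D. But row 1 minus a₁ times row 2 is (1 - a₁b₁, 0, b₃ - a₁a₂); its second entry,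
  -- the only one of negative weight, is zero and its first is not, so its norm is positive.
  have hΔ : 1 - a1 * b1 - a2 * b2 - a3 * b3 + a1 * a2 * a3 + b1 * b2 * b3 ≠ 0 := by
    intro h0
    rw [h0, mul_zero] at c1 c2
    have hN1 := (mul_eq_zero.1 c1).resolve_left n2
    have hN2 := (mul_eq_zero.1 c2).resolve_left n3
    rw [← e1] at hN1
    rw [← e2] at hN2
    have h1' := congrArg conj h1
    simp only [map_add, map_mul, Complex.conj_ofReal, Complex.conj_conj, map_zero] at h1'
    have key : (d1 * ((1 - a1 * b1) * conj (1 - a1 * b1)) +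
        d3 * ((b3 - a1 * a2) * conj (b3 - a1 * a2)) : ℂ) = 0 := by
      simp only [map_sub, map_mul, map_one]
      linear_combination hN1 - conj a1 * h1' - a1 * h1 + a1 * conj a1 * hN2
    rw [← ofReal_normSq_eq, ← ofReal_normSq_eq] at key
    have key' : d1 * ‖1 - a1 * b1‖ ^ 2 + d3 * ‖b3 - a1 * a2‖ ^ 2 = 0 := by exact_mod_cast key
    have : 0 < ‖1 - a1 * b1‖ := norm_pos_iff.2 n1
    have : 0 < d1 * ‖1 - a1 * b1‖ ^ 2 := by positivity
    have : 0 ≤ d3 * ‖b3 - a1 * a2‖ ^ 2 := by positivity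
    linarith
  refine ⟨?_, ?_, ?_⟩
  · intro h
    rw [h, Complex.ofReal_zero, mul_zero, eq_comm] at c1
    exact (mul_ne_zero (Complex.ofReal_ne_zero.2 hd1.ne') hΔ) c1
  · intro h
    rw [h, Complex.ofReal_zero, mul_zero, eq_comm] at c2
    exact (mul_ne_zero (Complex.ofReal_ne_zero.2 hd2.ne) hΔ) c2
  · intro h
    rw [h, Complex.ofReal_zero, mul_zero, eq_comm] at c3
    exact (mul_ne_zero (Complex.ofReal_ne_zero.2 hd3.ne') hΔ) c3

open ComplexConjugate in
/-- `N₁` and `N₃` are not both negative. -/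
theorem not_both_neg (hd1 : 0 < d1) (hd3 : 0 < d3)
    (h3 : d3 * b3 + d1 * conj a3 + d2 * (a1 * conj b2) = 0)
    (N1 : d1 + d2 * ‖a1‖ ^ 2 + d3 * ‖b3‖ ^ 2 < 0)
    (N3 : d1 * ‖a3‖ ^ 2 + d2 * ‖b2‖ ^ 2 + d3 < 0) : False := by
  have h3' := congrArg conj h3
  simp only [map_add, map_mul, Complex.conj_ofReal, Complex.conj_conj, map_zero] at h3'
  -- D-norm of b₂ times row 1 minus a₁ times row 3, chosen to kill the second entry: nonnegative on
  -- the left, while orthogonality makes it |b₂|² N₁ + |a₁|² N₃. This is the remark that D has only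
  -- one negative direction.
  have key : (d1 * ((b2 - a1 * a3) * conj (b2 - a1 * a3)) +
      d3 * ((b3 * b2 - a1) * conj (b3 * b2 - a1)) : ℂ) =
      b2 * conj b2 * (d1 + d2 * (a1 * conj a1) + d3 * (b3 * conj b3)) +
      a1 * conj a1 * (d1 * (a3 * conj a3) + d2 * (b2 * conj b2) + d3) := by
    simp only [map_sub, map_mul]
    linear_combination -(b2 * conj a1) * h3 - a1 * conj b2 * h3'
  simp only [← ofReal_normSq_eq] at key
  have key' : d1 * ‖b2 - a1 * a3‖ ^ 2 + d3 * ‖b3 * b2 - a1‖ ^ 2 =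
      ‖b2‖ ^ 2 * (d1 + d2 * ‖a1‖ ^ 2 + d3 * ‖b3‖ ^ 2) +
      ‖a1‖ ^ 2 * (d1 * ‖a3‖ ^ 2 + d2 * ‖b2‖ ^ 2 + d3) := by exact_mod_cast key
  have p1 : 0 ≤ d1 * ‖b2 - a1 * a3‖ ^ 2 := by positivity
  have p2 : 0 ≤ d3 * ‖b3 * b2 - a1‖ ^ 2 := by positivity
  have p3 : ‖b2‖ ^ 2 * (d1 + d2 * ‖a1‖ ^ 2 + d3 * ‖b3‖ ^ 2) ≤ 0 :=
    mul_nonpos_of_nonneg_of_nonpos (by positivity) N1.le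
  have p4 : ‖a1‖ ^ 2 * (d1 * ‖a3‖ ^ 2 + d2 * ‖b2‖ ^ 2 + d3) = 0 :=
    le_antisymm (mul_nonpos_of_nonneg_of_nonpos (by positivity) N3.le) (by linarith)
  have p5 : ‖a1‖ ^ 2 = 0 := (mul_eq_zero.1 p4).resolve_right N3.ne
  rw [p5] at N1
  have : 0 ≤ d3 * ‖b3‖ ^ 2 := by positivity
  linarith

theorem neg_on_Ioo_of_ne_zero {f : ℝ → ℝ} {a b : ℝ} (hf : ContinuousOn f (Ioo a b))
    (hne : ∀ φ ∈ Ioo a b, f φ ≠ 0) (hex : ∃ φ ∈ Ioo a b, f φ < 0) : ∀ φ ∈ Ioo a b, f φ < 0 := by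
  intro φ hφ
  obtain ⟨ψ, hψ, hneg⟩ := hex
  by_contra! h
  have := isPreconnected_Ioo.intermediate_value hψ hφ hf (show (0 : ℝ) ∈ Icc (f ψ) (f φ) from
    ⟨hneg.le, h⟩)
  obtain ⟨u, hu, hu0⟩ := this
  exact hne u hu hu0

/-- If `D E = F G` with `F ≠ 0` near a point, where `D`, `G` are real and the quotient of the
other factors tends to a negative number, then `D`, `G` have opposite signs. -/
theorem exists_mul_neg_of_tendsto {F : Filter ℝ} [F.NeBot] {s : Set ℝ} (hs : ∀ᶠ φ in F, φ ∈ s)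
    {N M d e : ℝ → ℝ} {u v Δ : ℝ → ℂ} {w : ℂ} {d₀ : ℝ}
    (hN : ∀ φ ∈ s, u φ * N φ = d φ * Δ φ) (hM : ∀ φ ∈ s, v φ * M φ = e φ * Δ φ)
    (hM0 : ∀ φ ∈ s, M φ ≠ 0) (he0 : ∀ φ ∈ s, e φ ≠ 0) (hu0 : ∀ φ ∈ s, u φ ≠ 0)
    (hw : w ≠ 0) (hd₀ : 0 < d₀)
    (hu : Tendsto u F (𝓝 w)) (hv : Tendsto v F (𝓝 w))
    (hd : Tendsto (fun φ => d φ / e φ) F (𝓝 (-d₀))) : ∃ φ ∈ s, N φ * M φ < 0 := by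
  have h1 : Tendsto (fun φ => ((d φ / e φ : ℝ) : ℂ) * (v φ / u φ)) F (𝓝 (((-d₀ : ℝ) : ℂ) * (w / w))) :=
    ((Complex.continuous_ofReal.tendsto _).comp hd).mul (hv.div hu hw)
  rw [div_self hw, mul_one] at h1
  have h2 := (Complex.continuous_re.tendsto _).comp h1
  have h3 : ∀ᶠ φ in F, (((d φ / e φ : ℝ) : ℂ) * (v φ / u φ)).re < 0 :=
    h2.eventually_lt_const (by simpa using hd₀)
  obtain ⟨φ, hφ, hφs⟩ := (h3.and hs).exists
  refine ⟨φ, hφs, ?_⟩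
  have e1 : ((d φ / e φ : ℝ) : ℂ) * (v φ / u φ) = ((N φ / M φ : ℝ) : ℂ) := by
    have hM0' : (M φ : ℂ) ≠ 0 := Complex.ofReal_ne_zero.2 (hM0 φ hφs)
    have he0' : (e φ : ℂ) ≠ 0 := Complex.ofReal_ne_zero.2 (he0 φ hφs)
    have hu0' := hu0 φ hφs
    push_cast
    field_simp
    refine mul_left_cancel₀ he0' ?_
    linear_combination (e φ * d φ : ℂ) * hM φ hφs - (e φ : ℂ) * e φ * hN φ hφs
  rw [e1, Complex.ofReal_re] at hφ
  have hpos : 0 < M φ ^ 2 := by have := hM0 φ hφs; positivity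
  have : N φ * M φ = N φ / M φ * M φ ^ 2 := by
    have := hM0 φ hφs
    field_simp
  rw [this]
  exact mul_neg_of_neg_of_pos hφ hpos

open ComplexConjugate in
/-- Signs of the quantities `N_j` on an arc between two consecutive sixth roots of unity. -/
theorem signs_on_arc {g : ℝ → ℂ} (hg : Continuous g) {e1 e2 e3 : ℝ → ℝ} (he1 : Continuous e1)
    (he2 : Continuous e2) (he3 : Continuous e3) {L α : ℝ} (hL : 0 < L)
    (p1 : ∀ φ ∈ Ioo 0 L, 0 < e1 φ) (p2 : ∀ φ ∈ Ioo 0 L, e2 φ < 0) (p3 : ∀ φ ∈ Ioo 0 L, 0 < e3 φ)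
    (q0 : e1 0 / e2 0 = -1) (q0' : e2 0 ≠ 0) (q1 : e2 L / e3 L = -1) (q1' : e3 L ≠ 0)
    (hLα : L - α = -L)
    (h1 : ∀ φ ∈ Ioo 0 L, e1 φ * g (-φ) + e2 φ * conj (g φ) +
      e3 φ * (g (φ + α) * conj (g (-φ + α))) = 0)
    (h2 : ∀ φ ∈ Ioo 0 L, e2 φ * g (-φ - α) + e3 φ * conj (g (φ + α)) +
      e1 φ * (g (φ - α) * conj (g (-φ))) = 0)
    (h3 : ∀ φ ∈ Ioo 0 L, e3 φ * g (-φ + α) + e1 φ * conj (g (φ - α)) +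
      e2 φ * (g φ * conj (g (-φ - α))) = 0)
    (n1 : ∀ φ ∈ Ioo 0 L, 1 - g φ * g (-φ) ≠ 0)
    (n2 : ∀ φ ∈ Ioo 0 L, 1 - g (φ + α) * g (-φ - α) ≠ 0)
    (n3 : ∀ φ ∈ Ioo 0 L, 1 - g (φ - α) * g (-φ + α) ≠ 0)
    (m0 : 1 - g α * g (-α) ≠ 0) (m1 : 1 - g L * g (-L) ≠ 0) :
    ∀ φ ∈ Ioo 0 L, 0 < e1 φ + e2 φ * ‖g φ‖ ^ 2 + e3 φ * ‖g (-φ + α)‖ ^ 2 ∧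
      e1 φ * ‖g (-φ)‖ ^ 2 + e2 φ + e3 φ * ‖g (φ + α)‖ ^ 2 < 0 := by
  set N1 : ℝ → ℝ := fun φ => e1 φ + e2 φ * ‖g φ‖ ^ 2 + e3 φ * ‖g (-φ + α)‖ ^ 2 with hN1
  set N2 : ℝ → ℝ := fun φ => e1 φ * ‖g (-φ)‖ ^ 2 + e2 φ + e3 φ * ‖g (φ + α)‖ ^ 2 with hN2
  set N3 : ℝ → ℝ := fun φ => e1 φ * ‖g (φ - α)‖ ^ 2 + e2 φ * ‖g (-φ - α)‖ ^ 2 + e3 φ with hN3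
  set Δ : ℝ → ℂ := fun φ => 1 - g φ * g (-φ) - g (φ + α) * g (-φ - α) - g (φ - α) * g (-φ + α) +
    g φ * g (φ + α) * g (φ - α) + g (-φ) * g (-φ - α) * g (-φ + α) with hΔ
  have cN1 : Continuous N1 := by fun_prop
  have cN2 : Continuous N2 := by fun_prop
  have cN3 : Continuous N3 := by fun_prop
  have hne : ∀ φ ∈ Ioo 0 L, N1 φ ≠ 0 ∧ N2 φ ≠ 0 ∧ N3 φ ≠ 0 := fun φ hφ =>
    norms_ne_zero (p1 φ hφ) (p2 φ hφ) (p3 φ hφ) (h1 φ hφ) (h2 φ hφ) (h3 φ hφ) (n1 φ hφ) (n2 φ hφ)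
      (n3 φ hφ)
  have hcof : ∀ φ ∈ Ioo 0 L, (1 - g (φ + α) * g (-φ - α)) * N1 φ = e1 φ * Δ φ ∧
      (1 - g (φ - α) * g (-φ + α)) * N2 φ = e2 φ * Δ φ ∧
      (1 - g φ * g (-φ)) * N3 φ = e3 φ * Δ φ := by
    intro φ hφ
    have := cofactor_relations (h1 φ hφ) (h2 φ hφ) (h3 φ hφ)
    simp only [← ofReal_normSq_eq] at this
    simp only [hN1, hN2, hN3, hΔ]
    push_cast at this ⊢
    exact this
  -- By the cofactor relations N₁/N₂ = (e₁/e₂)(v/u). As φ → 0 the factors u and v have the same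
  -- nonzero limit and e₁/e₂ → -1, so the signs differ near 0, hence on the whole arc.
  have s12 : ∀ φ ∈ Ioo 0 L, N1 φ * N2 φ < 0 := by
    refine neg_on_Ioo_of_ne_zero (by fun_prop) (fun φ hφ => mul_ne_zero (hne φ hφ).1 (hne φ hφ).2.1) ?_
    refine exists_mul_neg_of_tendsto (F := 𝓝[>] 0) (Ioo_mem_nhdsGT hL)
      (fun φ hφ => (hcof φ hφ).1) (fun φ hφ => (hcof φ hφ).2.1) (fun φ hφ => (hne φ hφ).2.1)
      (fun φ hφ => (p2 φ hφ).ne) n2 m0 one_pos ?_ ?_ ?_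
    · have : Tendsto (fun φ => 1 - g (φ + α) * g (-φ - α)) (𝓝 0)
        (𝓝 (1 - g (0 + α) * g (-0 - α))) := Continuous.tendsto (by fun_prop) 0
      simpa using this.mono_left (nhdsWithin_le_nhds (s := Ioi 0))
    · have : Tendsto (fun φ => 1 - g (φ - α) * g (-φ + α)) (𝓝 0)
        (𝓝 (1 - g (0 - α) * g (-0 + α))) := Continuous.tendsto (by fun_prop) 0
      simpa [mul_comm] using this.mono_left (nhdsWithin_le_nhds (s := Ioi 0))
    · rw [← q0]
      exact ((he1.tendsto 0).div (he2.tendsto 0) q0').mono_left nhdsWithin_le_nhds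
  -- The same comparison of N₂ and N₃ at the other end φ = L, where e₂/e₃ → -1.
  have s23 : ∀ φ ∈ Ioo 0 L, N2 φ * N3 φ < 0 := by
    refine neg_on_Ioo_of_ne_zero (by fun_prop)
      (fun φ hφ => mul_ne_zero (hne φ hφ).2.1 (hne φ hφ).2.2) ?_
    refine exists_mul_neg_of_tendsto (F := 𝓝[<] L) (Ioo_mem_nhdsLT hL)
      (fun φ hφ => (hcof φ hφ).2.1) (fun φ hφ => (hcof φ hφ).2.2) (fun φ hφ => (hne φ hφ).2.2)
      (fun φ hφ => (p3 φ hφ).ne') n3 m1 one_pos ?_ ?_ ?_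
    · have : Tendsto (fun φ => 1 - g (φ - α) * g (-φ + α)) (𝓝 L)
        (𝓝 (1 - g (L - α) * g (-L + α))) := Continuous.tendsto (by fun_prop) L
      rw [hLα, show -L + α = L by linarith, mul_comm] at this
      exact this.mono_left nhdsWithin_le_nhds
    · have : Tendsto (fun φ => 1 - g φ * g (-φ)) (𝓝 L) (𝓝 (1 - g L * g (-L))) :=
        Continuous.tendsto (by fun_prop) L
      exact this.mono_left nhdsWithin_le_nhds
    · rw [← q1]
      exact ((he2.tendsto L).div (he3.tendsto L) q1').mono_left nhdsWithin_le_nhds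
  intro φ hφ
  have t1 := s12 φ hφ
  have t2 := s23 φ hφ
  change 0 < N1 φ ∧ N2 φ < 0
  -- The signs alternate. The pattern (-, +, -) is excluded since N₁ and N₃ cannot both be negative.
  rcases lt_or_gt_of_ne (hne φ hφ).1 with h | h
  · exfalso
    have hN2 : 0 < N2 φ := by
      by_contra! hle
      have := mul_nonneg_of_nonpos_of_nonpos h.le hle
      linarith
    have hN3 : N3 φ < 0 := by
      by_contra! hle
      have := mul_nonneg hN2.le hle
      linarith
    exact not_both_neg (p1 φ hφ) (p3 φ hφ) (h3 φ hφ) h hN3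
  · refine ⟨h, ?_⟩
    by_contra! hle
    have := mul_nonneg h.le hle
    linarith

open ComplexConjugate in
/-- Definiteness of the quadratic form attached to the jump on the unit circle. -/
theorem arc_form_neg (hd1 : 0 < d1) (hd2 : d2 < 0) (hd3 : 0 < d3)
    (h1 : d1 * b1 + d2 * conj a1 + d3 * (a2 * conj b3) = 0)
    (N1 : 0 < d1 + d2 * ‖a1‖ ^ 2 + d3 * ‖b3‖ ^ 2)
    (N2 : d1 * ‖b1‖ ^ 2 + d2 + d3 * ‖a2‖ ^ 2 < 0) {x1 x2 x3 y1 y2 y3 : ℂ}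
    (hy1 : d1 * y1 = x1 * (d1 + d2 * (a1 * conj a1) + d3 * (b3 * conj b3)) + x2 * (d2 * conj a1) +
      x3 * (d3 * conj (b3 - a1 * a2)))
    (hy2 : d2 * y2 = x1 * (d2 * a1) + x2 * d2 - x3 * (d3 * conj a2))
    (hy3 : d2 * y3 = x1 * (d2 * (b3 - a1 * a2)) - x2 * (d2 * a2) +
      x3 * (d2 + d3 * (a2 * conj a2))) :
    (-d1 * (x1 * conj y1) + d2 * (x2 * conj y2) - d3 * (x3 * conj y3) : ℂ).re ≤ 0 ∧
    ((-d1 * (x1 * conj y1) + d2 * (x2 * conj y2) - d3 * (x3 * conj y3) : ℂ).re = 0 →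
      x1 = 0 ∧ x2 = 0 ∧ x3 = 0) := by
  set S : ℂ := -d1 * (x1 * conj y1) + d2 * (x2 * conj y2) - d3 * (x3 * conj y3) with hS
  set n1 : ℝ := d1 + d2 * ‖a1‖ ^ 2 + d3 * ‖b3‖ ^ 2 with hn1
  set n2 : ℝ := d1 * ‖b1‖ ^ 2 + d2 + d3 * ‖a2‖ ^ 2 with hn2
  have e1 : (n1 : ℂ) = d1 + d2 * (a1 * conj a1) + d3 * (b3 * conj b3) := by
    simp only [hn1]; push_cast; rw [← ofReal_normSq_eq, ← ofReal_normSq_eq]; push_cast; ring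
  have e2 : (n2 : ℂ) = d1 * (b1 * conj b1) + d2 + d3 * (a2 * conj a2) := by
    simp only [hn2]; push_cast; rw [← ofReal_normSq_eq, ← ofReal_normSq_eq]; push_cast; ring
  have h1' := congrArg conj h1
  have hy1' := congrArg conj hy1
  have hy2' := congrArg conj hy2
  have hy3' := congrArg conj hy3
  simp only [map_add, map_sub, map_mul, Complex.conj_ofReal, Complex.conj_conj, map_zero]
    at h1' hy1' hy2' hy3'
  rw [map_sub, map_mul] at hy1
  -- Completing the square in x₁. The right side is ≥ 0 because n₁ > 0, d₂ < 0, n₂ < 0, and the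
  -- prefactor n₁ d₂ is negative, whence Re S ≤ 0.
  have key : (n1 * d2 * (S + conj S) : ℂ) = 2 * n1 * d2 * (d2 * (x2 * conj x2)) -
      2 * d2 * ((n1 * x1 + d3 * conj (b3 - a1 * a2) * x3) * conj (n1 * x1 + d3 * conj (b3 - a1 * a2) * x3)) -
      2 * (d1 * d3 * n2) * (x3 * conj x3) := by
    -- The circle relation eliminates b₁, which the hypotheses on the yⱼ do not contain but n₂ does.
    have hb : d1 * b1 = -(d2 * conj a1 + d3 * (a2 * conj b3)) := by linear_combination h1
    have hb' : d1 * conj b1 = -(d2 * a1 + d3 * (conj a2 * b3)) := by linear_combination h1'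
    have hbb : (d1 * n2 : ℂ) = (d2 * conj a1 + d3 * (a2 * conj b3)) *
        (d2 * a1 + d3 * (conj a2 * b3)) + d1 * d2 + d1 * d3 * (a2 * conj a2) := by
      rw [e2]
      linear_combination (d1 * conj b1) * hb - (d2 * conj a1 + d3 * (a2 * conj b3)) * hb'
    have hSS : (d2 * (S + conj S) : ℂ) = d2 * (2 * d2 * (x2 * conj x2)) - 2 * d2 * (n1 * (x1 * conj x1)) -
        2 * d2 * d3 * (b3 - a1 * a2) * (x1 * conj x3) - 2 * d2 * d3 * conj (b3 - a1 * a2) * (x3 * conj x1) -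
        2 * d3 * (d2 + d3 * (a2 * conj a2)) * (x3 * conj x3) := by
      rw [hS, e1]
      simp only [map_add, map_sub, map_mul, map_neg, Complex.conj_ofReal, Complex.conj_conj]
      linear_combination (-d2 * x1) * hy1' + d2 * x2 * hy2' - d3 * x3 * hy3' -
        d2 * conj x1 * hy1 + d2 * conj x2 * hy2 - d3 * conj x3 * hy3
    have hSn : (n1 * d2 * (S + conj S) : ℂ) = n1 * (d2 * (S + conj S)) := by ring
    rw [hSn, hSS]
    simp only [map_add, map_sub, map_mul, Complex.conj_ofReal, Complex.conj_conj]
    have : (2 * (d1 * d3 * n2) * (x3 * conj x3) : ℂ) = 2 * d3 * (x3 * conj x3) * (d1 * n2) := by ring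
    rw [this, hbb]
    linear_combination (-2 * d3 * (d2 + d3 * (a2 * conj a2)) * (x3 * conj x3)) * e1
  have hre : n1 * d2 * (2 * S.re) = 2 * n1 * d2 * (d2 * ‖x2‖ ^ 2) -
      2 * d2 * ‖n1 * x1 + d3 * conj (b3 - a1 * a2) * x3‖ ^ 2 - 2 * (d1 * d3 * n2) * ‖x3‖ ^ 2 := by
    simp only [← ofReal_normSq_eq, Complex.add_conj] at key
    exact_mod_cast key
  have q1 : 0 ≤ n1 * d2 * (d2 * ‖x2‖ ^ 2) := by
    have : n1 * d2 * (d2 * ‖x2‖ ^ 2) = n1 * (d2 * ‖x2‖) ^ 2 := by ring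
    rw [this]; positivity
  have q2 : 0 ≤ (-d2) * ‖n1 * x1 + d3 * conj (b3 - a1 * a2) * x3‖ ^ 2 := by
    have : 0 < -d2 := by linarith
    positivity
  have q3 : 0 ≤ d1 * d3 * (-n2) * ‖x3‖ ^ 2 := by
    have : 0 < -n2 := by linarith
    positivity
  have q4 : 0 < n1 * (-d2) := mul_pos N1 (by linarith)
  constructor
  · by_contra! h
    have := mul_pos q4 h
    nlinarith
  · intro h0
    rw [h0] at hre
    have z3 : d1 * d3 * (-n2) * ‖x3‖ ^ 2 = 0 := by nlinarith
    have z2 : (-d2) * ‖n1 * x1 + d3 * conj (b3 - a1 * a2) * x3‖ ^ 2 = 0 := by nlinarith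
    have z1 : n1 * d2 * (d2 * ‖x2‖ ^ 2) = 0 := by nlinarith
    have hx3 : x3 = 0 := by
      have : d1 * d3 * (-n2) ≠ 0 := by
        have : 0 < -n2 := by linarith
        positivity
      simpa using (mul_eq_zero.1 z3).resolve_left this
    have hx2 : x2 = 0 := by simpa [hd2.ne, N1.ne'] using z1
    refine ⟨?_, hx2, hx3⟩
    rw [hx3] at z2
    simpa [hd2.ne, N1.ne'] using z2

end Signs

end Bsq

namespace Bsq

/-! ### The jump relations as isometries -/

section Data

/-- `s(k) = (k - 1/k) / (2i)`, which is `Im k` on the unit circle. -/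
def sfn (k : ℂ) : ℂ := (k - k⁻¹) / (2 * Complex.I)

theorem sfn_inv (k : ℂ) : sfn k⁻¹ = -sfn k := by
  rw [sfn, sfn, inv_inv]; ring

theorem sfn_neg (k : ℂ) : sfn (-k) = -sfn k := by
  rw [sfn, sfn, inv_neg]; ring

open ComplexConjugate in
theorem conj_sfn (k : ℂ) : conj (sfn k) = -sfn (conj k) := by
  simp only [sfn, map_div₀, map_sub, map_inv₀, map_mul, Complex.conj_I, map_ofNat]
  rw [mul_neg, div_neg]

open ComplexConjugate in
theorem sfn_conj_inv (k : ℂ) : sfn (conj k)⁻¹ = conj (sfn k) := by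
  rw [sfn_inv, conj_sfn]

theorem sfn_exp (θ : ℝ) : sfn (Complex.exp (θ * Complex.I)) = Real.sin θ := by
  rw [sfn, ← Complex.exp_neg, Complex.ofReal_sin, Complex.sin]
  rw [div_eq_div_iff (by simp) (by norm_num)]
  linear_combination (-2 * (Complex.exp (-(θ * Complex.I)) - Complex.exp (θ * Complex.I))) *
    Complex.I_sq + (2 * Complex.I ^ 2) * congrArg Complex.exp (show -(θ * Complex.I) =
      -(θ : ℂ) * Complex.I by ring)

/-- The rational factor r̃ is the quotient s(ω²q)/s(ωq). Thus the symmetry between r₂ and conj r₁ is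
a symmetrization by the weights of the form. -/
theorem rtilde_mul_sfn {q : ℂ} (hq : q ≠ 0) (h : (om * q) ^ 2 ≠ 1) :
    rtilde q * sfn (om * q) = sfn (om ^ 2 * q) := by
  have ho := om_ne_zero
  have h3 := om_cube
  have hden : 1 - om ^ 2 * q ^ 2 ≠ 0 := by
    rw [← mul_pow]; exact sub_ne_zero.2 h.symm
  rw [rtilde, sfn, sfn]
  field_simp
  linear_combination (om ^ 3 * q ^ 4 - 1 - om * q ^ 2 + om ^ 2 * q ^ 2) * h3

theorem theta_add (x t : ℝ) (k : ℂ) : theta 3 1 x t k = theta 3 2 x t k + theta 2 1 x t k := by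
  simp only [theta]; ring

open ComplexConjugate in
theorem conj_lfun_inv (j : ℕ) (k : ℂ) : conj (lfun j (conj k)⁻¹) = -lfun j k := by
  have h : conj om = om⁻¹ := by
    rw [conj_om]
    exact eq_inv_of_mul_eq_one_left (by rw [← pow_succ, om_cube])
  have h2 : conj (om ^ j * (conj k)⁻¹) = (om ^ j * k)⁻¹ := by
    rw [map_mul, map_inv₀, Complex.conj_conj, map_pow, h, mul_inv, inv_pow]
  rw [lfun, lfun]
  generalize om ^ j * (conj k)⁻¹ = w at h2 ⊢
  simp only [map_div₀, map_mul, map_add, map_inv₀, h2, Complex.conj_I, Complex.conj_ofReal,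
    map_ofNat, inv_inv]
  ring

open ComplexConjugate in
theorem conj_zfun_inv (j : ℕ) (k : ℂ) : conj (zfun j (conj k)⁻¹) = -zfun j k := by
  have h : conj om = om⁻¹ := by
    rw [conj_om]
    exact eq_inv_of_mul_eq_one_left (by rw [← pow_succ, om_cube])
  have h2 : conj (om ^ j * (conj k)⁻¹) = (om ^ j * k)⁻¹ := by
    rw [map_mul, map_inv₀, Complex.conj_conj, map_pow, h, mul_inv, inv_pow]
  rw [zfun, zfun]
  generalize om ^ j * (conj k)⁻¹ = w at h2 ⊢
  simp only [map_div₀, map_mul, map_add, map_inv₀, map_pow, h2, Complex.conj_I,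
    Complex.conj_ofReal, map_ofNat, inv_inv, inv_pow]
  ring

-- Each phase is purely imaginary on the unit circle and extends this by reflection. On the circle
-- the exponentials are therefore unimodular; on the rays those at k and at its reflection cancel.
open ComplexConjugate in
theorem conj_theta_inv (i j : ℕ) (x t : ℝ) (k : ℂ) :
    conj (theta i j x t (conj k)⁻¹) = -theta i j x t k := by
  simp only [theta, map_add, map_mul, map_sub, Complex.conj_ofReal, conj_lfun_inv, conj_zfun_inv]
  ring

variable {r1 r2 : ℂ → ℂ} {Z : Finset ℂ} {c : ℂ → ℂ}

open ComplexConjugate in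
theorem conj_inv_of_norm_one {k : ℂ} (hk : ‖k‖ = 1) : (conj k)⁻¹ = k := by
  have h : k * conj k = 1 := by rw [← ofReal_normSq_eq, hk]; simp
  exact inv_eq_of_mul_eq_one_left h

theorem om_sq_pow_six : (om ^ 2) ^ 6 = 1 := by
  rw [← pow_mul, show 2 * 6 = 3 * 4 from rfl, pow_mul, om_cube, one_pow]

theorem om_pow_six : om ^ 6 = 1 := by
  rw [show 6 = 3 * 2 from rfl, pow_mul, om_cube, one_pow]

theorem ne_of_pow_six {k w : ℂ} (hk : k ^ 6 ≠ 1) (hw : w ^ 6 = 1) : k ≠ w ∧ k ≠ -w := by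
  refine ⟨?_, ?_⟩ <;> rintro rfl
  · exact hk hw
  · exact hk (by rw [neg_pow, hw]; norm_num)

theorem sq_ne_one_of_pow_six {k : ℂ} (hk : k ^ 6 ≠ 1) : k ^ 2 ≠ 1 := by
  intro h
  exact hk (by rw [show 6 = 2 * 3 from rfl, pow_mul, h, one_pow])

open ComplexConjugate in
theorem r2_eq_of_norm_one (hd : IsScatteringData r1 r2 Z c) {k : ℂ} (hk : ‖k‖ = 1)
    (hk6 : k ^ 6 ≠ 1) : r2 k * sfn (om * k) = sfn (om ^ 2 * k) * conj (r1 k) := by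
  have hk0 : k ≠ 0 := by rintro rfl; simp at hk
  obtain ⟨h1, h2⟩ := ne_of_pow_six hk6 om_sq_pow_six
  have := hd.conj_rel k (Or.inr (by simpa [unitCircle] using hk)) hk0 h1 h2
  rw [conj_inv_of_norm_one hk] at this
  rw [this, ← rtilde_mul_sfn hk0]
  · ring
  · apply sq_ne_one_of_pow_six
    rwa [mul_pow, om_pow_six, one_mul]

/-- This is the nonvanishing denominator in the quotient formula for r₂ at ω²k; the excluded points
±ω² turn into k = ±1. -/
theorem one_sub_r1_ne_zero (hd : IsScatteringData r1 r2 Z c) {k : ℂ} (hk : ‖k‖ = 1)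
    (hk2 : k ^ 2 ≠ 1) : 1 - r1 k * r1 k⁻¹ ≠ 0 := by
  have e1 : om * (om ^ 2 * k) = k := by rw [← mul_assoc, ← pow_succ', om_cube, one_mul]
  have h1 : om ^ 2 * k ≠ om ^ 2 := by
    intro h
    apply hk2
    have : k = 1 := mul_left_cancel₀ (pow_ne_zero 2 om_ne_zero) (by rw [h, mul_one])
    rw [this, one_pow]
  have h2 : om ^ 2 * k ≠ -om ^ 2 := by
    intro h
    apply hk2
    have : k = -1 := mul_left_cancel₀ (pow_ne_zero 2 om_ne_zero) (by rw [h]; ring)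
    rw [this]; norm_num
  have := (hd.circ_rel_r2 (om ^ 2 * k) (by simp [unitCircle, norm_om, hk]) h1 h2).1
  rwa [e1, one_div] at this

open ComplexConjugate in
/-- The relation on the unit circle, with `r₂` eliminated. -/
theorem circle_relation (hd : IsScatteringData r1 r2 Z c) {k : ℂ} (hk : ‖k‖ = 1)
    (hk6 : k ^ 6 ≠ 1) : sfn (om * k) * r1 k⁻¹ + sfn (om ^ 2 * k) * conj (r1 k) +
      sfn k * (r1 (om * k) * conj (r1 (om * k⁻¹))) = 0 := by
  have hk0 : k ≠ 0 := by rintro rfl; simp at hk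
  have e1 : om * (om ^ 2 * k) = k := by rw [← mul_assoc, ← pow_succ', om_cube, one_mul]
  have e2 : om ^ 2 * (om ^ 2 * k) = om * k := by
    rw [← mul_assoc, ← pow_add, show 2 + 2 = 3 + 1 from rfl, pow_succ, om_cube, one_mul]
  have e3 : (om ^ 2 * k)⁻¹ = om * k⁻¹ := by
    rw [mul_inv]; congr 1
    exact inv_eq_of_mul_eq_one_left (by rw [← pow_succ', om_cube])
  have hb6 : (om ^ 2 * k) ^ 6 ≠ 1 := by rwa [mul_pow, om_sq_pow_six, one_mul]
  obtain ⟨h1, h2⟩ := ne_of_pow_six hb6 om_pow_six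
  -- Evaluated at ω²k so that the arguments become k, k⁻¹, ωk and ωk⁻¹. Then both values of r₂ are
  -- replaced by weighted conjugates of r₁.
  have h := hd.circ_rel (om ^ 2 * k) (by simp [unitCircle, norm_om, hk]) h1 h2
  rw [e1, e2, one_div, one_div, e3] at h
  have g1 := r2_eq_of_norm_one hd hk hk6
  have g2 := r2_eq_of_norm_one hd (k := om * k⁻¹) (by simp [norm_om, hk]) (by
    rw [mul_pow, om_pow_six, one_mul, inv_pow, ne_eq, inv_eq_one]; exact hk6)
  have e4 : om * (om * k⁻¹) = (om * k)⁻¹ := by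
    rw [mul_inv om k, ← mul_assoc]; congr 1
    exact eq_inv_of_mul_eq_one_left (by linear_combination om_cube)
  have e5 : om ^ 2 * (om * k⁻¹) = k⁻¹ := by rw [← mul_assoc, ← pow_succ, om_cube, one_mul]
  rw [e4, e5, sfn_inv, sfn_inv] at g2
  linear_combination sfn (om * k) * h - g1 + r1 (om * k) * g2

theorem circPar_add (a b : ℝ) : circPar (a + b) = circPar a * circPar b := by
  simp only [circPar]; rw [← Complex.exp_add]; congr 1; push_cast; ring

theorem circPar_neg (a : ℝ) : circPar (-a) = (circPar a)⁻¹ := by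
  simp only [circPar]; rw [← Complex.exp_neg]; congr 1; push_cast; ring

theorem circPar_om : circPar (2 * Real.pi / 3) = om := om_eq_exp.symm

theorem circPar_two_pi : circPar (2 * Real.pi) = 1 := by
  simp only [circPar]; rw [← Complex.exp_two_pi_mul_I]; congr 1; push_cast; ring

theorem norm_circPar (a : ℝ) : ‖circPar a‖ = 1 := Complex.norm_exp_ofReal_mul_I a

theorem sfn_circPar (a : ℝ) : sfn (circPar a) = Real.sin a := sfn_exp a

theorem circPar_om_sub (φ : ℝ) : circPar (φ - 2 * Real.pi / 3) = om ^ 2 * circPar φ := by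
  rw [sub_eq_add_neg, circPar_add, circPar_neg, circPar_om, mul_comm]; congr 1
  exact inv_eq_of_mul_eq_one_left (by rw [← pow_succ, om_cube])

theorem circPar_om_add (φ : ℝ) : circPar (φ + 2 * Real.pi / 3) = om * circPar φ := by
  rw [circPar_add, circPar_om, mul_comm]

theorem circPar_pow_six_ne_one {φ : ℝ} (hφ : φ ∈ Ioo 0 (Real.pi / 3)) : circPar φ ^ 6 ≠ 1 := by
  intro h
  rw [circPar, ← Complex.exp_nat_mul, Complex.exp_eq_one_iff] at h
  obtain ⟨m, hm⟩ := h
  have h2 := congrArg Complex.im hm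
  simp at h2
  have hpi := Real.pi_pos
  have h0 : (0 : ℝ) < m := by
    by_contra! hle
    have := hφ.1
    nlinarith
  have h1 : (m : ℝ) < 1 := by
    by_contra! hle
    have := hφ.2
    nlinarith
  have h0' : 0 < m := by exact_mod_cast h0
  have h1' : m < 1 := by exact_mod_cast h1
  omega

open ComplexConjugate in
/-- Signs of the diagonal minors of the jump matrix on the unit circle. -/
theorem circle_signs (hd : IsScatteringData r1 r2 Z c) {σ : ℂ} (hσ : σ = 1 ∨ σ = -1) {φ : ℝ}
    (hφ : φ ∈ Ioo 0 (Real.pi / 3)) :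
    0 < Real.sin (φ + 2 * Real.pi / 3) + Real.sin (φ - 2 * Real.pi / 3) * ‖r1 (σ * circPar φ)‖ ^ 2 +
      Real.sin φ * ‖r1 (σ * circPar (-φ + 2 * Real.pi / 3))‖ ^ 2 ∧
    Real.sin (φ + 2 * Real.pi / 3) * ‖r1 (σ * circPar (-φ))‖ ^ 2 + Real.sin (φ - 2 * Real.pi / 3) +
      Real.sin φ * ‖r1 (σ * circPar (φ + 2 * Real.pi / 3))‖ ^ 2 < 0 := by
  have hpi := Real.pi_pos
  set g : ℝ → ℂ := fun θ => r1 (σ * circPar θ) with hg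
  have hgc : Continuous g := by
    have hc : Continuous fun θ : ℝ => r1 (circPar θ) := by
      have := hd.r1_circ.continuousOn
      rwa [continuousOn_univ] at this
    rcases hσ with h | h
    · simpa [hg, h] using hc
    · have : g = fun θ => r1 (circPar (θ + Real.pi)) := by
        ext θ
        have : circPar Real.pi = -1 := by simp [circPar, Complex.exp_pi_mul_I]
        simp [hg, h, circPar_add, this]
      rw [this]
      exact hc.comp (by fun_prop)
  have hper : ∀ θ, g (θ + 2 * Real.pi) = g θ := by
    intro θ; simp only [hg]; rw [circPar_add, circPar_two_pi, mul_one]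
  have hσ2 : σ * σ = 1 := by rcases hσ with h | h <;> rw [h] <;> norm_num
  have hσ0 : σ ≠ 0 := by rcases hσ with h | h <;> rw [h] <;> norm_num
  have hσi : σ⁻¹ = σ := inv_eq_of_mul_eq_one_left hσ2
  have hσn : ‖σ‖ = 1 := by rcases hσ with h | h <;> rw [h] <;> simp
  have hsσ : ∀ k, sfn (σ * k) = σ * sfn k := by
    intro k
    rcases hσ with h | h <;> rw [h]
    · simp
    · rw [neg_one_mul, sfn_neg]; ring
  have hnorm : ∀ θ, ‖σ * circPar θ‖ = 1 := fun θ => by rw [norm_mul, hσn, norm_circPar, one_mul]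
  have hsix : ∀ θ, circPar θ ^ 6 ≠ 1 → (σ * circPar θ) ^ 6 ≠ 1 := by
    intro θ h
    rwa [mul_pow, show 6 = 2 * 3 from rfl, pow_mul, sq, hσ2, one_pow, one_mul]
  -- The arcs at 1 and at -1 are treated together: s(σk) = σ s(k) for σ = ±1, so the sign cancels
  -- from the relation.
  have hrel : ∀ θ, circPar θ ^ 6 ≠ 1 → Real.sin (θ + 2 * Real.pi / 3) * g (-θ) +
      Real.sin (θ - 2 * Real.pi / 3) * conj (g θ) +
      Real.sin θ * (g (θ + 2 * Real.pi / 3) * conj (g (-θ + 2 * Real.pi / 3))) = 0 := by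
    intro θ hθ
    have h := circle_relation hd (hnorm θ) (hsix θ hθ)
    have e1 : om * (σ * circPar θ) = σ * circPar (θ + 2 * Real.pi / 3) := by
      rw [circPar_om_add]; ring
    have e2 : om ^ 2 * (σ * circPar θ) = σ * circPar (θ - 2 * Real.pi / 3) := by
      rw [circPar_om_sub]; ring
    have e3 : (σ * circPar θ)⁻¹ = σ * circPar (-θ) := by rw [mul_inv, hσi, circPar_neg]
    have e4 : om * (σ * circPar (-θ)) = σ * circPar (-θ + 2 * Real.pi / 3) := by
      rw [circPar_om_add]; ring
    rw [e3, e1, e2, e4, hsσ, hsσ, hsσ, sfn_circPar, sfn_circPar, sfn_circPar] at h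
    simp only [hg]
    refine mul_left_cancel₀ hσ0 ?_
    rw [mul_zero, ← h]; ring
  have hne : ∀ θ, circPar θ ^ 2 ≠ 1 → 1 - g θ * g (-θ) ≠ 0 := by
    intro θ hθ
    have := one_sub_r1_ne_zero hd (hnorm θ) (by rwa [mul_pow, sq, hσ2, one_mul])
    rwa [mul_inv, hσi, ← circPar_neg] at this
  have hshift1 : ∀ φ ∈ Ioo 0 (Real.pi / 3), circPar (φ + 2 * Real.pi / 3) ^ 6 ≠ 1 := by
    intro φ hφ
    rw [circPar_om_add, mul_pow, om_pow_six, one_mul]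
    exact circPar_pow_six_ne_one hφ
  have hshift2 : ∀ φ ∈ Ioo 0 (Real.pi / 3), circPar (φ - 2 * Real.pi / 3) ^ 6 ≠ 1 := by
    intro φ hφ
    rw [circPar_om_sub, mul_pow, om_sq_pow_six, one_mul]
    exact circPar_pow_six_ne_one hφ
  have hom2 : om ^ 2 ≠ 1 := by
    intro h
    have h1 := om_cube
    rw [pow_succ, h, one_mul] at h1
    have := om_re
    rw [h1] at this
    norm_num at this
  have hsin : 0 < Real.sin (Real.pi / 3) :=
    Real.sin_pos_of_pos_of_lt_pi (by linarith) (by linarith)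
  have hsin2 : 0 < Real.sin (2 * Real.pi / 3) :=
    Real.sin_pos_of_pos_of_lt_pi (by linarith) (by linarith)
  -- The arc runs from 1 to e^{iπ/3}: the weights sin(φ + 2π/3), sin(φ - 2π/3), sin φ have signs +,
  -- -, + inside it. At each end one weight vanishes and the other two are opposite, which gives the
  -- limits -1 compared there.
  refine signs_on_arc hgc (e1 := fun φ => Real.sin (φ + 2 * Real.pi / 3))
    (e2 := fun φ => Real.sin (φ - 2 * Real.pi / 3)) (e3 := Real.sin)
    (by fun_prop) (by fun_prop) (by fun_prop) (L := Real.pi / 3) (α := 2 * Real.pi / 3)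
    (by linarith) ?_ ?_ ?_ ?_ ?_ ?_ ?_ (by ring) ?_ ?_ ?_ ?_ ?_ ?_ ?_ ?_ φ hφ
  · exact fun φ hφ => Real.sin_pos_of_pos_of_lt_pi (by linarith [hφ.1]) (by linarith [hφ.2])
  · exact fun φ hφ => Real.sin_neg_of_neg_of_neg_pi_lt (by linarith [hφ.2]) (by linarith [hφ.1])
  · exact fun φ hφ => Real.sin_pos_of_pos_of_lt_pi (by linarith [hφ.1]) (by linarith [hφ.2])
  · simp only [zero_add, zero_sub, Real.sin_neg]
    rw [div_neg, div_self hsin2.ne']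
  · simpa using hsin2.ne'
  · have : Real.pi / 3 - 2 * Real.pi / 3 = -(Real.pi / 3) := by ring
    simp only [this, Real.sin_neg]
    rw [neg_div, div_self hsin.ne']
  · exact hsin.ne'
  · exact fun φ hφ => hrel φ (circPar_pow_six_ne_one hφ)
  · intro φ hφ
    have h := hrel _ (hshift1 φ hφ)
    have e1 : φ + 2 * Real.pi / 3 + 2 * Real.pi / 3 = φ - 2 * Real.pi / 3 + 2 * Real.pi := by ring
    rw [e1, Real.sin_add_two_pi, hper, show -(φ + 2 * Real.pi / 3) = -φ - 2 * Real.pi / 3 by ring,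
      show φ + 2 * Real.pi / 3 - 2 * Real.pi / 3 = φ by ring,
      show -φ - 2 * Real.pi / 3 + 2 * Real.pi / 3 = -φ by ring] at h
    exact h
  · intro φ hφ
    have h := hrel _ (hshift2 φ hφ)
    have e1 : φ - 2 * Real.pi / 3 - 2 * Real.pi / 3 = φ + 2 * Real.pi / 3 - 2 * Real.pi := by ring
    have e2 : -φ + 2 * Real.pi / 3 + 2 * Real.pi / 3 = -φ - 2 * Real.pi / 3 + 2 * Real.pi := by ring
    rw [e1, Real.sin_sub_two_pi, show -(φ - 2 * Real.pi / 3) = -φ + 2 * Real.pi / 3 by ring, e2, hper,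
      show φ - 2 * Real.pi / 3 + 2 * Real.pi / 3 = φ by ring] at h
    exact h
  · exact fun φ hφ => hne φ (sq_ne_one_of_pow_six (circPar_pow_six_ne_one hφ))
  · intro φ hφ
    have := hne _ (sq_ne_one_of_pow_six (hshift1 φ hφ))
    rwa [show -(φ + 2 * Real.pi / 3) = -φ - 2 * Real.pi / 3 by ring] at this
  · intro φ hφ
    have := hne _ (sq_ne_one_of_pow_six (hshift2 φ hφ))
    rwa [show -(φ - 2 * Real.pi / 3) = -φ + 2 * Real.pi / 3 by ring] at this
  · exact hne _ (by rw [circPar_om]; exact hom2)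
  · refine hne _ ?_
    rw [sq, ← circPar_add, show Real.pi / 3 + Real.pi / 3 = 2 * Real.pi / 3 by ring, circPar_om]
    intro h
    exact hom2 (by rw [h, one_pow])

open ComplexConjugate in
/-- Definiteness of the form attached to the jump across the unit circle near the real axis. -/
theorem circle_form_neg (hd : IsScatteringData r1 r2 Z c) (x t : ℝ) {σ : ℂ}
    (hσ : σ = 1 ∨ σ = -1) {φ : ℝ} (hφ : φ ∈ Ioo 0 (Real.pi / 3)) {u w : Fin 3 → ℂ}
    (hw : w = u ᵥ* vmat r1 r2 x t 8 (σ * circPar φ)) :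
    (-sfn (om * circPar φ) * (u 0 * conj (w 0)) + sfn (om ^ 2 * circPar φ) * (u 1 * conj (w 1)) -
      sfn (circPar φ) * (u 2 * conj (w 2))).re ≤ 0 ∧
    ((-sfn (om * circPar φ) * (u 0 * conj (w 0)) + sfn (om ^ 2 * circPar φ) * (u 1 * conj (w 1)) -
      sfn (circPar φ) * (u 2 * conj (w 2))).re = 0 → u = 0) := by
  have hpi := Real.pi_pos
  have hσ2 : σ * σ = 1 := by rcases hσ with h | h <;> rw [h] <;> norm_num
  have hσ0 : σ ≠ 0 := by rcases hσ with h | h <;> rw [h] <;> norm_num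
  have hσn : ‖σ‖ = 1 := by rcases hσ with h | h <;> rw [h] <;> simp
  have hsσ : ∀ k, sfn (σ * k) = σ * sfn k := by
    intro k
    rcases hσ with h | h <;> rw [h]
    · simp
    · rw [neg_one_mul, sfn_neg]; ring
  set k : ℂ := σ * circPar φ with hk
  have hkn : ‖k‖ = 1 := by rw [hk, norm_mul, hσn, norm_circPar, one_mul]
  have hk0 : k ≠ 0 := by intro h; rw [h] at hkn; simp at hkn
  have hk6 : k ^ 6 ≠ 1 := by
    rw [hk, mul_pow, show 6 = 2 * 3 from rfl, pow_mul, sq, hσ2, one_pow, one_mul]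
    exact circPar_pow_six_ne_one hφ
  obtain ⟨hN1, hN2⟩ := circle_signs hd hσ hφ
  set d1 := Real.sin (φ + 2 * Real.pi / 3) with hd1
  set d2 := Real.sin (φ - 2 * Real.pi / 3) with hd2
  set d3 := Real.sin φ with hd3
  have p1 : 0 < d1 := Real.sin_pos_of_pos_of_lt_pi (by linarith [hφ.1]) (by linarith [hφ.2])
  have p2 : d2 < 0 := Real.sin_neg_of_neg_of_neg_pi_lt (by linarith [hφ.2]) (by linarith [hφ.1])
  have p3 : 0 < d3 := Real.sin_pos_of_pos_of_lt_pi (by linarith [hφ.1]) (by linarith [hφ.2])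
  have s1 : sfn (om * circPar φ) = d1 := by rw [← circPar_om_add, sfn_circPar]
  have s2 : sfn (om ^ 2 * circPar φ) = d2 := by rw [← circPar_om_sub, sfn_circPar]
  have s3 : sfn (circPar φ) = d3 := sfn_circPar φ
  have k1 : sfn (om * k) = σ * d1 := by
    rw [hk, show om * (σ * circPar φ) = σ * (om * circPar φ) by ring, hsσ, s1]
  have k2 : sfn (om ^ 2 * k) = σ * d2 := by
    rw [hk, show om ^ 2 * (σ * circPar φ) = σ * (om ^ 2 * circPar φ) by ring, hsσ, s2]
  have k3 : sfn k = σ * d3 := by rw [hk, hsσ, s3]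
  set a1 := r1 k with ha1
  set a2 := r1 (om * k) with ha2
  set b1 := r1 k⁻¹ with hb1
  set b3 := r1 (om * k⁻¹) with hb3
  have hki : k⁻¹ = σ * circPar (-φ) := by
    rw [hk, mul_inv, circPar_neg, inv_eq_of_mul_eq_one_left hσ2]
  have E2 : r1 (σ * circPar (φ + 2 * Real.pi / 3)) = a2 := by
    rw [ha2, hk, circPar_om_add]; congr 1; ring
  have E3 : r1 (σ * circPar (-φ + 2 * Real.pi / 3)) = b3 := by
    rw [hb3, hki, circPar_om_add]; congr 1; ring
  have E4 : r1 (σ * circPar (-φ)) = b1 := by rw [hb1, hki]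
  rw [E3] at hN1
  rw [E4, E2] at hN2
  have e3 : (om ^ 2 * k)⁻¹ = om * k⁻¹ := by
    rw [mul_inv]; congr 1
    exact inv_eq_of_mul_eq_one_left (by rw [← pow_succ', om_cube])
  have e4 : om * (om * k⁻¹) = (om * k)⁻¹ := by
    rw [mul_inv om k, ← mul_assoc]; congr 1
    exact eq_inv_of_mul_eq_one_left (by linear_combination om_cube)
  have e5 : om ^ 2 * (om * k⁻¹) = k⁻¹ := by rw [← mul_assoc, ← pow_succ, om_cube, one_mul]
  have e6 : om * (om * k) = om ^ 2 * k := by ring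
  have e7 : om ^ 2 * (om * k) = k := by rw [← mul_assoc, ← pow_succ, om_cube, one_mul]
  have h1 := circle_relation hd hkn hk6
  rw [k1, k2, k3] at h1
  have h1' : d1 * b1 + d2 * conj a1 + d3 * (a2 * conj b3) = 0 := by
    refine mul_left_cancel₀ hσ0 ?_
    rw [mul_zero, ← h1]; ring
  have R1 : r2 k * d1 = d2 * conj a1 := by
    have := r2_eq_of_norm_one hd hkn hk6
    rw [k1, k2] at this
    refine mul_left_cancel₀ hσ0 ?_
    linear_combination this
  have R2 : r2 (om * k) * d2 = d3 * conj a2 := by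
    have := r2_eq_of_norm_one hd (k := om * k) (by simp [norm_om, hkn])
      (by rwa [mul_pow, om_pow_six, one_mul])
    rw [e6, e7, k2, k3] at this
    refine mul_left_cancel₀ hσ0 ?_
    linear_combination this
  have R3 : r2 (om * k⁻¹) * d1 = d3 * conj b3 := by
    have := r2_eq_of_norm_one hd (k := om * k⁻¹) (by simp [norm_om, hkn]) (by
      rw [mul_pow, om_pow_six, one_mul, inv_pow, ne_eq, inv_eq_one]; exact hk6)
    rw [e4, e5, sfn_inv, sfn_inv, k1, k3] at this
    refine mul_left_cancel₀ hσ0 ?_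
    linear_combination -this
  -- Two unimodular exponentials suffice because θ₃₁ = θ₃₂ + θ₂₁. They are absorbed into the second
  -- and third components, which leaves the form unchanged and removes x and t from the algebra.
  set E := Complex.exp (theta 2 1 x t k) with hE
  set F := Complex.exp (theta 3 2 x t k) with hF
  have hE0 : E ≠ 0 := Complex.exp_ne_zero _
  have hF0 : F ≠ 0 := Complex.exp_ne_zero _
  have hEc : E * conj E = 1 := by
    have := conj_theta_inv 2 1 x t k
    rw [conj_inv_of_norm_one hkn] at this
    rw [hE, ← Complex.exp_conj, this, ← Complex.exp_add, add_neg_cancel, Complex.exp_zero]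
  have hFc : F * conj F = 1 := by
    have := conj_theta_inv 3 2 x t k
    rw [conj_inv_of_norm_one hkn] at this
    rw [hF, ← Complex.exp_conj, this, ← Complex.exp_add, add_neg_cancel, Complex.exp_zero]
  have w0 := congrFun hw 0
  have w1 := congrFun hw 1
  have w2 := congrFun hw 2
  simp only [vmat, Matrix.vecMul, dotProduct, Fin.sum_univ_three, theta_add, neg_add,
    Complex.exp_add, Complex.exp_neg, ffun, one_div, e3, Matrix.of_apply, Matrix.cons_val_zero,
    Matrix.cons_val_one, Matrix.cons_val, ← hE, ← hF, ← ha1, ← ha2, ← hb3] at w0 w1 w2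
  have hd1' : (d1 : ℂ) ≠ 0 := Complex.ofReal_ne_zero.2 p1.ne'
  have hd2' : (d2 : ℂ) ≠ 0 := Complex.ofReal_ne_zero.2 p2.ne
  have main := arc_form_neg p1 p2 p3 h1' hN1 hN2 (x1 := u 0) (x2 := u 1 * E) (x3 := u 2 * (E * F))
    (y1 := w 0) (y2 := w 1 * E) (y3 := w 2 * (E * F)) (by
      rw [w0, map_sub, map_mul]
      refine mul_left_cancel₀ hd2' ?_
      linear_combination (d2 * (u 0 * a1 + u 1 * E)) * R1 + (d2 * (u 0 * b3 + u 2 * (E * F))) * R3 -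
        (u 2 * (E * F) * d1 * r2 k) * R2 - (u 2 * (E * F) * d3 * conj a2) * R1) (by
      rw [w1]
      field_simp
      linear_combination (-(u 2 * E * F)) * R2) (by
      rw [w2]
      field_simp
      linear_combination (u 2 * E * F * a2) * R2)
  have eq : (-d1 * (u 0 * conj (w 0)) + d2 * (u 1 * E * conj (w 1 * E)) -
      d3 * (u 2 * (E * F) * conj (w 2 * (E * F))) : ℂ) =
      -d1 * (u 0 * conj (w 0)) + d2 * (u 1 * conj (w 1)) - d3 * (u 2 * conj (w 2)) := by
    simp only [map_mul]
    linear_combination (d2 * (u 1 * conj (w 1)) - d3 * (u 2 * conj (w 2)) * (F * conj F)) * hEc -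
      d3 * (u 2 * conj (w 2)) * hFc
  rw [eq] at main
  rw [s1, s2, s3]
  refine ⟨main.1, fun h => ?_⟩
  obtain ⟨z0, z1, z2⟩ := main.2 h
  ext i
  fin_cases i
  · exact z0
  · simpa [hE0] using z1
  · simpa [hE0, hF0] using z2

open ComplexConjugate in
/-- The form has no jump across the ray `arg k = π/6`. -/
theorem ray_form_eq (hd : IsScatteringData r1 r2 Z c) (x t : ℝ) {r : ℝ} (hr : 1 < r)
    {k q : ℂ} (hk : k = r * (-(Complex.I * kap 3))) (hq : q = ((r⁻¹ : ℝ) : ℂ) * (Complex.I * kap 6))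
    {u w u' w' : Fin 3 → ℂ} (hu : u' = u ᵥ* vmat r1 r2 x t 3 k)
    (hw : w' = w ᵥ* vmat r1 r2 x t 6 q) :
    -sfn (om * k) * (u' 0 * conj (w' 0)) + sfn (om ^ 2 * k) * (u' 1 * conj (w' 1)) -
      sfn k * (u' 2 * conj (w' 2)) =
    -sfn (om * k) * (u 0 * conj (w 0)) + sfn (om ^ 2 * k) * (u 1 * conj (w 1)) -
      sfn k * (u 2 * conj (w 2)) := by
  have hr0 : (0 : ℝ) < r := by linarith
  have hrC : (r : ℂ) ≠ 0 := Complex.ofReal_ne_zero.2 hr0.ne'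
  rw [kap_three] at hk
  rw [kap_six] at hq
  have hI := Complex.I_ne_zero
  have ho := om_ne_zero
  have hom := om_cube
  -- On this pair of rays the jumps involve r₁ at -ir and i/r and r₂ at -i/r and ir. These are
  -- points of Γ₁ and Γ₄ exchanged by k ↦ 1/k̄, so both values of r₂ can be expressed through r₁.
  have hb : om ^ 2 * k = -(r * Complex.I) := by
    rw [hk]; linear_combination (-(r * Complex.I)) * hom
  have hb' : om ^ 2 * q = -(Complex.I / r) := by
    rw [hq]; push_cast; field_simp; linear_combination -hom
  have hbi : 1 / -(r * Complex.I) = Complex.I / r := by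
    field_simp; rw [Complex.I_sq]
  have hbi' : 1 / -(Complex.I / r) = r * Complex.I := by
    field_simp; rw [Complex.I_sq]
  have hqk : q = (conj k)⁻¹ := by
    rw [hk, hq]
    simp only [map_mul, map_neg, Complex.conj_ofReal, Complex.conj_I, conj_om]
    push_cast
    field_simp
    linear_combination (-om ^ 3) * Complex.I_sq + hom
  have hG1 : -(Complex.I / r) ∈ GammaRay 4 ∪ unitCircle := by
    left; left
    refine ⟨r⁻¹, by positivity, inv_le_one_of_one_le₀ hr.le, ?_⟩
    rw [kap_four]; push_cast; field_simp
  have hG2 : r * Complex.I ∈ GammaRay 4 ∪ unitCircle := by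
    left; right
    refine ⟨r, hr.le, ?_⟩
    rw [kap_four]; ring
  have hn1 : ‖-(Complex.I / r)‖ < 1 := by
    rw [norm_neg, norm_div, Complex.norm_I, Complex.norm_real, Real.norm_of_nonneg hr0.le]
    exact (div_lt_one hr0).2 hr
  have hn2 : 1 < ‖(r : ℂ) * Complex.I‖ := by
    rw [norm_mul, Complex.norm_I, Complex.norm_real, Real.norm_of_nonneg hr0.le, mul_one]; exact hr
  have hon : ‖om ^ 2‖ = 1 := by rw [norm_pow, norm_om, one_pow]
  have hne1 : -(Complex.I / r) ≠ om ^ 2 ∧ -(Complex.I / r) ≠ -om ^ 2 := by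
    constructor <;> intro h <;> rw [h] at hn1
    · exact hn1.ne hon
    · rw [norm_neg] at hn1; exact hn1.ne hon
  have hne2 : (r : ℂ) * Complex.I ≠ om ^ 2 ∧ (r : ℂ) * Complex.I ≠ -om ^ 2 := by
    constructor <;> intro h <;> rw [h] at hn2
    · exact hn2.ne' hon
    · rw [norm_neg] at hn2; exact hn2.ne' hon
  have z1 : -(Complex.I / r) ≠ 0 := by simp [hrC]
  have z2 : (r : ℂ) * Complex.I ≠ 0 := by simp [hrC]
  have c1 := hd.conj_rel _ hG1 z1 hne1.1 hne1.2
  have c2 := hd.conj_rel _ hG2 z2 hne2.1 hne2.2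
  have i1 : (conj (-(Complex.I / r)))⁻¹ = -(r * Complex.I) := by
    simp only [map_neg, map_div₀, Complex.conj_I, Complex.conj_ofReal]
    field_simp; rw [Complex.I_sq]; norm_num
  have i2 : (conj ((r : ℂ) * Complex.I))⁻¹ = Complex.I / r := by
    simp only [map_mul, Complex.conj_I, Complex.conj_ofReal]
    field_simp; rw [Complex.I_sq]
  rw [i1] at c1
  rw [i2] at c2
  have hsq : ∀ z : ℂ, ‖z‖ ≠ 1 → (om * z) ^ 2 ≠ 1 := by
    intro z hz h
    have := congrArg norm h
    rw [norm_pow, norm_mul, norm_om, one_mul, norm_one] at this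
    exact hz ((pow_eq_one_iff_of_nonneg (norm_nonneg _) (by norm_num)).1 this)
  have t1 := rtilde_mul_sfn z1 (hsq _ hn1.ne)
  have t2 := rtilde_mul_sfn z2 (hsq _ hn2.ne')
  have j1 : om * (-(Complex.I / r)) = (conj k)⁻¹ := by
    rw [← hb', ← hqk, ← mul_assoc, ← pow_succ', hom, one_mul]
  have j2 : om ^ 2 * (-(Complex.I / r)) = (conj (om * k))⁻¹ := by
    rw [map_mul, mul_inv, ← hqk, conj_om, ← hb', ← mul_assoc]
    congr 1
    refine eq_inv_of_mul_eq_one_left ?_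
    linear_combination (om ^ 3 + 1) * hom
  have j3 : om * ((r : ℂ) * Complex.I) = conj (om * k) := by
    rw [hk]
    simp only [map_mul, map_neg, Complex.conj_ofReal, Complex.conj_I, conj_om]
    linear_combination (-(om * r * Complex.I)) * hom
  have j4 : om ^ 2 * ((r : ℂ) * Complex.I) = conj k := by
    rw [hk]
    simp only [map_mul, map_neg, Complex.conj_ofReal, Complex.conj_I, conj_om]
    ring
  rw [j1, j2, sfn_conj_inv, sfn_conj_inv] at t1
  rw [j3, j4, ← neg_neg (sfn (conj (om * k))), ← neg_neg (sfn (conj k)), ← conj_sfn,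
    ← conj_sfn] at t2
  have t1' := congrArg conj t1
  have t2' := congrArg conj t2
  -- The two identities express the conjugated values of r̃ through the weights at k itself, which
  -- is what cancels the cross terms of the form.
  simp only [map_mul, map_neg, Complex.conj_conj] at t1' t2'
  set E := Complex.exp (theta 3 1 x t k) with hE
  have hE0 : E ≠ 0 := Complex.exp_ne_zero _
  have hEq : conj (Complex.exp (theta 3 1 x t q)) = E⁻¹ := by
    rw [hqk, ← Complex.exp_conj, conj_theta_inv, Complex.exp_neg]
  have u0 := congrFun hu 0
  have u1 := congrFun hu 1
  have u2 := congrFun hu 2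
  have w0 := congrArg conj (congrFun hw 0)
  have w1 := congrFun hw 1
  have w2 := congrArg conj (congrFun hw 2)
  simp [vmat, Matrix.vecMul, dotProduct, Fin.sum_univ_three, hb, hb', Complex.exp_neg, ← hE,
    -one_div, hbi, hbi', c1, c2, hEq] at u0 u1 u2 w0 w1 w2
  rw [u0, u1, u2, w0, w1, w2]
  generalize r1 (-(r * Complex.I)) = A at *
  generalize r1 (Complex.I / r) = B at *
  generalize conj (rtilde (-(Complex.I / r))) = ρ₁ at *
  generalize conj (rtilde ((r : ℂ) * Complex.I)) = ρ₂ at *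
  field_simp
  linear_combination (conj (w 2) * (u 0 * A * B ^ 2 * ρ₂ + u 2 * A * B * ρ₂ * E) -
    conj (w 0) * (u 0 * A * B * E + u 2 * A * E ^ 2)) * t1' - u 0 * conj (w 2) * B * t2'

end Data

end Bsq

namespace Bsq

/-! ### The local hermitian form -/

open ComplexConjugate

section Form

/-- The sesquilinear form in the values of the solution at `k` and at `k̄`. -/
def hform (σ k : ℂ) (u v : Fin 3 → ℂ) : ℂ :=
  σ * (-sfn (om * k) * (u 0 * conj (v 1)) + sfn (om ^ 2 * k) * (u 1 * conj (v 0))) -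
    sfn k * (u 2 * conj (v 2))

/-- The form, applied to the values of `N` at `k` and at `k̄`. -/
def herm (N : ℂ → Fin 3 → ℂ) (σ k : ℂ) : ℂ := hform σ k (N k) (N (conj k))

theorem vecMul_matB (u : Fin 3 → ℂ) : u ᵥ* matB = ![u 1, u 0, u 2] := by
  ext i
  fin_cases i <;> simp [matB, Matrix.vecMul, dotProduct, Fin.sum_univ_three]

theorem vecMul_matA (u : Fin 3 → ℂ) : u ᵥ* matA = ![u 1, u 2, u 0] := by
  ext i
  fin_cases i <;> simp [matA, Matrix.vecMul, dotProduct, Fin.sum_univ_three]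

theorem sfn_om_mul_neg_inv (k : ℂ) : sfn (om * -k⁻¹) = sfn (om ^ 2 * k) := by
  have : om * -k⁻¹ = -(om ^ 2 * k)⁻¹ := by
    rw [mul_inv, inv_eq_of_mul_eq_one_left (show om * om ^ 2 = 1 by rw [← pow_succ', om_cube])]
    ring
  rw [this, sfn_neg, sfn_inv, neg_neg]

theorem sfn_om_sq_mul_neg_inv (k : ℂ) : sfn (om ^ 2 * -k⁻¹) = sfn (om * k) := by
  have : om ^ 2 * -k⁻¹ = -(om * k)⁻¹ := by
    rw [mul_inv, inv_eq_of_mul_eq_one_left (show om ^ 2 * om = 1 by rw [← pow_succ, om_cube])]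
    ring
  rw [this, sfn_neg, sfn_inv, neg_neg]

theorem sfn_neg_inv (k : ℂ) : sfn (-k⁻¹) = sfn k := by rw [sfn_neg, sfn_inv, neg_neg]

/-- Under k ↦ -1/k the weights s(ωk) and s(ω²k) are exchanged and s(k) is fixed, while ℬ swaps the
first two components. The sign σ absorbs the minus sign between the crossed terms. -/
theorem hform_neg_inv (k : ℂ) (u v : Fin 3 → ℂ) :
    hform (-1) (-k⁻¹) (u ᵥ* matB) (v ᵥ* matB) = hform 1 k u v := by
  rw [hform, hform, vecMul_matB, vecMul_matB, sfn_om_mul_neg_inv, sfn_om_sq_mul_neg_inv,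
    sfn_neg_inv]
  simp

theorem conj_sfn_om_mul (k : ℂ) : conj (sfn (om * k)) = -sfn (om ^ 2 * conj k) := by
  rw [conj_sfn, map_mul, conj_om]

theorem conj_sfn_om_sq_mul (k : ℂ) : conj (sfn (om ^ 2 * k)) = -sfn (om * conj k) := by
  rw [conj_sfn, map_mul, map_pow, conj_om, ← pow_mul, show 2 * 2 = 3 + 1 from rfl, pow_succ,
    om_cube, one_mul]

/-- At a real point the two crossed terms are complex conjugate, so their sum is real, and s(a) is
purely imaginary. The coefficient is positive both for a > 1 and for -1 < a < 0, the two real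
intervals inside the sectors. -/
theorem hform_real_im {σ : ℂ} (hσ : σ = 1 ∨ σ = -1) (a : ℝ) (u : Fin 3 → ℂ) :
    (hform σ a u u).im = (a - a⁻¹) / 2 * ‖u 2‖ ^ 2 := by
  have h1 := conj_sfn_om_sq_mul a
  rw [Complex.conj_ofReal] at h1
  have h2 : sfn a = ((-(a - a⁻¹) / 2 : ℝ) : ℂ) * Complex.I := by
    rw [sfn]
    field_simp
    rw [Complex.I_sq]
    push_cast
    ring
  have h3 : -sfn (om * a) * (u 0 * conj (u 1)) = conj (sfn (om ^ 2 * a) * (u 1 * conj (u 0))) := by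
    rw [map_mul, map_mul, h1, Complex.conj_conj]; ring
  have h4 : (u 2 * conj (u 2) : ℂ) = ((‖u 2‖ ^ 2 : ℝ) : ℂ) := (ofReal_normSq_eq _).symm
  rw [hform, h3, h2, h4, add_comm, Complex.add_conj]
  generalize (sfn (om ^ 2 * a) * (u 1 * conj (u 0))).re = y
  have h5 : (σ * ((2 * y : ℝ) : ℂ)).im = 0 := by
    rcases hσ with h | h <;> rw [h] <;> simp
  rw [Complex.sub_im, h5, mul_right_comm, ← Complex.ofReal_mul, Complex.im_ofReal_mul, Complex.I_im]
  ring

theorem differentiableAt_sfn {k : ℂ} (hk : k ≠ 0) : DifferentiableAt ℂ sfn k := by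
  unfold sfn
  exact ((differentiableAt_id.sub (differentiableAt_inv hk)).div_const _)

/-- Conjugating both the argument and the value of a holomorphic function keeps it holomorphic; the
form is built from such factors and the weights. -/
theorem differentiableAt_herm {N : ℂ → Fin 3 → ℂ} {k : ℂ} (hk : k ≠ 0)
    (h : DifferentiableAt ℂ N k) (h' : DifferentiableAt ℂ N (conj k)) (σ : ℂ) :
    DifferentiableAt ℂ (herm N σ) k := by
  rw [differentiableAt_pi] at h h'
  have hc : ∀ i, DifferentiableAt ℂ (fun z => conj (N (conj z) i)) k := fun i => by
    have := (h' i).conj_conj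
    rwa [Complex.conj_conj] at this
  have h1 : DifferentiableAt ℂ (fun z => sfn (om * z)) k :=
    (differentiableAt_sfn (mul_ne_zero om_ne_zero hk)).comp k (by fun_prop)
  have h2 : DifferentiableAt ℂ (fun z => sfn (om ^ 2 * z)) k :=
    (differentiableAt_sfn (mul_ne_zero (pow_ne_zero 2 om_ne_zero) hk)).comp k (by fun_prop)
  have h3 := differentiableAt_sfn hk
  unfold herm hform
  exact (((h1.neg.mul ((h 0).mul (hc 1))).add (h2.mul ((h 1).mul (hc 0)))).const_mul σ).sub
    (h3.mul ((h 2).mul (hc 2)))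

theorem tendsto_hform {α : Type*} {F : Filter α} {κ : α → ℂ} {k : ℂ} (hk : k ≠ 0)
    (hκ : Tendsto κ F (𝓝 k)) {u v : α → Fin 3 → ℂ} {u₀ v₀ : Fin 3 → ℂ}
    (hu : Tendsto u F (𝓝 u₀)) (hv : Tendsto v F (𝓝 v₀)) (σ : ℂ) :
    Tendsto (fun a => hform σ (κ a) (u a) (v a)) F (𝓝 (hform σ k u₀ v₀)) := by
  rw [tendsto_pi_nhds] at hu hv
  have hc : ∀ i, Tendsto (fun a => conj (v a i)) F (𝓝 (conj (v₀ i))) := fun i =>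
    (Complex.continuous_conj.tendsto _).comp (hv i)
  have hs : ∀ z : ℂ, z ≠ 0 → Tendsto (fun a => sfn (z * κ a)) F (𝓝 (sfn (z * k))) := fun z hz =>
    ((differentiableAt_sfn (mul_ne_zero hz hk)).continuousAt.tendsto).comp (hκ.const_mul z)
  have h3 := hs 1 one_ne_zero
  simp only [one_mul] at h3
  exact ((((hs _ om_ne_zero).neg.mul ((hu 0).mul (hc 1))).add
    ((hs _ (pow_ne_zero 2 om_ne_zero)).mul ((hu 1).mul (hc 0)))).const_mul σ).sub
    (h3.mul ((hu 2).mul (hc 2)))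

/-- A holomorphic function with nonnegative imaginary part on the real line is bounded below
linearly in `Im q`. -/
theorem exists_im_lower_bound {h : ℂ → ℂ} {a : ℝ}
    (hd : ∀ᶠ q in 𝓝 (a : ℂ), DifferentiableAt ℂ h q)
    (hr : ∀ᶠ y : ℝ in 𝓝[≠] a, 0 ≤ (h y).im) :
    ∃ C : ℝ, ∀ᶠ q in 𝓝 (a : ℂ), 0 < q.im → -C * q.im ≤ (h q).im := by
  have han : AnalyticAt ℂ h a := Complex.analyticAt_iff_eventually_differentiableAt.2 hd
  -- A holomorphic function is locally Lipschitz, so h(q) is compared with h(Re q), at distance Im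
  -- q.
  obtain ⟨K, s, hs, hK⟩ := (han.contDiffAt (n := 1)).exists_lipschitzOnWith
  have hcont : ContinuousAt (fun y : ℝ => (h y).im) a :=
    Complex.continuous_im.continuousAt.comp (ContinuousAt.comp (f := fun y : ℝ => (y : ℂ))
      hd.self_of_nhds.continuousAt Complex.continuous_ofReal.continuousAt)
  have ha : 0 ≤ (h a).im :=
    ge_of_tendsto (hcont.tendsto.mono_left nhdsWithin_le_nhds) hr
  have hr' : ∀ᶠ y : ℝ in 𝓝 a, 0 ≤ (h y).im := by
    rw [eventually_nhdsWithin_iff] at hr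
    filter_upwards [hr] with y hy
    by_cases hya : y = a
    · rw [hya]; exact ha
    · exact hy hya
  have hre : Tendsto (fun q : ℂ => q.re) (𝓝 (a : ℂ)) (𝓝 a) := by
    simpa using Complex.continuous_re.tendsto (a : ℂ)
  have hre' : Tendsto (fun q : ℂ => (q.re : ℂ)) (𝓝 (a : ℂ)) (𝓝 (a : ℂ)) :=
    (Complex.continuous_ofReal.tendsto a).comp hre
  refine ⟨K, ?_⟩
  filter_upwards [hs, hre' hs, hre.eventually hr'] with q h1 h2 h3 hq
  have h4 := hK.dist_le_mul _ h1 _ h2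
  have h5 : dist q (q.re : ℂ) = q.im := by
    rw [dist_eq_norm]
    have : q - (q.re : ℂ) = (q.im : ℂ) * Complex.I := by apply Complex.ext <;> simp
    rw [this, norm_mul, Complex.norm_I, mul_one, Complex.norm_real, Real.norm_of_nonneg hq.le]
  rw [h5, dist_eq_norm] at h4
  have h6 := Complex.abs_im_le_norm (h q - h (q.re : ℂ))
  rw [Complex.sub_im] at h6
  have := (abs_le.1 h6).1
  linarith

end Form

end Bsq

namespace Bsq

/-! ### Behaviour of the form at the poles of the continued solution -/

open ComplexConjugate

section Poles

variable {r1 r2 : ℂ → ℂ} {Z : Finset ℂ} {c : ℂ → ℂ} {ε x t : ℝ} {n : ℂ → Fin 3 → ℂ}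

theorem om_sq_sq : (om ^ 2) ^ 2 = om := by
  rw [← pow_mul, show 2 * 2 = 3 + 1 from rfl, pow_succ, om_cube, one_mul]

theorem om_mul_inv_eq {i j : ℕ} (h : om ^ i * om ^ j = 1) (k : ℂ) :
    om ^ i * k⁻¹ = (om ^ j * k)⁻¹ := by
  rw [mul_inv, inv_eq_of_mul_eq_one_left h]

theorem lfun_inv {i j : ℕ} (h : om ^ i * om ^ j = 1) (k : ℂ) : lfun i k⁻¹ = lfun j k := by
  rw [lfun, lfun, om_mul_inv_eq h, inv_inv, add_comm]

theorem zfun_inv {i j : ℕ} (h : om ^ i * om ^ j = 1) (k : ℂ) : zfun i k⁻¹ = zfun j k := by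
  rw [zfun, zfun, om_mul_inv_eq h, inv_pow, inv_inv, add_comm]

theorem theta_inv {i j i' j' : ℕ} (h : om ^ i * om ^ i' = 1) (h' : om ^ j * om ^ j' = 1)
    (x t : ℝ) (k : ℂ) : theta i j x t k⁻¹ = theta i' j' x t k := by
  rw [theta, theta, lfun_inv h, lfun_inv h', zfun_inv h, zfun_inv h']

theorem conj_theta_conj {i j i' j' : ℕ} (h : om ^ i * om ^ i' = 1) (h' : om ^ j * om ^ j' = 1)
    (x t : ℝ) (k : ℂ) : conj (theta i j x t (conj k)) = -theta i' j' x t k := by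
  have := conj_theta_inv i j x t k⁻¹
  rwa [map_inv₀, inv_inv, theta_inv h h'] at this

theorem conj_theta_three_two (x t : ℝ) (k : ℂ) :
    conj (theta 3 2 x t (conj k)) = -theta 3 1 x t k :=
  conj_theta_conj (by rw [om_cube, one_mul]) (by rw [← pow_add, om_cube]) x t k

theorem conj_theta_two_one (x t : ℝ) (k : ℂ) :
    conj (theta 2 1 x t (conj k)) = theta 2 1 x t k := by
  rw [conj_theta_conj (i' := 1) (j' := 2) (by rw [← pow_add, om_cube])
    (by rw [← pow_add, om_cube])]
  simp only [theta]
  ring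

theorem sq_sub_ne_zero {p z : ℂ} (hz : ‖z‖ = 1) (hn : ‖p‖ ≠ 1) : p ^ 2 - z ≠ 0 := by
  intro h
  have := congrArg norm (sub_eq_zero.1 h)
  rw [norm_pow, hz] at this
  exact hn ((pow_eq_one_iff_of_nonneg (norm_nonneg _) (by norm_num)).1 this)

theorem norm_ne_one_of_mem_sectors {p : ℂ} (hp : p ∈ sectors) : ‖p‖ ≠ 1 := by
  rcases hp with h | h
  · exact h.1.ne'
  · exact h.1.ne

/-- The polar coefficients at a pair `p`, `p̄` of centers are proportional. -/
theorem poleQ_add_poleP {p c e e' k : ℂ} (hk : k ≠ 0) (hp : ‖p‖ ≠ 1) (he : conj e' = e) :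
    sfn (om * k) * conj (poleQ (conj p) c e' (conj k)) + sfn k * poleP p c e k = 0 := by
  have hp1 := sq_sub_ne_zero norm_om hp
  have hp2 : om - p ^ 2 ≠ 0 := by rwa [← neg_sub, neg_ne_zero]
  have h1 : conj (poleQ (conj p) c e' (conj k)) =
      c * e / (k - p) * ((k ^ 2 - 1) / (om * (om - p ^ 2))) := by
    simp only [poleQ, map_mul, map_div₀, map_sub, map_pow, Complex.conj_conj, map_one, conj_om, he]
    rw [om_sq_sq]
  rw [h1, poleP, sfn, sfn]
  have := om_ne_zero
  by_cases hkp : k = p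
  · simp [hkp]
  have hkp' : k - p ≠ 0 := sub_ne_zero.2 hkp
  have e1 : (k ^ 2 - 1) / (om * (om - p ^ 2)) = -((k ^ 2 - 1) / (om * (p ^ 2 - om))) := by
    rw [← neg_sub (p ^ 2) om, mul_neg, div_neg]
  rw [e1]
  field_simp
  linear_combination (-(c * e * (k ^ 2 - 1))) * om_cube

/-- Nonreal points of Z have |k| > 1 with Im k > 0, or |k| < 1 with Im k < 0; conjugation changes
only the sign of the imaginary part. -/
theorem conj_notMem_of_mem (hd : IsScatteringData r1 r2 Z c) {p : ℂ} (hp : p ∈ Z)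
    (him : p.im ≠ 0) : conj p ∉ Z := by
  intro hp'
  have key : ∀ q ∈ Z, q.im ≠ 0 → (1 < ‖q‖ ∧ 0 < q.im) ∨ (‖q‖ < 1 ∧ q.im < 0) := by
    intro q hq hqi
    rcases hd.zeros_mem q hq with h | ⟨a, rfl, -⟩
    · exact h.2
    · simp at hqi
  have h1 := key p hp him
  have h2 := key _ hp' (by simpa using him)
  rw [Complex.norm_conj, Complex.conj_im] at h2
  rcases h1 with h1 | h1 <;> rcases h2 with h2 | h2 <;> linarith [h1.1, h1.2, h2.1, h2.2]

theorem norm_gt_iff_of_mem (hd : IsScatteringData r1 r2 Z c) {p : ℂ} (hp : p ∈ Z)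
    (him : p.im ≠ 0) : (1 < ‖p‖ ∧ 0 < p.im) ∨ (‖p‖ < 1 ∧ p.im < 0) := by
  rcases hd.zeros_mem p hp with h | ⟨a, rfl, -⟩
  · exact h.2
  · simp at him

theorem conj_mem_ball {p k : ℂ} (h : k ∈ Metric.ball p ε) :
    conj k ∈ Metric.ball (conj p) ε := by
  rw [Metric.mem_ball, Complex.dist_conj_conj]; exact h

/-- The values of the continued solution near a nonreal point of `Z` and its conjugate. -/
theorem continued_pair (hd : IsScatteringData r1 r2 Z c) (hε : AdmissibleRadius Z ε)
    (hn : IsHomogeneousSolution r1 r2 Z c ε x t n) {p : ℂ} (hp : p ∈ Z) (him : p.im ≠ 0)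
    {k : ℂ} (hk : k ∈ Metric.ball p ε) (hkp : k ≠ p) : ∃ β γ : ℂ,
    continued Z c ε x t n k = n k + ![0, 0, n k 0 * β] ∧
    continued Z c ε x t n (conj k) = n (conj k) + ![0, n (conj k) 2 * γ, 0] ∧
    sfn (om * k) * conj γ + sfn k * β = 0 := by
  have hpc : p ∈ centers Z := Or.inl hp
  have hks := closedBall_subset_sectors hd hε hpc (Metric.ball_subset_closedBall hk)
  refine ⟨poleP p (c p) (Complex.exp (-theta 3 1 x t p)) k,
    poleQ (conj p) (c p) (Complex.exp (theta 3 2 x t (conj p))) (conj k), ?_, ?_, ?_⟩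
  · rw [continued_eq_of_inside hd hε hn hpc hk hkp, poleTerm_mem him hp]
  · rw [continued_eq_of_inside hd hε hn (conj_mem_centers hpc) (conj_mem_ball hk)
      (fun h => hkp ((starRingEnd ℂ).injective h)),
      poleTerm_notMem (by simpa using him) (conj_notMem_of_mem hd hp him), Complex.conj_conj]
  · refine poleQ_add_poleP (ne_zero_of_mem_sectors hks)
      (norm_ne_one_of_mem_sectors (centers_subset_sectors hd hpc)) ?_
    rw [← Complex.exp_conj, conj_theta_three_two]

/-- The polar term at k enters through its third component and the one at k̄ through its second.
Both produce the product of the first component at k and the conjugate third component at k̄, with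
opposite coefficients, so the form does not see the poles. -/
theorem herm_continued_outer (hd : IsScatteringData r1 r2 Z c) (hε : AdmissibleRadius Z ε)
    (hn : IsHomogeneousSolution r1 r2 Z c ε x t n) {p : ℂ} (hp : p ∈ Z) (him : p.im ≠ 0)
    {k : ℂ} (hk : k ∈ Metric.ball p ε) (hkp : k ≠ p) :
    herm (continued Z c ε x t n) 1 k = hform 1 k (n k) (n (conj k)) := by
  obtain ⟨β, γ, h1, h2, h3⟩ := continued_pair hd hε hn hp him hk hkp
  rw [herm, h1, h2, hform, hform]
  simp
  linear_combination (-(n k 0 * conj (n (conj k) 2))) * h3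

/-- Same cancellation with the roles of k and k̄ exchanged. The product now comes from the other
crossed term of the form, and this is why σ = -1 is needed in the inner sector. -/
theorem herm_continued_inner (hd : IsScatteringData r1 r2 Z c) (hε : AdmissibleRadius Z ε)
    (hn : IsHomogeneousSolution r1 r2 Z c ε x t n) {p : ℂ} (hp : p ∈ Z) (him : p.im ≠ 0)
    {k : ℂ} (hk : k ∈ Metric.ball (conj p) ε) (hkp : k ≠ conj p) :
    herm (continued Z c ε x t n) (-1) k = hform (-1) k (n k) (n (conj k)) := by
  have hk' : conj k ∈ Metric.ball p ε := by simpa using conj_mem_ball hk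
  obtain ⟨β, γ, h1, h2, h3⟩ := continued_pair hd hε hn hp him hk'
    (fun h => hkp (by rw [← h, Complex.conj_conj]))
  rw [Complex.conj_conj] at h2
  have h4 := congrArg conj h3
  simp only [map_add, map_mul, map_zero, conj_sfn, Complex.conj_conj, conj_om] at h4
  rw [herm, h1, h2, hform, hform]
  simp
  linear_combination (n k 2 * conj (n (conj k) 0)) * h4

/-- The form has a limit at every point of the upper half of the sectors. -/
theorem exists_tendsto_herm (hd : IsScatteringData r1 r2 Z c) (hε : AdmissibleRadius Z ε)
    (hn : IsHomogeneousSolution r1 r2 Z c ε x t n) {k σ : ℂ} (him : 0 < k.im)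
    (hk : (k ∈ outerSector ∧ σ = 1) ∨ (k ∈ innerSector ∧ σ = -1)) :
    ∃ l, Tendsto (herm (continued Z c ε x t n) σ) (𝓝[(centers Z)ᶜ] k) (𝓝 l) := by
  have hks : k ∈ sectors := hk.imp And.left And.left
  have hk0 := ne_zero_of_mem_sectors hks
  by_cases hkc : k ∈ centers Z
  swap
  · refine ⟨_, (differentiableAt_herm hk0 (differentiableAt_continued hd hε hn ⟨hks, hkc⟩)
      (differentiableAt_continued hd hε hn ⟨conj_mem_sectors hks, fun h => hkc ?_⟩)
      σ).continuousAt.tendsto.mono_left nhdsWithin_le_nhds⟩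
    simpa using conj_mem_centers h
  have hcc := conj_mem_centers hkc
  have hball : Metric.ball k ε ∈ 𝓝 k := Metric.ball_mem_nhds _ hε.1
  have hev : ∀ᶠ z in 𝓝[(centers Z)ᶜ] k,
      hform σ z (n z) (n (conj z)) = herm (continued Z c ε x t n) σ z := by
    -- The position of Z decides the sign: a center in the upper half-plane is a point of Z only if
    -- it lies outside the unit disk, and the conjugate of one only if it lies inside. So σ always
    -- fits the cancellation.
    rcases hkc with hZ | hZ
    · have hσ : σ = 1 := by
        rcases norm_gt_iff_of_mem hd hZ him.ne' with h | h
        · rcases hk with hk | hk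
          · exact hk.2
          · linarith [hk.1.1, h.1]
        · linarith [h.2]
      subst hσ
      filter_upwards [nhdsWithin_le_nhds hball, self_mem_nhdsWithin] with z hz hz'
      exact (herm_continued_outer hd hε hn hZ him.ne' hz
        (by rintro rfl; exact hz' (Or.inl hZ))).symm
    · have hi : (conj k).im ≠ 0 := by simpa using him.ne'
      have hσ : σ = -1 := by
        rcases norm_gt_iff_of_mem hd hZ hi with h | h
        · have := h.2; rw [Complex.conj_im] at this; linarith
        · rcases hk with hk | hk
          · have := h.1; rw [Complex.norm_conj] at this; linarith [hk.1.1]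
          · exact hk.2
      subst hσ
      filter_upwards [nhdsWithin_le_nhds hball, self_mem_nhdsWithin] with z hz hz'
      refine (herm_continued_inner hd hε hn hZ hi (by rwa [Complex.conj_conj]) ?_).symm
      rw [Complex.conj_conj]
      rintro rfl; exact hz' (Or.inr hZ)
  have hdiff : ∀ p ∈ centers Z, DifferentiableAt ℂ n p := fun p hp =>
    differentiableAt_solution hd hε hn (centers_subset_sectors hd hp)
      (dist_ne_of_mem_ball hε hp (Metric.mem_ball_self hε.1))
  exact ⟨_, Tendsto.congr' hev ((differentiableAt_herm hk0 (hdiff k hkc) (hdiff _ hcc)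
    σ).continuousAt.tendsto.mono_left nhdsWithin_le_nhds)⟩

/-- The polar coefficient at a real center, multiplied by the weight of the form. -/
theorem sfn_mul_poleP {a e κ : ℝ} {c : ℂ} (ha : ‖(a : ℂ)‖ ≠ 1)
    (hκ : Complex.I * (om ^ 2 * (a : ℂ) ^ 2 - om) * c = κ) {k : ℂ} (hk : k ≠ 0) (hka : k ≠ a) :
    sfn (om ^ 2 * k) * poleP a c e k =
      ((-(κ * e) / (2 * ‖(a : ℂ) ^ 2 - om‖ ^ 2) : ℝ) : ℂ) * ((k ^ 4 + k ^ 2 + 1) / k) / (k - a) := by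
  have h1 := sq_sub_ne_zero norm_om ha
  have h2 := sq_sub_ne_zero (z := om ^ 2) (by rw [norm_pow, norm_om, one_pow]) ha
  have h3 : ((‖(a : ℂ) ^ 2 - om‖ ^ 2 : ℝ) : ℂ) = ((a : ℂ) ^ 2 - om) * ((a : ℂ) ^ 2 - om ^ 2) := by
    rw [ofReal_normSq_eq, map_sub, map_pow, Complex.conj_ofReal, conj_om]
  have h4 := sub_ne_zero.2 hka
  have hI := Complex.I_ne_zero
  have ho := om_ne_zero
  have hI2 := Complex.I_sq
  have h5 : sfn (om ^ 2 * k) = -Complex.I * om ^ 2 * (k ^ 2 - om ^ 2) / (2 * k) := by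
    rw [sfn, mul_inv, inv_eq_of_mul_eq_one_left (show om * om ^ 2 = 1 by rw [← pow_succ', om_cube])]
    field_simp
    linear_combination (om * k ^ 2 - om ^ 3) * hI2 + om_cube
  -- The numerator of the pole and the weight combine to a polynomial with real coefficients, so the
  -- weighted pole is real on the real axis.
  have h6 : (k ^ 2 - om ^ 2) * (k ^ 2 - om) = k ^ 4 + k ^ 2 + 1 := by
    linear_combination (-k ^ 2) * om_sq_add + om_cube
  have h7 : Complex.I * om ^ 2 * c * ((a : ℂ) ^ 2 - om ^ 2) = κ := by
    rw [← hκ]; linear_combination (-(Complex.I * c * om)) * om_cube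
  rw [h5, poleP, ← h6]
  rw [Complex.ofReal_div, Complex.ofReal_mul 2, h3, Complex.ofReal_neg, Complex.ofReal_mul, ← h7,
    Complex.ofReal_ofNat]
  field_simp

/-- Lower bound for the imaginary part of the form near the real points of the sectors. -/
theorem exists_herm_im_lower_bound (hd : IsScatteringData r1 r2 Z c) (hε : AdmissibleRadius Z ε)
    (hn : IsHomogeneousSolution r1 r2 Z c ε x t n) {a σ : ℝ}
    (ha : (1 < a ∧ σ = 1) ∨ (a ∈ Ioo (-1 : ℝ) 0 ∧ σ = -1)) :
    ∃ C : ℝ, ∀ᶠ q in 𝓝 (a : ℂ), 0 < q.im →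
      -C * q.im ≤ (herm (continued Z c ε x t n) σ q).im := by
  have has : (a : ℂ) ∈ sectors := ofReal_mem_sectors (ha.symm.imp And.left And.left)
  have hσ : (σ : ℂ) = 1 ∨ (σ : ℂ) = -1 := by
    rcases ha with h | h <;> rw [h.2] <;> simp
  have hσa : 0 < σ * a := by
    rcases ha with h | h
    · rw [h.2]; linarith
    · rw [h.2]; linarith [h.1.2]
  have hpos : ∀ᶠ y : ℝ in 𝓝 a, 0 ≤ (y - y⁻¹) / 2 := by
    rcases ha with ⟨h, -⟩ | ⟨h, -⟩
    · filter_upwards [lt_mem_nhds h] with y hy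
      have := inv_lt_one_of_one_lt₀ hy
      linarith
    · filter_upwards [Ioo_mem_nhds h.1 h.2] with y hy
      have := (inv_lt_of_neg hy.2 (by norm_num : (-1 : ℝ) < 0)).2 (by norm_num; exact hy.1)
      linarith [hy.1]
  have ha0 := ne_zero_of_mem_sectors has
  have hne0 : ∀ᶠ q in 𝓝 (a : ℂ), q ≠ 0 := eventually_ne_nhds ha0
  by_cases hac : (a : ℂ) ∈ centers Z
  swap
  · refine exists_im_lower_bound ?_ ?_
    · filter_upwards [isOpen_sectors_diff_centers.mem_nhds ⟨has, hac⟩] with q hq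
      refine differentiableAt_herm (ne_zero_of_mem_sectors hq.1)
        (differentiableAt_continued hd hε hn hq)
        (differentiableAt_continued hd hε hn ⟨conj_mem_sectors hq.1, fun h => hq.2 ?_⟩) _
      simpa using conj_mem_centers h
    · refine nhdsWithin_le_nhds ?_
      filter_upwards [hpos] with y hy
      rw [herm, Complex.conj_ofReal, hform_real_im hσ]
      positivity
  have haZ : (a : ℂ) ∈ Z := by
    rcases hac with h | h
    · exact h
    · simpa using h
  obtain ⟨κ, hκ0, hκ⟩ := hd.pos _ haZ (Complex.ofReal_im a)
  set e : ℝ := Real.exp (-(theta 2 1 x t a).re) with he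
  have hee : Complex.exp (-theta 2 1 x t a) = e := by
    have h1 : conj (theta 2 1 x t a) = theta 2 1 x t a := by
      have := conj_theta_two_one x t a
      rwa [Complex.conj_ofReal] at this
    rw [he, Complex.ofReal_exp, Complex.ofReal_neg, Complex.conj_eq_iff_re.1 h1]
  set N := continued Z c ε x t n with hN
  have hball : Metric.ball (a : ℂ) ε ∈ 𝓝 (a : ℂ) := Metric.ball_mem_nhds _ hε.1
  have hcball : ∀ q ∈ Metric.ball (a : ℂ) ε, conj q ∈ Metric.ball (a : ℂ) ε := fun q hq => by
    simpa using conj_mem_ball hq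
  have hdiff : ∀ p ∈ Metric.ball (a : ℂ) ε, DifferentiableAt ℂ n p := fun p hp =>
    differentiableAt_solution hd hε hn
      (closedBall_subset_sectors hd hε hac (Metric.ball_subset_closedBall hp))
      (dist_ne_of_mem_ball hε hac hp)
  set M : ℝ := -(κ * e) / (2 * ‖(a : ℂ) ^ 2 - om‖ ^ 2) with hM
  have hM0 : M ≤ 0 := by
    rw [hM]
    refine div_nonpos_of_nonpos_of_nonneg ?_ (by positivity)
    have : 0 < e := Real.exp_pos _
    nlinarith
  -- ψ(q)/(q - a) is the whole contribution of the polar terms. Those at q and at q̄ contribute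
  -- equally, hence the factor 2.
  set ψ : ℂ → ℂ := fun q => 2 * σ * (M * ((q ^ 4 + q ^ 2 + 1) / q)) * (n q 0 * conj (n (conj q) 0))
    with hψ
  have hψd : ∀ q ∈ Metric.ball (a : ℂ) ε, q ≠ 0 → DifferentiableAt ℂ ψ q := by
    intro q hq hq0
    have h1 := differentiableAt_pi.1 (hdiff q hq) 0
    have h2 := (differentiableAt_pi.1 (hdiff _ (hcball q hq)) 0).conj_conj
    rw [Complex.conj_conj] at h2
    have h3 : DifferentiableAt ℂ (fun q : ℂ => 2 * (σ : ℂ) * (M * ((q ^ 4 + q ^ 2 + 1) / q))) q := by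
      fun_prop (disch := assumption)
    exact h3.mul (h1.mul h2)
  have hψr : ∀ y : ℝ, ψ y = ((2 * σ * (M * ((y ^ 4 + y ^ 2 + 1) / y)) * ‖n y 0‖ ^ 2 : ℝ) : ℂ) := by
    intro y
    simp only [hψ]
    rw [Complex.conj_ofReal, ← ofReal_normSq_eq]
    push_cast
    ring
  -- The residue of the form at a. It is nonpositive because M ≤ 0 by the positivity condition and σ
  -- has the sign of a.
  set c₀ : ℝ := 2 * σ * (M * ((a ^ 4 + a ^ 2 + 1) / a)) * ‖n a 0‖ ^ 2 with hc₀
  have hc₀0 : c₀ ≤ 0 := by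
    have h1 : c₀ = -(2 * (-M) * (a ^ 4 + a ^ 2 + 1) * ‖n a 0‖ ^ 2 * (σ / a)) := by
      rw [hc₀]; ring
    have h2 : 0 < σ / a := by
      rcases ha with h | h
      · rw [h.2]; exact div_pos one_pos (by linarith)
      · rw [h.2]; exact div_pos_of_neg_of_neg (by norm_num) h.1.2
    rw [h1, neg_nonpos]
    have : 0 ≤ -M := by linarith
    positivity
  -- Splitting off the pole: ψ(q)/(q - a) is its difference quotient at a, holomorphic and real on
  -- the real axis, plus c₀/(q - a).
  have hherm : ∀ q ∈ Metric.ball (a : ℂ) ε, q ≠ a →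
      herm N σ q = (hform σ q (n q) (n (conj q)) + dslope ψ a q) + c₀ / (q - a) := by
    intro q hq hqa
    have hq0 := ne_zero_of_mem_sectors
      (closedBall_subset_sectors hd hε hac (Metric.ball_subset_closedBall hq))
    have hqa' : conj q ≠ a := fun h => hqa (by rw [← Complex.conj_conj q, h, Complex.conj_ofReal])
    have hs := sub_ne_zero.2 hqa
    have h1 := sfn_mul_poleP (e := e) (norm_ne_one_of_mem_sectors has) hκ hq0 hqa
    have h2 := sfn_mul_poleP (e := e) (norm_ne_one_of_mem_sectors has) hκ
      (by simpa using hq0) hqa'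
    have h3 := congrArg conj h2
    rw [map_mul, conj_sfn_om_sq_mul, Complex.conj_conj] at h3
    simp only [map_mul, map_div₀, map_add, map_sub, map_pow, map_one, Complex.conj_conj,
      Complex.conj_ofReal] at h3
    rw [← hM] at h1 h3
    have h4 : dslope ψ a q + c₀ / (q - a) = ψ q / (q - a) := by
      rw [dslope_of_ne _ hqa, slope_def_field, hψr a, ← add_div, sub_add_cancel]
    rw [add_assoc, h4, herm, hN, continued_eq_of_inside hd hε hn hac hq hqa,
      continued_eq_of_inside hd hε hn hac (hcball q hq) hqa',
      poleTerm_real (Complex.ofReal_im a), poleTerm_real (Complex.ofReal_im a), hee, hform, hform]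
    simp
    linear_combination (σ * (n q 0 * conj (n (conj q) 0))) * (h1 + h3)
  obtain ⟨C, hC⟩ := exists_im_lower_bound (a := a)
    (h := fun q => hform σ q (n q) (n (conj q)) + dslope ψ a q) (by
      have hψo : DifferentiableOn ℂ ψ (Metric.ball (a : ℂ) ε ∩ {0}ᶜ) := fun q hq =>
        (hψd q hq.1 hq.2).differentiableWithinAt
      have hUo : IsOpen (Metric.ball (a : ℂ) ε ∩ {0}ᶜ) :=
        Metric.isOpen_ball.inter isOpen_compl_singleton
      have hU : Metric.ball (a : ℂ) ε ∩ {0}ᶜ ∈ 𝓝 (a : ℂ) :=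
        hUo.mem_nhds ⟨Metric.mem_ball_self hε.1, ha0⟩
      have hds := (Complex.differentiableOn_dslope hU).2 hψo
      filter_upwards [hU] with q hq
      exact (differentiableAt_herm hq.2 (hdiff q hq.1) (hdiff _ (hcball q hq.1)) σ).add
        (hds.differentiableAt (hUo.mem_nhds hq))) (by
      filter_upwards [nhdsWithin_le_nhds hpos, self_mem_nhdsWithin] with y hy hya
      have hya' : (y : ℂ) ≠ a := fun h => hya (Complex.ofReal_injective h)
      rw [Complex.add_im, Complex.conj_ofReal, hform_real_im hσ, dslope_of_ne _ hya',
        slope_def_field, hψr, hψr, ← Complex.ofReal_sub, ← Complex.ofReal_sub,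
        ← Complex.ofReal_div, Complex.ofReal_im, add_zero]
      positivity)
  refine ⟨C, ?_⟩
  filter_upwards [hC, hball] with q h1 h2 hq
  have hqa : q ≠ a := by rintro rfl; simp at hq
  rw [hherm q h2 hqa, Complex.add_im]
  -- Im 1/(q - a) is negative in the upper half-plane, so a real nonpositive residue can only
  -- increase the imaginary part.
  have h3 : (c₀ / (q - a)).im = -c₀ * (q.im / Complex.normSq (q - a)) := by
    rw [Complex.div_im]; simp; ring
  have h4 : 0 ≤ -c₀ * (q.im / Complex.normSq (q - a)) :=
    mul_nonneg (by linarith) (div_nonneg hq.le (Complex.normSq_nonneg _))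
  rw [h3]
  linarith [h1 hq]

end Poles

end Bsq

namespace Bsq

/-! ### Boundary behaviour of the form -/

open ComplexConjugate Asymptotics

section Boundary

variable {r1 r2 : ℂ → ℂ} {Z : Finset ℂ} {c : ℂ → ℂ} {ε x t : ℝ} {n : ℂ → Fin 3 → ℂ}

/-- The sum of the forms at `k` and at `-1/k`. -/
def hsum (N : ℂ → Fin 3 → ℂ) (k : ℂ) : ℂ := herm N 1 k + herm N (-1) (-k⁻¹)

theorem neg_inv_mem_innerSector {k : ℂ} (hk : k ∈ outerSector) : -k⁻¹ ∈ innerSector := by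
  obtain ⟨h1, h2, h3⟩ := hk
  have hk0 : 0 < ‖k‖ := by linarith
  have key : ∀ z : ℂ, (z * -k⁻¹).re = -((conj z * k).re / Complex.normSq k) := by
    intro z
    rw [Complex.inv_def]
    simp
    ring
  have hN : 0 < Complex.normSq k := Complex.normSq_pos.2 (norm_pos_iff.1 hk0)
  refine ⟨by rw [norm_neg, norm_inv]; exact inv_lt_one_of_one_lt₀ h1, ?_, ?_⟩
  · rw [key, conj_om, neg_pos]
    exact div_neg_of_neg_of_pos h3 hN
  · rw [key, map_pow, conj_om, om_sq_sq, neg_pos]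
    exact div_neg_of_neg_of_pos h2 hN

theorem conj_notMem_closedBall {k : ℂ} (h : ∀ p ∈ centers Z, k ∉ Metric.closedBall p ε) :
    ∀ p ∈ centers Z, conj k ∉ Metric.closedBall p ε := by
  intro p hp hk
  refine h _ (conj_mem_centers hp) ?_
  rwa [Metric.mem_closedBall, ← Complex.dist_conj_conj, Complex.conj_conj]

theorem notMem_GammaTilde_of_outside (hd : IsScatteringData r1 r2 Z c)
    (hε : AdmissibleRadius Z ε) {k : ℂ} (hk : k ∈ sectors)
    (h : ∀ p ∈ centers Z, k ∉ Metric.closedBall p ε) : k ∉ GammaTilde Z ε := by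
  intro hG
  obtain ⟨p, hp, h'⟩ := mem_sphere_of_mem_sectors_of_mem_GammaTilde hd hε hk hG
  exact h p hp h'.le

/-- Off the small disks the form is expressed by the solution at `±k` and `±k̄`. -/
theorem hsum_eq_of_outside (hd : IsScatteringData r1 r2 Z c) (hε : AdmissibleRadius Z ε)
    (hn : IsHomogeneousSolution r1 r2 Z c ε x t n) {k : ℂ} (hk : k ∈ outerSector)
    (h1 : ∀ p ∈ centers Z, k ∉ Metric.closedBall p ε)
    (h2 : ∀ p ∈ centers Z, -k⁻¹ ∉ Metric.closedBall p ε) :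
    k ∉ GammaTilde Z ε ∧ conj k ∉ GammaTilde Z ε ∧ -k ∉ GammaTilde Z ε ∧
    -conj k ∉ GammaTilde Z ε ∧
    hsum (continued Z c ε x t n) k =
      hform 1 k (n k) (n (conj k)) + hform 1 k (n (-k)) (n (-conj k)) := by
  have hks : k ∈ sectors := Or.inl hk
  have hqs : -k⁻¹ ∈ sectors := Or.inr (neg_inv_mem_innerSector hk)
  have hq' : conj (-k⁻¹) ∉ GammaTilde Z ε :=
    notMem_GammaTilde_of_outside hd hε (conj_mem_sectors hqs) (conj_notMem_closedBall h2)
  have hq : -k⁻¹ ∉ GammaTilde Z ε := notMem_GammaTilde_of_outside hd hε hqs h2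
  have e1 : (-k⁻¹)⁻¹ = -k := by rw [inv_neg, inv_inv]
  have e2 : (conj (-k⁻¹))⁻¹ = -conj k := by rw [← map_inv₀, e1, map_neg]
  refine ⟨notMem_GammaTilde_of_outside hd hε hks h1,
    notMem_GammaTilde_of_outside hd hε (conj_mem_sectors hks) (conj_notMem_closedBall h1),
    e1 ▸ inv_notMem_GammaTilde hq, e2 ▸ inv_notMem_GammaTilde hq', ?_⟩
  -- The companion is evaluated at -1/k because the inner sector is where poles may sit. The
  -- ℬ-symmetry moves it to -k, where it has the same form as the first summand.
  have e3 := hn.symm_B _ hq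
  have e4 := hn.symm_B _ hq'
  rw [e1] at e3
  rw [e2] at e4
  rw [hsum, herm, herm, continued_eq_of_outside hd hε hn hks h1,
    continued_eq_of_outside hd hε hn (conj_mem_sectors hks) (conj_notMem_closedBall h1),
    continued_eq_of_outside hd hε hn hqs h2,
    continued_eq_of_outside hd hε hn (conj_mem_sectors hqs) (conj_notMem_closedBall h2), e3, e4,
    hform_neg_inv]

theorem neg_inv_mem_Gamma {k : ℂ} (hk : k ∈ Gamma) : -k⁻¹ ∈ Gamma := by
  rw [mem_Gamma_iff] at hk ⊢
  rw [norm_neg, norm_inv, inv_eq_one, Odd.neg_pow (by decide), inv_pow, Complex.neg_re,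
    Complex.inv_re, neg_eq_zero, div_eq_zero_iff]
  tauto

theorem eventually_outside_of_mem_Gamma (hε : AdmissibleRadius Z ε) {k₀ : ℂ} (h : k₀ ∈ Gamma)
    (h0 : k₀ ≠ 0) : ∀ᶠ k in 𝓝 k₀, (∀ p ∈ centers Z, k ∉ Metric.closedBall p ε) ∧
      ∀ p ∈ centers Z, -k⁻¹ ∉ Metric.closedBall p ε := by
  have key : ∀ q ∈ Gamma, ∀ᶠ k in 𝓝 q, ∀ p ∈ centers Z, k ∉ Metric.closedBall p ε := by
    intro q hq
    exact eventually_notMem_closedBall subset_rfl fun p hp hqp =>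
      Set.disjoint_left.1 (disjoint_closedBall_Gamma hε hp) hqp hq
  refine (key _ h).and ?_
  have : Tendsto (fun k : ℂ => -k⁻¹) (𝓝 k₀) (𝓝 (-k₀⁻¹)) := (tendsto_inv₀ h0).neg
  exact this.eventually (key _ (neg_inv_mem_Gamma h))

theorem eventually_hsum_eq (hd : IsScatteringData r1 r2 Z c) (hε : AdmissibleRadius Z ε)
    (hn : IsHomogeneousSolution r1 r2 Z c ε x t n) {k₀ : ℂ} (h : k₀ ∈ Gamma) (h0 : k₀ ≠ 0) :
    ∀ᶠ k in 𝓝[outerSector] k₀, k ∉ GammaTilde Z ε ∧ conj k ∉ GammaTilde Z ε ∧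
      -k ∉ GammaTilde Z ε ∧ -conj k ∉ GammaTilde Z ε ∧
      hsum (continued Z c ε x t n) k =
        hform 1 k (n k) (n (conj k)) + hform 1 k (n (-k)) (n (-conj k)) := by
  filter_upwards [self_mem_nhdsWithin,
    nhdsWithin_le_nhds (eventually_outside_of_mem_Gamma hε h h0)] with k hk hk'
  exact hsum_eq_of_outside hd hε hn hk hk'.1 hk'.2

/-! #### Boundedness and decay -/

theorem isBigO_hform {α : Type*} {F : Filter α} {κ : α → ℂ} {u v : α → Fin 3 → ℂ} {s a b : α → ℂ}
    (h1 : (fun y => sfn (om * κ y)) =O[F] s) (h2 : (fun y => sfn (om ^ 2 * κ y)) =O[F] s)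
    (h3 : (fun y => sfn (κ y)) =O[F] s) (hu : u =O[F] a) (hv : v =O[F] b) :
    (fun y => hform 1 (κ y) (u y) (v y)) =O[F] fun y => s y * (a y * b y) := by
  have hu' := isBigO_pi.1 hu
  have hv' : ∀ i, (fun y => conj (v y i)) =O[F] b := fun i =>
    ((isBigO_pi.1 hv i).norm_left.congr_left fun y => (Complex.norm_conj _).symm).of_norm_left
  simp only [hform, one_mul]
  exact ((h1.neg_left.mul ((hu' 0).mul (hv' 1))).add (h2.mul ((hu' 1).mul (hv' 0)))).sub
    (h3.mul ((hu' 2).mul (hv' 2)))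

/-- For the corners of the sector on the circle, where only boundedness of the solution is given.
The form involves it at ±k and ±k̄, so all four limit points must be exceptional points. -/
theorem isBigO_hsum_of_norm_one (hd : IsScatteringData r1 r2 Z c) (hε : AdmissibleRadius Z ε)
    (hn : IsHomogeneousSolution r1 r2 Z c ε x t n) {k₀ : ℂ} (hk₀ : ‖k₀‖ = 1)
    (h1 : k₀ ∈ GammaStar ∪ Qset) (h2 : conj k₀ ∈ GammaStar ∪ Qset) (h3 : -k₀ ∈ GammaStar ∪ Qset)
    (h4 : -conj k₀ ∈ GammaStar ∪ Qset) :
    hsum (continued Z c ε x t n) =O[𝓝[outerSector] k₀] fun _ => (1 : ℂ) := by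
  have h0 : k₀ ≠ 0 := by rintro rfl; simp at hk₀
  have hG : k₀ ∈ Gamma := (mem_Gamma_iff _).2 (Or.inl hk₀)
  have hev := eventually_hsum_eq hd hε hn hG h0
  have key : ∀ f : ℂ → ℂ, Continuous f → f k₀ ∈ GammaStar ∪ Qset →
      (∀ᶠ k in 𝓝[outerSector] k₀, f k ∉ GammaTilde Z ε) →
      (fun k => n (f k)) =O[𝓝[outerSector] k₀] fun _ => (1 : ℂ) := by
    intro f hf hm hG
    exact (hn.bounded _ hm).comp_tendsto (tendsto_nhdsWithin_of_tendsto_nhds_of_eventually_within _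
      (hf.continuousAt.mono_left nhdsWithin_le_nhds) hG)
  have hs : ∀ z : ℂ, z ≠ 0 →
      (fun k => sfn (z * k)) =O[𝓝[outerSector] k₀] fun _ => (1 : ℂ) := by
    intro z hz
    have : ContinuousAt (fun k => sfn (z * k)) k₀ :=
      ContinuousAt.comp (f := fun k => z * k)
        (differentiableAt_sfn (mul_ne_zero hz h0)).continuousAt (by fun_prop)
    exact (this.mono_left nhdsWithin_le_nhds).isBigO_one ℂ
  have hs1 := hs 1 one_ne_zero
  simp only [one_mul] at hs1
  have m1 := key (fun k => k) continuous_id h1 (hev.mono fun k h => h.1)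
  have m2 := key (fun k => conj k) Complex.continuous_conj h2 (hev.mono fun k h => h.2.1)
  have m3 := key (fun k => -k) continuous_neg h3 (hev.mono fun k h => h.2.2.1)
  have m4 := key (fun k => -conj k) Complex.continuous_conj.neg h4 (hev.mono fun k h => h.2.2.2.1)
  have hb := (isBigO_hform (hs _ om_ne_zero) (hs _ (pow_ne_zero 2 om_ne_zero)) hs1 m1 m2).add
    (isBigO_hform (hs _ om_ne_zero) (hs _ (pow_ne_zero 2 om_ne_zero)) hs1 m3 m4)
  simp only [one_mul] at hb
  exact hb.congr' (hev.mono fun k h => h.2.2.2.2.symm) EventuallyEq.rfl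

/-- One weight of size k times two factors of size 1/k. The disks do not interfere: k leaves every
bounded set and -1/k tends to 0, a point of Γ. -/
theorem isBigO_hsum_cobounded (hd : IsScatteringData r1 r2 Z c) (hε : AdmissibleRadius Z ε)
    (hn : IsHomogeneousSolution r1 r2 Z c ε x t n) :
    hsum (continued Z c ε x t n) =O[Bornology.cobounded ℂ ⊓ 𝓟 outerSector] fun k => k⁻¹ := by
  set F := Bornology.cobounded ℂ ⊓ 𝓟 outerSector with hF
  have hFc : F ≤ Bornology.cobounded ℂ := inf_le_left
  have h0G : (0 : ℂ) ∈ Gamma := (mem_Gamma_iff 0).2 (Or.inr (by simp))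
  have hev : ∀ᶠ k in F, k ∉ GammaTilde Z ε ∧ conj k ∉ GammaTilde Z ε ∧
      -k ∉ GammaTilde Z ε ∧ -conj k ∉ GammaTilde Z ε ∧
      hsum (continued Z c ε x t n) k =
        hform 1 k (n k) (n (conj k)) + hform 1 k (n (-k)) (n (-conj k)) := by
    have e1 : ∀ᶠ k in Bornology.cobounded ℂ, ∀ p ∈ centers Z, k ∉ Metric.closedBall p ε := by
      rw [(finite_centers Z).eventually_all]
      exact fun p _ => Metric.isBounded_closedBall
    have e2 : ∀ᶠ k in Bornology.cobounded ℂ, ∀ p ∈ centers Z, -k⁻¹ ∉ Metric.closedBall p ε := by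
      have h1 : ∀ᶠ k in 𝓝 (0 : ℂ), ∀ p ∈ centers Z, k ∉ Metric.closedBall p ε :=
        eventually_notMem_closedBall subset_rfl fun p hp hqp =>
          Set.disjoint_left.1 (disjoint_closedBall_Gamma hε hp) hqp h0G
      have h2 : Tendsto (fun k : ℂ => -k⁻¹) (Bornology.cobounded ℂ) (𝓝 0) := by
        simpa using (tendsto_inv₀_cobounded (α := ℂ)).neg
      exact h2.eventually h1
    have e3 : ∀ᶠ k in F, k ∈ outerSector := by
      rw [hF]; exact eventually_inf_principal.2 (Eventually.of_forall fun _ h => h)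
    filter_upwards [hFc e1, hFc e2, e3] with k h1 h2 h3
    exact hsum_eq_of_outside hd hε hn h3 h1 h2
  have key : ∀ f : ℂ → ℂ, (∀ k, ‖f k‖ = ‖k‖) → (∀ᶠ k in F, f k ∉ GammaTilde Z ε) →
      (fun k => n (f k)) =O[F] fun k : ℂ => k⁻¹ := by
    intro f hf hG
    have ht : Tendsto f F (Bornology.cobounded ℂ ⊓ 𝓟 (GammaTilde Z ε)ᶜ) := by
      refine tendsto_inf.2 ⟨?_, tendsto_principal.2 hG⟩
      rw [← tendsto_norm_atTop_iff_cobounded]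
      simp only [hf]
      exact tendsto_norm_cobounded_atTop.mono_left hFc
    refine (hn.infinity.comp_tendsto ht).trans (IsBigO.of_bound 1 (Eventually.of_forall fun k => ?_))
    simp [hf]
  have hinf : ∀ᶠ k : ℂ in F, 1 ≤ ‖k‖ :=
    hFc (tendsto_norm_cobounded_atTop.eventually_ge_atTop 1)
  have hs : ∀ z : ℂ, ‖z‖ = 1 → (fun k => sfn (z * k)) =O[F] fun k : ℂ => k := by
    intro z hz
    refine IsBigO.of_bound 1 ?_
    filter_upwards [hinf] with k hk
    rw [sfn, norm_div, norm_mul, Complex.norm_I, Complex.norm_ofNat, mul_one, one_mul,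
      div_le_iff₀ (by norm_num)]
    refine (norm_sub_le _ _).trans ?_
    rw [norm_inv, norm_mul, hz, one_mul]
    have := inv_le_one_of_one_le₀ hk
    linarith
  have hs1 := hs 1 norm_one
  simp only [one_mul] at hs1
  have hs2 := hs (om ^ 2) (by rw [norm_pow, norm_om, one_pow])
  have m1 := key (fun k => k) (fun _ => rfl) (hev.mono fun k h => h.1)
  have m2 := key (fun k => conj k) (fun k => Complex.norm_conj k) (hev.mono fun k h => h.2.1)
  have m3 := key (fun k => -k) (fun k => norm_neg k) (hev.mono fun k h => h.2.2.1)
  have m4 := key (fun k => -conj k) (fun k => by rw [norm_neg, Complex.norm_conj])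
    (hev.mono fun k h => h.2.2.2.1)
  have hb := (isBigO_hform (hs _ norm_om) hs2 hs1 m1 m2).add
    (isBigO_hform (hs _ norm_om) hs2 hs1 m3 m4)
  refine hb.congr' (hev.mono fun k h => h.2.2.2.2.symm) ?_
  filter_upwards [hinf] with k hk
  have : k ≠ 0 := by rintro rfl; simp at hk; linarith
  field_simp

end Boundary

end Bsq

namespace Bsq

/-! ### Limits of the form at the boundary of the sector -/

open ComplexConjugate

section Limits

variable {r1 r2 : ℂ → ℂ} {Z : Finset ℂ} {c : ℂ → ℂ} {ε x t : ℝ} {n : ℂ → Fin 3 → ℂ}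

theorem pow_six_of_mem_Qset {k : ℂ} (hk : k ∈ Qset) : k ^ 6 = 1 := by
  obtain ⟨j, -, rfl⟩ := hk
  rw [show 6 = 3 * 2 from rfl, pow_mul]
  rcases kap_cube j with h | h <;> rw [h] <;> norm_num

theorem circPar_notMem_Qset {φ : ℝ} (hφ : φ ∈ Ioo 0 (Real.pi / 3)) {τ : ℂ}
    (hτ : τ = 1 ∨ τ = -1) : τ * circPar φ ∉ Qset := by
  intro h
  refine circPar_pow_six_ne_one hφ ?_
  have := pow_six_of_mem_Qset h
  rcases hτ with h | h <;> rw [h] at this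
  · rwa [one_mul] at this
  · rwa [neg_one_mul, Even.neg_pow (by decide)] at this

theorem symm_B' (hn : IsHomogeneousSolution r1 r2 Z c ε x t n) {k : ℂ}
    (hk : k ∉ GammaTilde Z ε) : n k = ![n k⁻¹ 1, n k⁻¹ 0, n k⁻¹ 2] := by
  rw [hn.symm_B k hk, vecMul_matB]

theorem symm_A' (hn : IsHomogeneousSolution r1 r2 Z c ε x t n) {k : ℂ}
    (hk : k ∉ GammaTilde Z ε) :
    n k = ![n (om ^ 2 * k) 1, n (om ^ 2 * k) 2, n (om ^ 2 * k) 0] := by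
  have hA : matA * matA * matA = 1 := by
    ext i j
    fin_cases i <;> fin_cases j <;> simp [matA, Matrix.mul_apply, Fin.sum_univ_three]
  have hinv : matA⁻¹ = matA * matA := Matrix.inv_eq_left_inv hA
  rw [hn.symm_A k hk, hn.symm_A _ (om_mul_notMem_GammaTilde hk), ← mul_assoc, ← sq,
    ← vecMul_matA, hinv, Matrix.vecMul_vecMul]
  congr 1
  rw [← Matrix.mul_assoc, hA, Matrix.one_mul]

theorem tendsto_vec_swap {α : Type*} {F : Filter α} {f : α → Fin 3 → ℂ} {w : Fin 3 → ℂ}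
    (h : Tendsto f F (𝓝 w)) (i j k : Fin 3) :
    Tendsto (fun a => ![f a i, f a j, f a k]) F (𝓝 ![w i, w j, w k]) := by
  rw [tendsto_pi_nhds] at h
  exact tendsto_vec3 (h i) (h j) (h k)

/-- Limits of the solution at the arcs near the real axis. -/
theorem exists_tendsto_arc (hd : IsScatteringData r1 r2 Z c) (hε : AdmissibleRadius Z ε)
    (hn : IsHomogeneousSolution r1 r2 Z c ε x t n) {τ : ℂ} (hτ : τ = 1 ∨ τ = -1) {φ : ℝ}
    (hφ : φ ∈ Ioo 0 (Real.pi / 6)) : ∃ u w : Fin 3 → ℂ,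
    Tendsto (fun k => n (τ * k)) (𝓝[outerSector] (circPar φ)) (𝓝 u) ∧
    Tendsto (fun k => n (τ * conj k)) (𝓝[outerSector] (circPar φ)) (𝓝 w) ∧
    (hform 1 (circPar φ) u w).re ≤ 0 ∧
    ((hform 1 (circPar φ) u w).re = 0 → u = 0 ∧ w = 0) := by
  have hpi := Real.pi_pos
  have hφ' : φ ∈ Ioo 0 (Real.pi / 3) := ⟨hφ.1, by linarith [hφ.2]⟩
  have hk₀ := norm_circPar φ
  have h0 : circPar φ ≠ 0 := Complex.exp_ne_zero _
  have hτn : ‖τ‖ = 1 := by rcases hτ with h | h <;> rw [h] <;> simp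
  have hτ0 : τ ≠ 0 := by rintro rfl; simp at hτn
  have hτi : τ⁻¹ = τ := by rcases hτ with h | h <;> rw [h] <;> norm_num
  have hG : circPar φ ∈ Gamma := (mem_Gamma_iff _).2 (Or.inl hk₀)
  have hev := eventually_hsum_eq hd hε hn hG h0
  have hev1 : ∀ᶠ k in 𝓝[outerSector] (circPar φ), τ * k ∉ GammaTilde Z ε := by
    filter_upwards [hev] with k hk
    rcases hτ with h | h <;> rw [h]
    · rw [one_mul]; exact hk.1
    · rw [neg_one_mul]; exact hk.2.2.1
  have hev2 : ∀ᶠ k in 𝓝[outerSector] (circPar φ), τ * conj k ∉ GammaTilde Z ε := by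
    filter_upwards [hev] with k hk
    rcases hτ with h | h <;> rw [h]
    · rw [one_mul]; exact hk.2.1
    · rw [neg_one_mul]; exact hk.2.2.2.1
  have hout : Tendsto (fun k => τ * k) (𝓝[outerSector] (circPar φ))
      (𝓝[(Metric.closedBall 0 1)ᶜ \ GammaTilde Z ε] (τ * circPar φ)) := by
    refine tendsto_nhdsWithin_of_tendsto_nhds_of_eventually_within _
      (Tendsto.mono_left ((continuous_const.mul continuous_id).tendsto _) nhdsWithin_le_nhds) ?_
    filter_upwards [hev1, self_mem_nhdsWithin] with k h1 h2
    refine ⟨?_, h1⟩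
    simpa [hτn] using h2.1
  -- The point 1/(τk̄) is the reflection of τk in the circle: it lies inside and tends to the same
  -- boundary point. Through ℬ it turns the value at τk̄ into the other boundary value of the jump.
  have hin : Tendsto (fun k => (τ * conj k)⁻¹) (𝓝[outerSector] (circPar φ))
      (𝓝[Metric.ball 0 1 \ GammaTilde Z ε] (τ * circPar φ)) := by
    refine tendsto_nhdsWithin_of_tendsto_nhds_of_eventually_within _
      (Tendsto.mono_left ?_ nhdsWithin_le_nhds) ?_
    · have h1 : ContinuousAt (fun k => (τ * conj k)⁻¹) (circPar φ) := by
        refine ContinuousAt.inv₀ (by fun_prop) ?_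
        simpa [hτ0] using h0
      have h2 : (τ * conj (circPar φ))⁻¹ = τ * circPar φ := by
        rw [mul_inv, hτi, conj_inv_of_norm_one hk₀]
      have h3 := h1.tendsto
      rwa [h2] at h3
    · filter_upwards [hev2, self_mem_nhdsWithin] with k h1 h2
      refine ⟨?_, inv_notMem_GammaTilde h1⟩
      simpa [hτn] using inv_lt_one_of_one_lt₀ h2.1
  have hjump : ∃ u w : Fin 3 → ℂ,
      Tendsto n (𝓝[(Metric.closedBall 0 1)ᶜ \ GammaTilde Z ε] (τ * circPar φ)) (𝓝 u) ∧
      Tendsto n (𝓝[Metric.ball 0 1 \ GammaTilde Z ε] (τ * circPar φ)) (𝓝 w) ∧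
      (hform 1 (circPar φ) u ![w 1, w 0, w 2]).re ≤ 0 ∧
      ((hform 1 (circPar φ) u ![w 1, w 0, w 2]).re = 0 → u = 0 ∧ w = 0) := by
    -- At 1 the arc is counterclockwise, so the exterior limit is n₋; at -1 it is clockwise and the
    -- exterior limit is n₊.
    have hτ' := hτ
    rcases hτ' with h | h
    · obtain ⟨np, nm, -, -, hj⟩ := hn.jump_eight
      have hmem : τ * circPar φ ∈ (arcCCW (-(Real.pi / 6)) (Real.pi / 6)).carrier :=
        ⟨⟨φ, by linarith [hφ.1], hφ.2, by rw [h, one_mul]⟩, circPar_notMem_Qset hφ' hτ⟩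
      obtain ⟨hl, hr, hv⟩ := hj _ hmem
      have hf := circle_form_neg hd x t hτ hφ' hv
      refine ⟨_, _, hr, hl, ?_, ?_⟩
      · simpa [hform] using hf.1
      · intro h'
        have h1 := hf.2 (by simpa [hform] using h')
        exact ⟨h1, by rw [hv, h1, Matrix.zero_vecMul]⟩
    · obtain ⟨np, nm, -, -, hj⟩ := hn.jump_eight'
      have hmem : τ * circPar φ ∈ (arcCW (5 * Real.pi / 6) (7 * Real.pi / 6)).carrier := by
        refine ⟨⟨φ + Real.pi, by linarith [hφ.1], by linarith [hφ.2], ?_⟩,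
          circPar_notMem_Qset hφ' hτ⟩
        have : circPar Real.pi = -1 := by simp [circPar, Complex.exp_pi_mul_I]
        rw [h, circPar_add, this, mul_comm]
      obtain ⟨hl, hr, hv⟩ := hj _ hmem
      have hf := circle_form_neg hd x t hτ hφ' hv
      -- The clockwise orientation exchanges the two arguments of the form. The weights are real on
      -- the circle, so this only conjugates it.
      have hre : (hform 1 (circPar φ) (np (τ * circPar φ)) ![nm (τ * circPar φ) 1,
          nm (τ * circPar φ) 0, nm (τ * circPar φ) 2]).re =
          (-sfn (om * circPar φ) * (nm (τ * circPar φ) 0 * conj (np (τ * circPar φ) 0)) +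
            sfn (om ^ 2 * circPar φ) * (nm (τ * circPar φ) 1 * conj (np (τ * circPar φ) 1)) -
            sfn (circPar φ) * (nm (τ * circPar φ) 2 * conj (np (τ * circPar φ) 2))).re := by
        rw [← Complex.conj_re]
        congr 1
        rw [hform, ← circPar_om_add, ← circPar_om_sub, sfn_circPar, sfn_circPar, sfn_circPar]
        simp only [map_sub, map_add, map_mul, map_neg, Complex.conj_ofReal, Complex.conj_conj,
          one_mul, Matrix.cons_val_zero, Matrix.cons_val_one, Matrix.cons_val]
        ring
      refine ⟨_, _, hl, hr, ?_, ?_⟩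
      · rw [hre]; exact hf.1
      · intro h'
        have h1 := hf.2 (by rwa [hre] at h')
        exact ⟨by rw [hv, h1, Matrix.zero_vecMul], h1⟩
  obtain ⟨u, w, h1, h2, h3, h4⟩ := hjump
  refine ⟨u, ![w 1, w 0, w 2], h1.comp hout, ?_, h3, fun h => ?_⟩
  · refine Tendsto.congr' ?_ (tendsto_vec_swap (h2.comp hin) 1 0 2)
    filter_upwards [hev2] with k hk
    exact (symm_B' hn hk).symm
  · obtain ⟨h5, h6⟩ := h4 h
    refine ⟨h5, ?_⟩
    ext i
    fin_cases i <;> simp [h6]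

/-- The limit of the form on the ray `arg k = π/6` is real. -/
theorem exists_tendsto_ray (hd : IsScatteringData r1 r2 Z c) (hε : AdmissibleRadius Z ε)
    (hn : IsHomogeneousSolution r1 r2 Z c ε x t n) {r : ℝ} (hr : 1 < r) :
    ∃ l : ℝ, Tendsto (hsum (continued Z c ε x t n))
      (𝓝[outerSector] (r * (-(Complex.I * kap 3)))) (𝓝 (l : ℂ)) := by
  have hr0 : (0 : ℝ) < r := by linarith
  have hrC : (r : ℂ) ≠ 0 := Complex.ofReal_ne_zero.2 hr0.ne'
  have hI := Complex.I_ne_zero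
  have ho := om_ne_zero
  set k₀ : ℂ := r * (-(Complex.I * kap 3)) with hk₀
  set q₀ : ℂ := ((r⁻¹ : ℝ) : ℂ) * (Complex.I * kap 6) with hq₀
  have e₀ : k₀ = -(r * Complex.I * om) := by rw [hk₀, kap_three]; ring
  have h0 : k₀ ≠ 0 := by rw [e₀]; simp [hrC, ho]
  have hc0 : conj k₀ = r * Complex.I * om ^ 2 := by
    rw [e₀]; simp [conj_om]
  have hq1 : q₀ = (conj k₀)⁻¹ := by
    rw [hc0, hq₀, kap_six]
    refine eq_inv_of_mul_eq_one_left ?_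
    push_cast
    field_simp
    linear_combination (-Complex.I ^ 2) * om_cube - Complex.I_sq
  have hG : k₀ ∈ Gamma := by
    refine Or.inr (mem_iUnion₂.2 ⟨3, by simp, Or.inr ⟨r, hr.le, rfl⟩⟩)
  have hev := eventually_hsum_eq hd hε hn hG h0
  obtain ⟨np, nm, -, -, hj⟩ := hn.jump_outer 3 (by simp)
  obtain ⟨op, om', -, -, hj'⟩ := hn.jump_inner 6 (by simp)
  obtain ⟨hl, hrr, hv⟩ := hj k₀ ⟨r, hr, rfl⟩
  obtain ⟨hl', hr', hv'⟩ := hj' q₀ ⟨r⁻¹, by positivity, inv_lt_one_of_one_lt₀ hr, rfl⟩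
  generalize np k₀ = u' at hl hv
  generalize nm k₀ = u at hrr hv
  generalize op q₀ = w' at hl' hv'
  generalize om' q₀ = w at hr' hv'
  have hform_eq := ray_form_eq hd x t hr hk₀ hq₀ hv hv'
  have hside3 : ∀ z : ℂ, (z / (-(Complex.I * kap 3))).im = (om ^ 2 * z).re := by
    intro z
    have : z / (-(Complex.I * kap 3)) = om ^ 2 * z * Complex.I := by
      rw [kap_three, div_eq_iff (by simp [ho])]
      linear_combination (om ^ 3 * z) * Complex.I_sq - z * om_cube
    rw [this, Complex.mul_I_im]
  have hside6 : ∀ z : ℂ, (z / (Complex.I * kap 6)).im = (om ^ 2 * z).re := by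
    intro z
    rw [← hside3, kap_add_three 3, mul_neg]
  have hsq : ∀ {z : ℂ}, z ∉ GammaTilde Z ε → om ^ 2 * z ∉ GammaTilde Z ε := by
    intro z hz
    rw [sq, mul_assoc]
    exact om_mul_notMem_GammaTilde (om_mul_notMem_GammaTilde hz)
  have hlim : ∀ f : ℂ → ℂ, ContinuousAt f k₀ → ∀ (S : Set ℂ) (z : ℂ), f k₀ = z →
      (∀ᶠ k in 𝓝[outerSector] k₀, f k ∈ S \ GammaTilde Z ε) →
      Tendsto f (𝓝[outerSector] k₀) (𝓝[S \ GammaTilde Z ε] z) := by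
    intro f hf S z hz hS
    rw [← hz]
    exact tendsto_nhdsWithin_of_tendsto_nhds_of_eventually_within _
      (hf.tendsto.mono_left nhdsWithin_le_nhds) hS
  -- The four values in the form are moved by the symmetries to the points k and 1/k̄, which
  -- approach the rays from the right, and -ω²/k and -ω²k̄, which approach the same two boundary
  -- points from the left.
  have t1 := hrr.comp (hlim (fun k => k) continuousAt_id _ _ rfl (by
    filter_upwards [hev, self_mem_nhdsWithin] with k h1 h2
    refine ⟨?_, h1.1⟩
    rw [outerRay, mem_ofPred_eq, hside3]
    exact h2.2.2))
  have t2 := hr'.comp (hlim (fun k => (conj k)⁻¹)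
    (ContinuousAt.inv₀ (by fun_prop) (by simpa using h0)) _ _ hq1.symm (by
    filter_upwards [hev, self_mem_nhdsWithin] with k h1 h2
    refine ⟨?_, inv_notMem_GammaTilde h1.2.1⟩
    have hN : 0 < Complex.normSq k := Complex.normSq_pos.2 (by
      rintro rfl; have := h2.1; simp at this; linarith)
    have e : (om ^ 2 * (conj k)⁻¹).re = (om ^ 2 * k).re / Complex.normSq k := by
      rw [Complex.inv_def, Complex.conj_conj, Complex.normSq_conj, ← mul_assoc,
        Complex.re_mul_ofReal, div_eq_mul_inv]
    rw [innerRay, mem_ofPred_eq, hside6, e]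
    exact div_neg_of_neg_of_pos h2.2.2 hN))
  have t3 := hl'.comp (hlim (fun k => om ^ 2 * (-k)⁻¹)
    (ContinuousAt.mul continuousAt_const
      (ContinuousAt.inv₀ continuousAt_neg (neg_ne_zero.2 h0))) _ _ (by
        rw [e₀, hq₀, kap_six]
        push_cast
        field_simp
        linear_combination Complex.I_sq) (by
    filter_upwards [hev, self_mem_nhdsWithin] with k h1 h2
    refine ⟨?_, hsq (inv_notMem_GammaTilde h1.2.2.1)⟩
    rw [innerRay, mem_ofPred_eq, hside6, ← mul_assoc, ← sq, om_sq_sq, inv_neg]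
    exact (neg_inv_mem_innerSector h2).2.1))
  have t4 := hl.comp (hlim (fun k => om ^ 2 * (-conj k)) (by fun_prop) _ _ (by
        rw [hc0, e₀]
        linear_combination (-(r * Complex.I)) * om_sq_sq) (by
    filter_upwards [hev, self_mem_nhdsWithin] with k h1 h2
    refine ⟨?_, hsq h1.2.2.2.1⟩
    rw [outerRay, mem_ofPred_eq, hside3, ← mul_assoc, ← sq, om_sq_sq, mul_neg, Complex.neg_re,
      neg_pos]
    exact (conj_mem_outerSector h2).2.1))
  have s2 : Tendsto (fun k => n (conj k)) (𝓝[outerSector] k₀) (𝓝 ![w 1, w 0, w 2]) := by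
    refine Tendsto.congr' ?_ (tendsto_vec_swap t2 1 0 2)
    filter_upwards [hev] with k hk
    exact (symm_B' hn hk.2.1).symm
  have s3 : Tendsto (fun k => n (-k)) (𝓝[outerSector] k₀) (𝓝 ![w' 2, w' 1, w' 0]) := by
    refine Tendsto.congr' ?_ (tendsto_vec_swap t3 2 1 0)
    filter_upwards [hev] with k hk
    rw [symm_B' hn hk.2.2.1, symm_A' hn (inv_notMem_GammaTilde hk.2.2.1)]
    rfl
  have s4 : Tendsto (fun k => n (-conj k)) (𝓝[outerSector] k₀) (𝓝 ![u' 1, u' 2, u' 0]) := by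
    refine Tendsto.congr' ?_ (tendsto_vec_swap t4 1 2 0)
    filter_upwards [hev] with k hk
    exact (symm_A' hn hk.2.2.2.1).symm
  have hid : Tendsto (fun k : ℂ => k) (𝓝[outerSector] k₀) (𝓝 k₀) :=
    tendsto_id.mono_left nhdsWithin_le_nhds
  have hT := (tendsto_hform h0 hid t1 s2 1).add (tendsto_hform h0 hid s3 s4 1)
  have d1 : conj (sfn (om * k₀)) = sfn k₀ := by
    rw [conj_sfn_om_mul, ← sfn_neg, hc0, e₀]
    congr 1
    linear_combination (-(r * Complex.I)) * om_sq_sq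
  have d3 : conj (sfn k₀) = sfn (om * k₀) := by
    rw [conj_sfn, ← sfn_neg, hc0, e₀]
    congr 1
    ring
  have d2 : conj (sfn (om ^ 2 * k₀)) = sfn (om ^ 2 * k₀) := by
    rw [conj_sfn_om_sq_mul, ← sfn_neg, hc0, e₀]
    congr 1
    ring
  -- Absence of a jump turns the left limits into right limits. On this ray conjugation exchanges
  -- s(ωk₀) with s(k₀) and fixes s(ω²k₀), so the companion is the conjugate of the first summand.
  have hreal : hform 1 k₀ u ![w 1, w 0, w 2] +
      hform 1 k₀ ![w' 2, w' 1, w' 0] ![u' 1, u' 2, u' 0] =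
      hform 1 k₀ u ![w 1, w 0, w 2] + conj (hform 1 k₀ u ![w 1, w 0, w 2]) := by
    have h1 : hform 1 k₀ u ![w 1, w 0, w 2] = -sfn (om * k₀) * (u 0 * conj (w 0)) +
        sfn (om ^ 2 * k₀) * (u 1 * conj (w 1)) - sfn k₀ * (u 2 * conj (w 2)) := by
      simp [hform]
    rw [h1, ← hform_eq, hform]
    simp only [map_sub, map_add, map_mul, map_neg, Complex.conj_conj, d1, d2, d3, one_mul,
      Matrix.cons_val_zero, Matrix.cons_val_one, Matrix.cons_val]
    ring
  rw [hreal, Complex.add_conj] at hT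
  refine ⟨_, Tendsto.congr' ?_ hT⟩
  filter_upwards [hev] with k hk
  exact hk.2.2.2.2.symm

end Limits

end Bsq

namespace Bsq

/-! ### Vanishing of the limits at the unit circle -/

open ComplexConjugate Asymptotics

section Vanishing

variable {r1 r2 : ℂ → ℂ} {Z : Finset ℂ} {c : ℂ → ℂ} {ε x t : ℝ} {n : ℂ → Fin 3 → ℂ}

/-- Both summands have nonpositive real part on the arc, so a vanishing sum makes each vanish, and
with it the boundary values at both τ = ±1. -/
theorem exists_tendsto_hsum_arc (hd : IsScatteringData r1 r2 Z c) (hε : AdmissibleRadius Z ε)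
    (hn : IsHomogeneousSolution r1 r2 Z c ε x t n) {φ : ℝ} (hφ : φ ∈ Ioo 0 (Real.pi / 6)) :
    ∃ l : ℂ, Tendsto (hsum (continued Z c ε x t n)) (𝓝[outerSector] (circPar φ)) (𝓝 l) ∧
      l.re ≤ 0 ∧ (l.re = 0 →
        ∀ τ : ℂ, τ = 1 ∨ τ = -1 →
          Tendsto (fun k => n (τ * k)) (𝓝[outerSector] (circPar φ)) (𝓝 0) ∧
          Tendsto (fun k => n (τ * conj k)) (𝓝[outerSector] (circPar φ)) (𝓝 0)) := by
  obtain ⟨u, w, h1, h2, h3, h4⟩ := exists_tendsto_arc hd hε hn (Or.inl rfl) hφ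
  obtain ⟨u', w', h1', h2', h3', h4'⟩ := exists_tendsto_arc hd hε hn (Or.inr rfl) hφ
  have h0 : circPar φ ≠ 0 := Complex.exp_ne_zero _
  have hG : circPar φ ∈ Gamma := (mem_Gamma_iff _).2 (Or.inl (norm_circPar φ))
  have hev := eventually_hsum_eq hd hε hn hG h0
  have hid : Tendsto (fun k : ℂ => k) (𝓝[outerSector] (circPar φ)) (𝓝 (circPar φ)) :=
    tendsto_id.mono_left nhdsWithin_le_nhds
  have hT := (tendsto_hform h0 hid h1 h2 1).add (tendsto_hform h0 hid h1' h2' 1)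
  refine ⟨_, hT.congr' ?_, ?_, ?_⟩
  · filter_upwards [hev] with k hk
    rw [hk.2.2.2.2, one_mul, one_mul, neg_one_mul, neg_one_mul]
  · rw [Complex.add_re]; linarith
  · intro h
    rw [Complex.add_re] at h
    obtain ⟨e1, e2⟩ := h4 (by linarith)
    obtain ⟨e1', e2'⟩ := h4' (by linarith)
    rw [e1] at h1
    rw [e2] at h2
    rw [e1'] at h1'
    rw [e2'] at h2'
    rintro τ (rfl | rfl)
    · exact ⟨h1, h2⟩
    · exact ⟨h1', h2'⟩

/-! ### The form in the logarithmic coordinate -/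

theorem exp_eq_polar (w : ℂ) :
    Complex.exp w = (Real.exp w.re : ℝ) * Complex.exp (w.im * Complex.I) := by
  rw [Complex.ofReal_exp, ← Complex.exp_add, Complex.re_add_im]

theorem exp_mem_outerSector {w : ℂ} (h1 : 0 < w.re) (h2 : |w.im| < Real.pi / 6) :
    Complex.exp w ∈ outerSector := by
  rw [exp_eq_polar]
  exact polar_mem_outerSector (Real.one_lt_exp_iff.2 h1) h2

theorem exp_mem_outerSector_of_halfStrip {w : ℂ} (hw : w ∈ halfStrip (Real.pi / 6)) :
    Complex.exp w ∈ outerSector :=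
  exp_mem_outerSector hw.1 (by rw [abs_of_pos hw.2.1]; exact hw.2.2)

theorem tendsto_exp_halfStrip (w₀ : ℂ) : Tendsto Complex.exp (𝓝[halfStrip (Real.pi / 6)] w₀)
    (𝓝[outerSector] (Complex.exp w₀)) :=
  tendsto_nhdsWithin_of_tendsto_nhds_of_eventually_within _
    (Complex.continuous_exp.continuousAt.tendsto.mono_left nhdsWithin_le_nhds)
    (by filter_upwards [self_mem_nhdsWithin] with w hw using exp_mem_outerSector_of_halfStrip hw)

theorem exp_im_pos {w : ℂ} (h1 : 0 < w.im) (h2 : w.im < Real.pi) : 0 < (Complex.exp w).im := by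
  rw [Complex.exp_im]
  exact mul_pos (Real.exp_pos _) (Real.sin_pos_of_pos_of_lt_pi h1 h2)

theorem neg_inv_exp (w : ℂ) : (-(Complex.exp w)⁻¹).im = Real.exp (-w.re) * Real.sin w.im := by
  rw [← Complex.exp_neg, Complex.neg_im, Complex.exp_im]
  simp

/-- The points of the strip where one of the two forms has a pole. -/
def stripPoles (Z : Finset ℂ) : Set ℂ :=
  {w | w ∈ halfStrip (Real.pi / 6) ∧ (Complex.exp w ∈ centers Z ∨ -(Complex.exp w)⁻¹ ∈ centers Z)}

theorem finite_stripPoles (Z : Finset ℂ) : (stripPoles Z).Finite := by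
  have hpi := Real.pi_pos
  have hf : (centers Z ∪ (fun k => -k⁻¹) '' centers Z).Finite :=
    (finite_centers Z).union ((finite_centers Z).image _)
  refine Set.Finite.of_finite_image (f := Complex.exp) (hf.subset ?_) ?_
  · rintro _ ⟨w, ⟨-, h⟩, rfl⟩
    refine h.imp id fun h => ⟨_, h, ?_⟩
    simp
  · intro a ha b hb h
    exact Complex.exp_inj_of_neg_pi_lt_of_le_pi (by linarith [ha.1.2.1]) (by linarith [ha.1.2.2])
      (by linarith [hb.1.2.1]) (by linarith [hb.1.2.2]) h

theorem eventually_notMem_stripPoles {w₀ : ℂ} (h : w₀ ∉ stripPoles Z) :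
    ∀ᶠ w in 𝓝 w₀, w ∉ stripPoles Z :=
  (finite_stripPoles Z).isClosed.isOpen_compl.mem_nhds h

theorem isOpen_strip_diff : IsOpen (halfStrip (Real.pi / 6) \ stripPoles Z) :=
  (isOpen_halfStrip _).sdiff (finite_stripPoles Z).isClosed

theorem mem_closure_strip_diff {w : ℂ} (h1 : 0 ≤ w.re) (h2 : 0 ≤ w.im) (h3 : w.im ≤ Real.pi / 6) :
    w ∈ closure (halfStrip (Real.pi / 6) \ stripPoles Z) := by
  have hpi := Real.pi_pos
  have hden := (finite_stripPoles Z).countable.dense_compl ℝ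
  have hsub := hden.open_subset_closure_inter (isOpen_halfStrip (Real.pi / 6))
  have e : halfStrip (Real.pi / 6) = Ioi 0 ×ℂ Ioo 0 (Real.pi / 6) := by
    ext z; simp [halfStrip, Complex.mem_reProdIm]
  have : w ∈ closure (halfStrip (Real.pi / 6)) := by
    rw [e, Complex.closure_reProdIm, closure_Ioi, closure_Ioo (by linarith)]
    exact ⟨h1, h2, h3⟩
  have h4 := closure_mono hsub this
  rwa [closure_closure] at h4

theorem differentiableAt_hsum (hd : IsScatteringData r1 r2 Z c) (hε : AdmissibleRadius Z ε)
    (hn : IsHomogeneousSolution r1 r2 Z c ε x t n) {k : ℂ} (hk : k ∈ outerSector)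
    (h1 : k ∉ centers Z) (h2 : -k⁻¹ ∉ centers Z) :
    DifferentiableAt ℂ (hsum (continued Z c ε x t n)) k := by
  have key : ∀ σ : ℂ, ∀ q ∈ sectors, q ∉ centers Z →
      DifferentiableAt ℂ (herm (continued Z c ε x t n) σ) q := by
    intro σ q hq hqc
    refine differentiableAt_herm (ne_zero_of_mem_sectors hq)
      (differentiableAt_continued hd hε hn ⟨hq, hqc⟩)
      (differentiableAt_continued hd hε hn ⟨conj_mem_sectors hq, fun h => hqc ?_⟩) σ
    simpa using conj_mem_centers h
  have hk0 := ne_zero_of_mem_sectors (Or.inl hk)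
  have h3 : DifferentiableAt ℂ (fun k : ℂ => -k⁻¹) k := (differentiableAt_inv hk0).neg
  exact (key 1 k (Or.inl hk) h1).add
    (DifferentiableAt.comp (g := herm (continued Z c ε x t n) (-1)) k
      (key (-1) _ (Or.inr (neg_inv_mem_innerSector hk)) h2) h3)

theorem differentiableAt_hsum_exp (hd : IsScatteringData r1 r2 Z c) (hε : AdmissibleRadius Z ε)
    (hn : IsHomogeneousSolution r1 r2 Z c ε x t n) {w : ℂ}
    (hw : w ∈ halfStrip (Real.pi / 6) \ stripPoles Z) :
    DifferentiableAt ℂ (fun w => hsum (continued Z c ε x t n) (Complex.exp w)) w := by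
  refine (differentiableAt_hsum hd hε hn (exp_mem_outerSector_of_halfStrip hw.1) ?_ ?_).comp w
    Complex.differentiable_exp.differentiableAt
  · exact fun h => hw.2 ⟨hw.1, Or.inl h⟩
  · exact fun h => hw.2 ⟨hw.1, Or.inr h⟩

/-- The form in the logarithmic coordinate, extended to its removable singularities and to the
upper edge of the strip. -/
def stripForm (Z : Finset ℂ) (c : ℂ → ℂ) (ε x t : ℝ) (n : ℂ → Fin 3 → ℂ) : ℂ → ℂ :=
  extendFrom (halfStrip (Real.pi / 6) \ stripPoles Z)
    fun w => hsum (continued Z c ε x t n) (Complex.exp w)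

theorem stripForm_eq (hd : IsScatteringData r1 r2 Z c) (hε : AdmissibleRadius Z ε)
    (hn : IsHomogeneousSolution r1 r2 Z c ε x t n) {w : ℂ}
    (hw : w ∈ halfStrip (Real.pi / 6) \ stripPoles Z) :
    stripForm Z c ε x t n w = hsum (continued Z c ε x t n) (Complex.exp w) :=
  extendFrom_eq (subset_closure hw)
    ((differentiableAt_hsum_exp hd hε hn hw).continuousAt.tendsto.mono_left nhdsWithin_le_nhds)

theorem eventually_stripForm_eq (hd : IsScatteringData r1 r2 Z c) (hε : AdmissibleRadius Z ε)
    (hn : IsHomogeneousSolution r1 r2 Z c ε x t n) {w₀ : ℂ} (h : w₀ ∉ stripPoles Z) :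
    ∀ᶠ w in 𝓝[halfStrip (Real.pi / 6)] w₀,
      stripForm Z c ε x t n w = hsum (continued Z c ε x t n) (Complex.exp w) := by
  filter_upwards [self_mem_nhdsWithin, nhdsWithin_le_nhds (eventually_notMem_stripPoles h)]
    with w h1 h2
  exact stripForm_eq hd hε hn ⟨h1, h2⟩

theorem exp_top_edge (ρ : ℝ) : Complex.exp (ρ + ((Real.pi / 6 : ℝ) : ℂ) * Complex.I) =
    (Real.exp ρ : ℝ) * (-(Complex.I * kap 3)) := by
  have h1 : Complex.exp (((Real.pi / 6 : ℝ) : ℂ) * Complex.I) = -(Complex.I * kap 3) := by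
    have h2 : -Complex.I = Complex.exp (((-(Real.pi / 2) : ℝ) : ℂ) * Complex.I) := by
      rw [← Complex.exp_neg_pi_div_two_mul_I]
      congr 1
      push_cast
      ring
    rw [kap_three, om_eq_exp, ← neg_mul, h2, ← Complex.exp_add, ← add_mul, ← Complex.ofReal_add]
    congr 3
    ring
  rw [Complex.exp_add, h1, Complex.ofReal_exp]

/-- The map k ↦ -1/k preserves the upper half-plane, so both summands are evaluated in the upper
halves of their sectors, where nonreal zeros are removable for the form. -/
theorem exists_tendsto_stripForm (hd : IsScatteringData r1 r2 Z c) (hε : AdmissibleRadius Z ε)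
    (hn : IsHomogeneousSolution r1 r2 Z c ε x t n) {w : ℂ} (h1 : 0 < w.re) (h2 : 0 < w.im)
    (h3 : w.im < Real.pi / 6) :
    ∃ y, Tendsto (fun w => hsum (continued Z c ε x t n) (Complex.exp w))
      (𝓝[halfStrip (Real.pi / 6) \ stripPoles Z] w) (𝓝 y) := by
  have hpi := Real.pi_pos
  have hw : w ∈ halfStrip (Real.pi / 6) := ⟨h1, h2, h3⟩
  have hk := exp_mem_outerSector_of_halfStrip hw
  have him1 := exp_im_pos h2 (by linarith)
  have him2 : 0 < (-(Complex.exp w)⁻¹).im := by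
    rw [neg_inv_exp]
    exact mul_pos (Real.exp_pos _) (Real.sin_pos_of_pos_of_lt_pi h2 (by linarith))
  obtain ⟨l1, hl1⟩ := exists_tendsto_herm hd hε hn him1 (Or.inl ⟨hk, rfl⟩)
  obtain ⟨l2, hl2⟩ := exists_tendsto_herm hd hε hn him2 (Or.inr ⟨neg_inv_mem_innerSector hk, rfl⟩)
  have key : ∀ f : ℂ → ℂ, Continuous f → (∀ w ∈ halfStrip (Real.pi / 6) \ stripPoles Z,
      f w ∉ centers Z) → Tendsto f (𝓝[halfStrip (Real.pi / 6) \ stripPoles Z] w)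
        (𝓝[(centers Z)ᶜ] (f w)) := by
    intro f hf h
    refine tendsto_nhdsWithin_of_tendsto_nhds_of_eventually_within _
      (hf.continuousAt.tendsto.mono_left nhdsWithin_le_nhds) ?_
    filter_upwards [self_mem_nhdsWithin] with w hw using h w hw
  refine ⟨_, (hl1.comp (key Complex.exp Complex.continuous_exp
    fun w hw h => hw.2 ⟨hw.1, Or.inl h⟩)).add (hl2.comp (key (fun w => -(Complex.exp w)⁻¹)
      (Complex.continuous_exp.inv₀ Complex.exp_ne_zero).neg
      fun w hw h => hw.2 ⟨hw.1, Or.inr h⟩))⟩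

theorem exists_tendsto_stripForm_top (hd : IsScatteringData r1 r2 Z c) (hε : AdmissibleRadius Z ε)
    (hn : IsHomogeneousSolution r1 r2 Z c ε x t n) {ρ : ℝ} (hρ : 0 < ρ) :
    ∃ y : ℝ, Tendsto (fun w => hsum (continued Z c ε x t n) (Complex.exp w))
      (𝓝[halfStrip (Real.pi / 6) \ stripPoles Z] (ρ + ((Real.pi / 6 : ℝ) : ℂ) * Complex.I))
      (𝓝 (y : ℂ)) := by
  obtain ⟨l, hl⟩ := exists_tendsto_ray hd hε hn (Real.one_lt_exp_iff.2 hρ)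
  refine ⟨l, ?_⟩
  have h := tendsto_exp_halfStrip (ρ + ((Real.pi / 6 : ℝ) : ℂ) * Complex.I)
  rw [exp_top_edge] at h
  exact hl.comp (h.mono_left (nhdsWithin_mono _ sdiff_subset))

theorem continuousOn_stripForm (hd : IsScatteringData r1 r2 Z c) (hε : AdmissibleRadius Z ε)
    (hn : IsHomogeneousSolution r1 r2 Z c ε x t n) :
    ContinuousOn (stripForm Z c ε x t n) {w | 0 < w.re ∧ 0 < w.im ∧ w.im ≤ Real.pi / 6} := by
  refine continuousOn_extendFrom
    (fun w hw => mem_closure_strip_diff hw.1.le hw.2.1.le hw.2.2) fun w hw => ?_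
  rcases hw.2.2.lt_or_eq with h | h
  · exact exists_tendsto_stripForm hd hε hn hw.1 hw.2.1 h
  · obtain ⟨y, hy⟩ := exists_tendsto_stripForm_top hd hε hn hw.1
    have e : (w.re + ((Real.pi / 6 : ℝ) : ℂ) * Complex.I : ℂ) = w := by
      rw [← h, Complex.re_add_im]
    rw [e] at hy
    exact ⟨y, hy⟩

theorem stripForm_top_im (hd : IsScatteringData r1 r2 Z c) (hε : AdmissibleRadius Z ε)
    (hn : IsHomogeneousSolution r1 r2 Z c ε x t n) {ρ : ℝ} (hρ : 0 < ρ) :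
    (stripForm Z c ε x t n (ρ + ((Real.pi / 6 : ℝ) : ℂ) * Complex.I)).im = 0 := by
  have hpi := Real.pi_pos
  obtain ⟨y, hy⟩ := exists_tendsto_stripForm_top hd hε hn hρ
  rw [stripForm, extendFrom_eq (mem_closure_strip_diff ?_ ?_ ?_) hy, Complex.ofReal_im]
  · simpa using hρ.le
  · simp; positivity
  · simp

theorem stripForm_bottom (hd : IsScatteringData r1 r2 Z c) (hε : AdmissibleRadius Z ε)
    (hn : IsHomogeneousSolution r1 r2 Z c ε x t n) {ρ : ℝ} (hρ : 0 < ρ) :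
    ∃ C : ℝ, ∀ᶠ w in 𝓝 (ρ : ℂ), 0 < w.im → -C * w.im ≤ (stripForm Z c ε x t n w).im := by
  have hpi := Real.pi_pos
  have ha := Real.one_lt_exp_iff.2 hρ
  obtain ⟨C₁, h1⟩ := exists_herm_im_lower_bound hd hε hn (a := Real.exp ρ) (σ := 1)
    (Or.inl ⟨ha, rfl⟩)
  obtain ⟨C₂, h2⟩ := exists_herm_im_lower_bound hd hε hn (a := -(Real.exp ρ)⁻¹) (σ := -1)
    (Or.inr ⟨⟨neg_lt_neg (inv_lt_one_of_one_lt₀ ha), by simp; positivity⟩, rfl⟩)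
  have t1 : Tendsto Complex.exp (𝓝 (ρ : ℂ)) (𝓝 ((Real.exp ρ : ℝ) : ℂ)) := by
    rw [Complex.ofReal_exp]; exact Complex.continuous_exp.continuousAt.tendsto
  have t2 : Tendsto (fun w => -(Complex.exp w)⁻¹) (𝓝 (ρ : ℂ))
      (𝓝 ((-(Real.exp ρ)⁻¹ : ℝ) : ℂ)) := by
    rw [Complex.ofReal_neg, Complex.ofReal_inv]
    exact (t1.inv₀ (by simp)).neg
  have hre : Tendsto (fun q : ℂ => q.re) (𝓝 (ρ : ℂ)) (𝓝 ρ) := by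
    simpa using Complex.continuous_re.tendsto (ρ : ℂ)
  have him : Tendsto (fun q : ℂ => q.im) (𝓝 (ρ : ℂ)) (𝓝 0) := by
    simpa using Complex.continuous_im.tendsto (ρ : ℂ)
  have hS : (ρ : ℂ) ∉ stripPoles Z := fun h => by
    have := h.1.2.1; simp at this
  -- Transfers the two bounds to w: Im e^w ≤ e^{ρ+1} Im w when Re w < ρ + 1, and Im(-e^{-w}) ≤ Im w
  -- when Re w > 0.
  refine ⟨|C₁| * Real.exp (ρ + 1) + |C₂|, ?_⟩
  filter_upwards [t1.eventually h1, t2.eventually h2, hre.eventually (lt_mem_nhds hρ),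
    hre.eventually (gt_mem_nhds (lt_add_one ρ)),
    him.eventually (gt_mem_nhds (show (0 : ℝ) < Real.pi / 6 by positivity)),
    eventually_notMem_stripPoles hS] with w h1 h2 h3 h4 h5 h6 h7
  have hsin := Real.sin_le h7.le
  have hsin0 := Real.sin_pos_of_pos_of_lt_pi h7 (by linarith)
  have e1 : (Complex.exp w).im = Real.exp w.re * Real.sin w.im := Complex.exp_im w
  have b1 : Real.exp w.re * Real.sin w.im ≤ Real.exp (ρ + 1) * w.im :=
    mul_le_mul (Real.exp_le_exp.2 h4.le) hsin hsin0.le (Real.exp_pos _).le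
  have b2 : Real.exp (-w.re) * Real.sin w.im ≤ 1 * w.im :=
    mul_le_mul (Real.exp_le_one_iff.2 (by linarith)) hsin hsin0.le zero_le_one
  have p1 : 0 < Real.exp w.re * Real.sin w.im := mul_pos (Real.exp_pos _) hsin0
  have p2 : 0 < Real.exp (-w.re) * Real.sin w.im := mul_pos (Real.exp_pos _) hsin0
  rw [e1] at h1
  rw [neg_inv_exp] at h2
  have h1 := h1 p1
  have h2 := h2 p2
  rw [Complex.ofReal_one] at h1
  rw [Complex.ofReal_neg, Complex.ofReal_one] at h2
  rw [stripForm_eq hd hε hn ⟨⟨h3, h7, h5⟩, h6⟩, hsum, Complex.add_im]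
  have g1 : C₁ * (Real.exp w.re * Real.sin w.im) ≤ |C₁| * (Real.exp (ρ + 1) * w.im) :=
    mul_le_mul (le_abs_self _) b1 p1.le (abs_nonneg _)
  have g2 : C₂ * (Real.exp (-w.re) * Real.sin w.im) ≤ |C₂| * (1 * w.im) :=
    mul_le_mul (le_abs_self _) b2 p2.le (abs_nonneg _)
  linarith

theorem stripForm_decay (hd : IsScatteringData r1 r2 Z c) (hε : AdmissibleRadius Z ε)
    (hn : IsHomogeneousSolution r1 r2 Z c ε x t n) :
    ∃ C R : ℝ, ∀ w ∈ halfStrip (Real.pi / 6), R ≤ w.re →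
      ‖stripForm Z c ε x t n w‖ ≤ C * Real.exp (-w.re) := by
  obtain ⟨C, hC⟩ := (isBigO_hsum_cobounded hd hε hn).bound
  rw [eventually_inf_principal] at hC
  obtain ⟨R, hR⟩ := (Metric.hasBasis_cobounded_compl_closedBall (0 : ℂ)).eventually_iff.1 hC
  obtain ⟨M, hM⟩ := ((finite_stripPoles Z).image Complex.re).bddAbove
  -- Since e^x ≥ x + 1, the first bound puts e^w outside the ball of radius R; the second lies
  -- beyond all of the finitely many exceptional points.
  refine ⟨C, max (R + 1) (M + 1), fun w hw hwR => ?_⟩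
  have h1 : w ∉ stripPoles Z := by
    intro h
    have := hM ⟨w, h, rfl⟩
    linarith [le_max_right (R + 1) (M + 1)]
  have h2 : R < ‖Complex.exp w‖ := by
    rw [Complex.norm_exp]
    linarith [Real.add_one_le_exp w.re, le_max_left (R + 1) (M + 1)]
  have h3 := hR.2 (x := Complex.exp w) (by simpa using h2) (exp_mem_outerSector_of_halfStrip hw)
  rw [stripForm_eq hd hε hn ⟨hw, h1⟩]
  rwa [norm_inv, Complex.norm_exp, ← Real.exp_neg] at h3

/-- At φ = 0 the point is 1 ∈ 𝒬 and at φ = π/6 it is iκ₆ ∈ Γ_⋆, so boundedness of the solution is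
used. In between the limit exists. -/
theorem exists_local_bound_stripForm (hd : IsScatteringData r1 r2 Z c)
    (hε : AdmissibleRadius Z ε) (hn : IsHomogeneousSolution r1 r2 Z c ε x t n) {φ : ℝ}
    (hφ : φ ∈ Icc 0 (Real.pi / 6)) :
    ∃ B : ℝ, ∀ᶠ w in 𝓝[halfStrip (Real.pi / 6)] (φ * Complex.I),
      ‖stripForm Z c ε x t n w‖ ≤ B := by
  have hS : (φ * Complex.I : ℂ) ∉ stripPoles Z := fun h => by
    have := h.1.1; simp at this
  have key : hsum (continued Z c ε x t n) =O[𝓝[outerSector] (circPar φ)] fun _ => (1 : ℂ) := by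
    rcases hφ.1.eq_or_lt with h0 | h0
    · have e : circPar φ = 1 := by simp [circPar, ← h0]
      have m1 : (1 : ℂ) ∈ GammaStar ∪ Qset := Or.inr ⟨1, by simp, kap_one.symm⟩
      have m2 : (-1 : ℂ) ∈ GammaStar ∪ Qset := Or.inr ⟨4, by simp, kap_four.symm⟩
      refine isBigO_hsum_of_norm_one hd hε hn (norm_circPar φ) ?_ ?_ ?_ ?_ <;> rw [e]
      · exact m1
      · rwa [map_one]
      · exact m2
      · rwa [map_one]
    · rcases hφ.2.lt_or_eq with h1 | h1
      · obtain ⟨l, hl, -⟩ := exists_tendsto_hsum_arc hd hε hn ⟨h0, h1⟩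
        exact hl.isBigO_one ℂ
      · have e : circPar φ = -(Complex.I * om) := by
          have := exp_top_edge 0
          rw [kap_three] at this
          simpa [circPar, h1] using this
        have hc : conj (circPar φ) = Complex.I * om ^ 2 := by rw [e]; simp [conj_om]
        have m : ∀ j ∈ Finset.Icc 1 6, Complex.I * kap j ∈ GammaStar ∪ Qset := fun j hj =>
          Or.inl (Or.inl ⟨j, hj, rfl⟩)
        refine isBigO_hsum_of_norm_one hd hε hn (norm_circPar φ) ?_ ?_ ?_ ?_
        · have := m 6 (by simp)
          rwa [kap_six, mul_neg, ← e] at this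
        · have := m 5 (by simp)
          rwa [kap_five, ← hc] at this
        · have := m 3 (by simp)
          rwa [kap_three, ← neg_neg (Complex.I * om), ← e] at this
        · have := m 2 (by simp)
          rwa [kap_two, mul_neg, ← hc] at this
  obtain ⟨B, hB⟩ := key.bound
  refine ⟨B, ?_⟩
  filter_upwards [(tendsto_exp_halfStrip (φ * Complex.I)).eventually hB,
    eventually_stripForm_eq hd hε hn hS] with w h1 h2
  rw [h2]
  simpa using h1

theorem stripForm_bounded (hd : IsScatteringData r1 r2 Z c) (hε : AdmissibleRadius Z ε)
    (hn : IsHomogeneousSolution r1 r2 Z c ε x t n) :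
    ∃ B : ℝ, ∃ δ > 0, ∀ w ∈ halfStrip (Real.pi / 6), w.re < δ →
      ‖stripForm Z c ε x t n w‖ ≤ B := by
  have hK : IsCompact ((fun φ : ℝ => (φ * Complex.I : ℂ)) '' Icc 0 (Real.pi / 6)) :=
    isCompact_Icc.image (by fun_prop)
  have hP : ∃ B : ℝ, ∀ᶠ w in 𝓝ˢ ((fun φ : ℝ => (φ * Complex.I : ℂ)) '' Icc 0 (Real.pi / 6)),
      w ∈ halfStrip (Real.pi / 6) → ‖stripForm Z c ε x t n w‖ ≤ B := by
    refine hK.induction_on (p := fun s => ∃ B : ℝ, ∀ᶠ w in 𝓝ˢ s, w ∈ halfStrip (Real.pi / 6) →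
      ‖stripForm Z c ε x t n w‖ ≤ B) ?_ ?_ ?_ ?_
    · exact ⟨0, by simp⟩
    · rintro s s' hs ⟨B, hB⟩
      exact ⟨B, nhdsSet_mono hs hB⟩
    · rintro s s' ⟨B, hB⟩ ⟨B', hB'⟩
      refine ⟨max B B', ?_⟩
      rw [nhdsSet_union, eventually_sup]
      exact ⟨hB.mono fun w h hw => (h hw).trans (le_max_left _ _),
        hB'.mono fun w h hw => (h hw).trans (le_max_right _ _)⟩
    · rintro _ ⟨φ, hφ, rfl⟩
      obtain ⟨B, hB⟩ := exists_local_bound_stripForm hd hε hn hφ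
      rw [eventually_nhdsWithin_iff, eventually_nhds_iff] at hB
      obtain ⟨U, hU, hUo, hUφ⟩ := hB
      refine ⟨U, nhdsWithin_le_nhds (hUo.mem_nhds hUφ), B, ?_⟩
      rw [hUo.nhdsSet_eq]
      exact hU
  obtain ⟨B, hB⟩ := hP
  obtain ⟨U, hUo, hKU, hU⟩ := eventually_nhdsSet_iff_exists.1 hB
  obtain ⟨δ, hδ, hδU⟩ := hK.exists_thickening_subset_open hUo hKU
  refine ⟨B, δ, hδ, fun w hw hwδ => hU w (hδU ?_) hw⟩
  refine Metric.mem_thickening_iff.2 ⟨_, ⟨w.im, ⟨hw.2.1.le, hw.2.2.le⟩, rfl⟩, ?_⟩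
  have : w - w.im * Complex.I = (w.re : ℂ) := by
    nth_rewrite 1 [← Complex.re_add_im w]; ring
  rw [dist_eq_norm, this, Complex.norm_real, Real.norm_of_nonneg hw.1.le]
  exact hwδ

/-- The solution vanishes at the arcs of the unit circle near the real axis. -/
theorem tendsto_zero_of_arc (hd : IsScatteringData r1 r2 Z c) (hε : AdmissibleRadius Z ε)
    (hn : IsHomogeneousSolution r1 r2 Z c ε x t n) {φ : ℝ} (hφ : φ ∈ Ioo 0 (Real.pi / 6))
    {τ : ℂ} (hτ : τ = 1 ∨ τ = -1) :
    Tendsto (fun k => n (τ * k)) (𝓝[outerSector] (circPar φ)) (𝓝 0) := by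
  have hpi := Real.pi_pos
  choose! l hl1 hl2 hl3 using fun φ (hφ : φ ∈ Ioo 0 (Real.pi / 6)) =>
    exists_tendsto_hsum_arc hd hε hn hφ
  -- All boundary information meets here: real on top, bounded below linearly at the bottom, decay
  -- to the right, and nonpositive real part on the left edge.
  have h := re_limit_eq_zero_of_halfStrip (finite_stripPoles Z).countable
    (b := Real.pi / 6) (by positivity) (continuousOn_stripForm hd hε hn)
    (fun w hw hws => (differentiableAt_hsum_exp hd hε hn ⟨hw, hws⟩).congr_of_eventuallyEq (by
      filter_upwards [isOpen_strip_diff.mem_nhds ⟨hw, hws⟩] with z hz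
      exact stripForm_eq hd hε hn hz))
    (fun ρ hρ => stripForm_top_im hd hε hn hρ) (fun ρ hρ => stripForm_bottom hd hε hn hρ)
    (stripForm_decay hd hε hn) (stripForm_bounded hd hε hn) (l := l)
    (fun φ hφ => by
      have hS : (φ * Complex.I : ℂ) ∉ stripPoles Z := fun h => by
        have := h.1.1; simp at this
      refine ((hl1 φ hφ).comp (tendsto_exp_halfStrip (φ * Complex.I))).congr' ?_
      exact (eventually_stripForm_eq hd hε hn hS).mono fun w h => h.symm)
    hl2
  exact (hl3 φ hφ (h φ hφ) τ hτ).1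

end Vanishing

end Bsq

namespace Bsq

/-! ### Uniqueness -/

open ComplexConjugate

section Uniqueness

variable {r1 r2 : ℂ → ℂ} {Z : Finset ℂ} {c : ℂ → ℂ} {ε x t : ℝ} {n : ℂ → Fin 3 → ℂ}

/-- The solution vanishes on an open set near the unit circle. -/
theorem exists_eventually_eq_zero (hd : IsScatteringData r1 r2 Z c) (hε : AdmissibleRadius Z ε)
    (hn : IsHomogeneousSolution r1 r2 Z c ε x t n) {τ : ℂ} (hτ : τ = 1 ∨ τ = -1) :
    ∃ k₁ ∈ outerSector, (∀ p ∈ centers Z, k₁ ∉ Metric.closedBall p ε) ∧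
      (∀ p ∈ centers Z, -k₁⁻¹ ∉ Metric.closedBall p ε) ∧ ∀ᶠ k in 𝓝 k₁, n (τ * k) = 0 := by
  have hpi := Real.pi_pos
  set k₀ := circPar (Real.pi / 12) with hk₀
  have hn₀ : ‖k₀‖ = 1 := norm_circPar _
  have h0 : k₀ ≠ 0 := Complex.exp_ne_zero _
  have hG : k₀ ∈ Gamma := (mem_Gamma_iff _).2 (Or.inl hn₀)
  have harg₀ : Complex.arg k₀ = Real.pi / 12 :=
    Complex.arg_exp_mul_I _ ▸ (toIocMod_eq_self _).2 ⟨by linarith, by linarith⟩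
  have hslit : k₀ ∈ Complex.slitPlane :=
    Complex.mem_slitPlane_iff_arg.2 ⟨by rw [harg₀]; linarith, h0⟩
  have harg : ∀ᶠ k in 𝓝 k₀, Complex.arg k ∈ Ioo 0 (Real.pi / 6) := by
    refine (Complex.continuousAt_arg hslit).eventually (Ioo_mem_nhds ?_ ?_) <;> rw [harg₀] <;>
      linarith
  have hev := eventually_hsum_eq hd hε hn hG h0
  rw [eventually_nhdsWithin_iff] at hev
  obtain ⟨ρ, hρ, hU⟩ := Metric.eventually_nhds_iff_ball.1
    (harg.and (hev.and (eventually_outside_of_mem_Gamma hε hG h0)))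
  have hout : ∀ k ∈ Metric.ball k₀ ρ, 1 < ‖k‖ → k ∈ outerSector := by
    intro k hk h1
    rw [← Complex.norm_mul_exp_arg_mul_I k]
    have := (hU k hk).1
    exact polar_mem_outerSector h1 (by rw [abs_of_pos this.1]; exact this.2)
  have hdiff : ∀ k ∈ Metric.ball k₀ ρ, 1 < ‖k‖ → DifferentiableAt ℂ (fun k => n (τ * k)) k := by
    intro k hk h1
    have h2 : ∀ z ∈ Metric.ball k₀ ρ ∩ {z | 1 < ‖z‖}, τ * z ∉ GammaTilde Z ε := by
      intro z hz
      have h3 := (hU z hz.1).2.1 (hout z hz.1 hz.2)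
      rcases hτ with h | h <;> rw [h]
      · rw [one_mul]; exact h3.1
      · rw [neg_one_mul]; exact h3.2.2.1
    have ho : IsOpen (Metric.ball k₀ ρ ∩ {z | 1 < ‖z‖}) :=
      Metric.isOpen_ball.inter (isOpen_lt continuous_const continuous_norm)
    have h4 : DifferentiableOn ℂ (fun k => n (τ * k)) (Metric.ball k₀ ρ ∩ {z | 1 < ‖z‖}) :=
      hn.analytic.comp (by fun_prop) h2
    exact h4.differentiableAt (ho.mem_nhds ⟨hk, h1⟩)
  classical
  -- Extension by zero into the disk: continuous because the limits on the arc vanish, hence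
  -- holomorphic across the circle, and zero on an open set.
  set f : ℂ → Fin 3 → ℂ := fun k => if 1 < ‖k‖ then n (τ * k) else 0 with hf
  have hgt : ∀ k, 1 < ‖k‖ → f =ᶠ[𝓝 k] fun k => n (τ * k) := by
    intro k hk
    filter_upwards [(isOpen_lt continuous_const continuous_norm).mem_nhds hk] with z hz
    exact if_pos hz
  have hlt : ∀ k, ‖k‖ < 1 → f =ᶠ[𝓝 k] 0 := by
    intro k hk
    filter_upwards [(isOpen_lt continuous_norm continuous_const).mem_nhds hk] with z hz
    exact if_neg (not_lt.2 (le_of_lt hz))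
  have hfd : ∀ k ∈ Metric.ball k₀ ρ, dist k 0 ≠ 1 → DifferentiableAt ℂ f k := by
    intro k hk h1
    rw [dist_zero_right] at h1
    rcases h1.lt_or_gt with h | h
    · exact (differentiableAt_const (0 : Fin 3 → ℂ)).congr_of_eventuallyEq (hlt k h)
    · exact (hdiff k hk h).congr_of_eventuallyEq (hgt k h)
  have hfc : ContinuousOn f (Metric.ball k₀ ρ) := by
    intro k hk
    refine ContinuousAt.continuousWithinAt ?_
    by_cases h1 : ‖k‖ = 1
    · have hkc : k = circPar (Complex.arg k) := by
        have := Complex.norm_mul_exp_arg_mul_I k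
        rw [h1, Complex.ofReal_one, one_mul] at this
        exact this.symm
      have hT := tendsto_zero_of_arc hd hε hn (hU k hk).1 hτ
      rw [← hkc] at hT
      have hfk : f k = 0 := if_neg (by rw [h1]; exact lt_irrefl 1)
      rw [ContinuousAt, hfk, tendsto_def]
      intro V hV
      have h2 := hT.eventually hV
      rw [eventually_nhdsWithin_iff] at h2
      filter_upwards [h2, Metric.isOpen_ball.mem_nhds hk] with z hz hzU
      by_cases h3 : 1 < ‖z‖
      · rw [mem_preimage, hf]
        simp only [if_pos h3]
        exact hz (hout z hzU h3)
      · rw [mem_preimage, hf]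
        simp only [if_neg h3]
        exact mem_of_mem_nhds hV
    · exact (hfd k hk (by rwa [dist_zero_right])).continuousAt
  have hfa : AnalyticOnNhd ℂ f (Metric.ball k₀ ρ) :=
    (differentiableOn_of_off_sphere Metric.isOpen_ball hfc 0 one_pos hfd).analyticOnNhd
      Metric.isOpen_ball
  have hpt : ∀ s : ℝ, |s| < ρ → 0 ≤ 1 + s →
      ((1 + s : ℝ) : ℂ) * k₀ ∈ Metric.ball k₀ ρ ∧ ‖((1 + s : ℝ) : ℂ) * k₀‖ = 1 + s := by
    intro s hs hs1
    constructor
    · rw [Metric.mem_ball, dist_eq_norm]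
      have : ((1 + s : ℝ) : ℂ) * k₀ - k₀ = s * k₀ := by push_cast; ring
      rw [this, norm_mul, hn₀, mul_one, Complex.norm_real]
      exact hs
    · rw [norm_mul, hn₀, mul_one, Complex.norm_real, Real.norm_of_nonneg hs1]
  -- A radial step short enough to stay in the ball: (1 - s)k₀ lies where f is zero by definition,
  -- (1 + s)k₀ where f is the solution.
  set s : ℝ := min (ρ / 2) (1 / 2) with hs
  have hs0 : 0 < s := lt_min (by linarith) (by norm_num)
  have hsρ : s < ρ := lt_of_le_of_lt (min_le_left _ _) (by linarith)
  have hs1 : s ≤ 1 / 2 := min_le_right _ _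
  obtain ⟨a1, a2⟩ := hpt (-s) (by rwa [abs_neg, abs_of_pos hs0]) (by linarith)
  obtain ⟨b1, b2⟩ := hpt s (by rwa [abs_of_pos hs0]) (by linarith)
  have hz := hfa.eqOn_zero_of_preconnected_of_eventuallyEq_zero
    (convex_ball k₀ ρ).isPreconnected a1 (hlt _ (by rw [a2]; linarith))
  have hb : 1 < ‖((1 + s : ℝ) : ℂ) * k₀‖ := by rw [b2]; linarith
  refine ⟨_, hout _ b1 hb, (hU _ b1).2.2.1, (hU _ b1).2.2.2, ?_⟩
  filter_upwards [Metric.isOpen_ball.mem_nhds b1, hgt _ hb] with z h1 h2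
  rw [← h2]
  exact hz h1

/-- Adding the polar term is a unipotent operation: it changes one component by a multiple of
another that it leaves alone. -/
theorem eq_zero_of_add_poleTerm_eq_zero {p k : ℂ} {u : Fin 3 → ℂ}
    (h : u + poleTerm Z c x t p k u = 0) : u = 0 := by
  have e0 := congrFun h 0
  have e1 := congrFun h 1
  have e2 := congrFun h 2
  by_cases h1 : p.im = 0
  · rw [poleTerm_real h1] at e0 e1 e2
    simp at e0 e1 e2
    rw [e0, zero_mul, add_zero] at e1
    ext i; fin_cases i <;> assumption
  · by_cases h2 : p ∈ Z
    · rw [poleTerm_mem h1 h2] at e0 e1 e2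
      simp at e0 e1 e2
      rw [e0, zero_mul, add_zero] at e2
      ext i; fin_cases i <;> assumption
    · rw [poleTerm_notMem h1 h2] at e0 e1 e2
      simp at e0 e1 e2
      rw [e2, zero_mul, add_zero] at e1
      ext i; fin_cases i <;> assumption

theorem poleTerm_zero (p k : ℂ) : poleTerm Z c x t p k 0 = 0 := by
  by_cases h1 : p.im = 0
  · rw [poleTerm_real h1]; ext i; fin_cases i <;> simp
  · by_cases h2 : p ∈ Z
    · rw [poleTerm_mem h1 h2]; ext i; fin_cases i <;> simp
    · rw [poleTerm_notMem h1 h2]; ext i; fin_cases i <;> simp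

/-! ### Connectedness of the sectors and propagation of zeros -/

theorem abs_arg_of_mem_outerSector {k : ℂ} (hk : k ∈ outerSector) :
    |Complex.arg k| < Real.pi / 6 := by
  have hpi := Real.pi_pos
  have hk0 := ne_zero_of_mem_sectors (Or.inl hk)
  have hnorm : 0 < ‖k‖ := norm_pos_iff.2 hk0
  have hre : 0 < k.re := by linarith [re_add_re_add_re k, hk.2.1, hk.2.2]
  have h1 := hk.2.1
  have h2 := hk.2.2
  rw [← Complex.norm_mul_exp_arg_mul_I k, om_mul_polar_re] at h1
  rw [← Complex.norm_mul_exp_arg_mul_I k, om_sq_mul_polar_re] at h2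
  have h3 := abs_lt.1 (Complex.abs_arg_lt_pi_div_two_iff.2 (Or.inl hre))
  rw [abs_lt]
  constructor
  · by_contra! h
    have : 0 ≤ Real.cos (Complex.arg k + 2 * Real.pi / 3) :=
      Real.cos_nonneg_of_neg_pi_div_two_le_of_le (by linarith) (by linarith)
    nlinarith
  · by_contra! h
    have : 0 ≤ Real.cos (Complex.arg k - 2 * Real.pi / 3) :=
      Real.cos_nonneg_of_neg_pi_div_two_le_of_le (by linarith) (by linarith)
    nlinarith

/-- The exponential maps a convex half-strip onto the sector. -/
theorem isPreconnected_outerSector : IsPreconnected outerSector := by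
  have e : outerSector = Complex.exp '' (Ioi 0 ×ℂ Ioo (-(Real.pi / 6)) (Real.pi / 6)) := by
    ext k
    constructor
    · intro hk
      have hk0 := ne_zero_of_mem_sectors (Or.inl hk)
      refine ⟨Complex.log k, ?_, Complex.exp_log hk0⟩
      rw [Complex.mem_reProdIm, Complex.log_re, Complex.log_im]
      exact ⟨Real.log_pos hk.1, abs_lt.1 (abs_arg_of_mem_outerSector hk)⟩
    · rintro ⟨w, hw, rfl⟩
      exact exp_mem_outerSector hw.1 (abs_lt.2 hw.2)
  rw [e]
  refine IsPreconnected.image ?_ _ Complex.continuous_exp.continuousOn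
  exact (((convex_Ioi 0).linear_preimage Complex.reLm).inter
    ((convex_Ioo _ _).linear_preimage Complex.imLm)).isPreconnected

theorem neg_inv_mem_outerSector {k : ℂ} (hk : k ∈ innerSector) : -k⁻¹ ∈ outerSector := by
  have hk0 := ne_zero_of_mem_sectors (Or.inr hk)
  obtain ⟨h1, h2, h3⟩ := hk
  have key : ∀ z : ℂ, (z * -k⁻¹).re = -((conj z * k).re / Complex.normSq k) := by
    intro z
    rw [Complex.inv_def]
    simp
    ring
  have hN : 0 < Complex.normSq k := Complex.normSq_pos.2 hk0
  refine ⟨?_, ?_, ?_⟩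
  · rw [norm_neg, norm_inv]
    exact (one_lt_inv₀ (norm_pos_iff.2 hk0)).2 h1
  · rw [key, conj_om, neg_lt_zero]
    exact div_pos h3 hN
  · rw [key, map_pow, conj_om, om_sq_sq, neg_lt_zero]
    exact div_pos h2 hN

theorem isPreconnected_innerSector : IsPreconnected innerSector := by
  have e : innerSector = (fun k => -k⁻¹) '' outerSector := by
    ext k
    constructor
    · exact fun hk => ⟨_, neg_inv_mem_outerSector hk, by simp⟩
    · rintro ⟨w, hw, rfl⟩
      exact neg_inv_mem_innerSector hw
  rw [e]
  refine isPreconnected_outerSector.image _ fun k hk => ?_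
  exact (continuousAt_inv₀ (ne_zero_of_mem_sectors (Or.inl hk))).neg.continuousWithinAt

/-- Identity theorem for the continued solution. -/
theorem eventually_continued_eq_zero (hd : IsScatteringData r1 r2 Z c)
    (hε : AdmissibleRadius Z ε) (hn : IsHomogeneousSolution r1 r2 Z c ε x t n) {V : Set ℂ}
    (hV : V ⊆ sectors) (hVp : IsPreconnected V) {k₁ : ℂ} (hk₁ : k₁ ∈ V)
    (h₁ : ∀ᶠ k in 𝓝 k₁, continued Z c ε x t n k = 0) {k : ℂ} (hk : k ∈ V) :
    ∀ᶠ z in 𝓝 k, z ∉ centers Z → continued Z c ε x t n z = 0 := by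
  set N := continued Z c ε x t n with hN
  -- Ignoring the centers makes this open set relatively closed as well, even at the possible poles.
  set u : Set ℂ := {k | ∀ᶠ z in 𝓝 k, z ∉ centers Z → N z = 0} with hu
  have huo : IsOpen u := isOpen_iff_eventually.2 fun k hk => eventually_eventually_nhds.2 hk
  refine hVp.subset_of_closure_inter_subset huo ⟨k₁, hk₁, h₁.mono fun z hz _ => hz⟩ ?_ hk
  rintro z ⟨hzc, hzV⟩
  have hzs := hV hzV
  by_cases hz : z ∈ centers Z
  · have hdn : AnalyticOnNhd ℂ n (Metric.ball z ε) := by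
      refine DifferentiableOn.analyticOnNhd (fun y hy => ?_) Metric.isOpen_ball
      exact (differentiableAt_solution hd hε hn
        (closedBall_subset_sectors hd hε hz (Metric.ball_subset_closedBall hy))
        (dist_ne_of_mem_ball hε hz hy)).differentiableWithinAt
    obtain ⟨y, hyb, hyu⟩ := mem_closure_iff.1 hzc _ Metric.isOpen_ball
      (Metric.mem_ball_self hε.1)
    by_cases hyz : y = z
    · rwa [hyz] at hyu
    have hny : n =ᶠ[𝓝 y] 0 := by
      have hyc : ∀ᶠ w in 𝓝 y, w ∉ centers Z := by
        refine (finite_centers Z).isClosed.isOpen_compl.mem_nhds fun hyc => ?_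
        exact notMem_closedBall_of_mem_closedBall hε hz hyc hyz
          (Metric.ball_subset_closedBall hyb) (Metric.mem_closedBall_self hε.1.le)
      filter_upwards [hyu, hyc, Metric.isOpen_ball.mem_nhds hyb, eventually_ne_nhds hyz]
        with w h1 h2 h3 h4
      have := h1 h2
      rw [hN, continued_eq_of_inside hd hε hn hz h3 h4] at this
      exact eq_zero_of_add_poleTerm_eq_zero this
    have h0 := hdn.eqOn_zero_of_preconnected_of_eventuallyEq_zero
      (convex_ball z ε).isPreconnected hyb hny
    filter_upwards [Metric.ball_mem_nhds z hε.1] with w hw hwc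
    rw [hN, continued_eq_of_inside hd hε hn hz hw (by rintro rfl; exact hwc hz), h0 hw]
    simp [poleTerm_zero]
  · obtain ⟨ρ, hρ, hb⟩ := Metric.isOpen_iff.1 (isOpen_sectors_diff_centers (Z := Z)) z ⟨hzs, hz⟩
    have hdN : AnalyticOnNhd ℂ N (Metric.ball z ρ) :=
      DifferentiableOn.analyticOnNhd (fun y hy =>
        (differentiableAt_continued hd hε hn (hb hy)).differentiableWithinAt) Metric.isOpen_ball
    obtain ⟨y, hyb, hyu⟩ := mem_closure_iff.1 hzc _ Metric.isOpen_ball (Metric.mem_ball_self hρ)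
    have hNy : N =ᶠ[𝓝 y] 0 := by
      filter_upwards [hyu, Metric.isOpen_ball.mem_nhds hyb] with w h1 h2
      exact h1 (hb h2).2
    have h0 := hdN.eqOn_zero_of_preconnected_of_eventuallyEq_zero
      (convex_ball z ρ).isPreconnected hyb hNy
    filter_upwards [Metric.ball_mem_nhds z hρ] with w hw _
    exact h0 hw

/-- Each sector needs its own starting point: the arc at 1 serves the outer one directly, the arc at
-1 the inner one after ℬ moves -k to -1/k. -/
theorem eventually_continued_eq_zero_of_mem_sectors (hd : IsScatteringData r1 r2 Z c)
    (hε : AdmissibleRadius Z ε) (hn : IsHomogeneousSolution r1 r2 Z c ε x t n) {k : ℂ}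
    (hk : k ∈ sectors) : ∀ᶠ z in 𝓝 k, z ∉ centers Z → continued Z c ε x t n z = 0 := by
  rcases hk with hk | hk
  · obtain ⟨k₁, h1, h2, -, h3⟩ := exists_eventually_eq_zero hd hε hn (Or.inl rfl)
    refine eventually_continued_eq_zero hd hε hn subset_union_left isPreconnected_outerSector h1 ?_ hk
    filter_upwards [h3, isOpen_outerSector.mem_nhds h1,
      eventually_notMem_closedBall subset_rfl h2] with z hz1 hz2 hz3
    rwa [continued_eq_of_outside hd hε hn (Or.inl hz2) hz3, ← one_mul z]
  · obtain ⟨k₁, h1, -, h2, h3⟩ := exists_eventually_eq_zero hd hε hn (Or.inr rfl)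
    have hq₁ := neg_inv_mem_innerSector h1
    refine eventually_continued_eq_zero hd hε hn subset_union_right isPreconnected_innerSector
      hq₁ ?_ hk
    have hT : Tendsto (fun q : ℂ => -q⁻¹) (𝓝 (-k₁⁻¹)) (𝓝 k₁) := by
      have := (tendsto_inv₀ (ne_zero_of_mem_sectors (Or.inr hq₁))).neg
      simpa using this
    filter_upwards [hT.eventually h3, isOpen_innerSector.mem_nhds hq₁,
      eventually_notMem_closedBall subset_rfl h2] with z hz1 hz2 hz3
    rw [continued_eq_of_outside hd hε hn (Or.inr hz2) hz3,
      hn.symm_B z (notMem_GammaTilde_of_outside hd hε (Or.inr hz2) hz3)]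
    rw [neg_one_mul, neg_neg] at hz1
    rw [hz1, Matrix.zero_vecMul]

theorem eq_zero_of_mem_sectors (hd : IsScatteringData r1 r2 Z c)
    (hε : AdmissibleRadius Z ε) (hn : IsHomogeneousSolution r1 r2 Z c ε x t n) {k : ℂ}
    (hk : k ∈ sectors) (hkG : k ∉ GammaTilde Z ε) : n k = 0 := by
  have hin : ∀ p ∈ centers Z, ∀ z ∈ Metric.ball p ε, z ≠ p → n z = 0 := by
    intro p hp z hz hzp
    have hzs := closedBall_subset_sectors hd hε hp (Metric.ball_subset_closedBall hz)
    have h1 := (eventually_continued_eq_zero_of_mem_sectors hd hε hn hzs).self_of_nhds fun hzc =>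
      notMem_closedBall_of_mem_closedBall hε hp hzc hzp
        (Metric.ball_subset_closedBall hz) (Metric.mem_closedBall_self hε.1.le)
    rw [continued_eq_of_inside hd hε hn hp hz hzp] at h1
    exact eq_zero_of_add_poleTerm_eq_zero h1
  by_cases h : ∃ p ∈ centers Z, k ∈ Metric.closedBall p ε
  · obtain ⟨p, hp, hkp⟩ := h
    have hkb : k ∈ Metric.ball p ε :=
      lt_of_le_of_ne hkp fun h => hkG (sphere_subset_GammaTilde hp h)
    by_cases hkp' : k = p
    -- At the center the continuation gives no information, but the solution is continuous there and
    -- vanishes on the punctured disk.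
    · subst hkp'
      have hc := (differentiableAt_solution hd hε hn hk (dist_ne_of_mem_ball hε hp hkb)).continuousAt
      refine tendsto_nhds_unique (hc.tendsto.mono_left nhdsWithin_le_nhds)
        (Tendsto.congr' (f₁ := fun _ => 0) (l₁ := 𝓝[≠] k) ?_ tendsto_const_nhds)
      filter_upwards [self_mem_nhdsWithin,
        nhdsWithin_le_nhds (Metric.isOpen_ball.mem_nhds hkb)] with z h1 h2
      exact (hin k hp z h2 h1).symm
    · exact hin p hp k hkb hkp'
  · push Not at h
    rw [← continued_eq_of_outside hd hε hn hk h]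
    exact (eventually_continued_eq_zero_of_mem_sectors hd hε hn hk).self_of_nhds fun hkc =>
      h k hkc (Metric.mem_closedBall_self hε.1.le)

/-- Every solution of the homogeneous Riemann-Hilbert problem vanishes. -/
theorem eq_zero_of_isHomogeneousSolution (hd : IsScatteringData r1 r2 Z c)
    (hε : AdmissibleRadius Z ε) (hn : IsHomogeneousSolution r1 r2 Z c ε x t n) {k : ℂ}
    (hk : k ∉ GammaTilde Z ε) : n k = 0 := by
  -- The sign of Re k³ and the side of the circle divide the complement of Γ into four classes.
  -- Rotations bring two of them to the sectors; inversion carries the other two to these.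
  have key : ∀ q ∉ GammaTilde Z ε,
      ((1 < ‖q‖ ∧ 0 < (q ^ 3).re) ∨ (‖q‖ < 1 ∧ (q ^ 3).re < 0)) → n q = 0 := by
    intro q hq hs
    have h1 := om_mul_notMem_GammaTilde hq
    have h2 := om_mul_notMem_GammaTilde h1
    rcases exists_rotation_mem_sectors hs with h | h | h
    · exact eq_zero_of_mem_sectors hd hε hn h hq
    · rw [hn.symm_A q hq, eq_zero_of_mem_sectors hd hε hn h h1, Matrix.zero_vecMul]
    · rw [sq, mul_assoc] at h
      rw [hn.symm_A q hq, hn.symm_A _ h1, eq_zero_of_mem_sectors hd hε hn h h2,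
        Matrix.zero_vecMul, Matrix.zero_vecMul]
  have hG : k ∉ Gamma := fun h => hk (Or.inl h)
  rw [mem_Gamma_iff, not_or] at hG
  have hk0 : k ≠ 0 := by rintro rfl; simp at hG
  have hN : 0 < Complex.normSq (k ^ 3) := Complex.normSq_pos.2 (pow_ne_zero 3 hk0)
  have hinv : ((k⁻¹) ^ 3).re = (k ^ 3).re / Complex.normSq (k ^ 3) := by
    rw [inv_pow, Complex.inv_re]
  rcases lt_or_gt_of_ne hG.1 with h | h <;> rcases lt_or_gt_of_ne hG.2 with h' | h'
  · exact key k hk (Or.inr ⟨h, h'⟩)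
  · rw [hn.symm_B k hk, key _ (inv_notMem_GammaTilde hk) (Or.inl ⟨?_, ?_⟩), Matrix.zero_vecMul]
    · rw [norm_inv]; exact (one_lt_inv₀ (norm_pos_iff.2 hk0)).2 h
    · rw [hinv]; exact div_pos h' hN
  · rw [hn.symm_B k hk, key _ (inv_notMem_GammaTilde hk) (Or.inr ⟨?_, ?_⟩), Matrix.zero_vecMul]
    · rw [norm_inv]; exact inv_lt_one_of_one_lt₀ h
    · rw [hinv]; exact div_neg_of_neg_of_pos h' hN
  · exact key k hk (Or.inl ⟨h, h'⟩)

end Uniqueness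

end Bsq

end

/-- Vanishing lemma for the homogeneous Riemann-Hilbert problem for `ñ`. -/
theorem lemma4p3 (r1 r2 : ℂ → ℂ) (Z : Finset ℂ) (c : ℂ → ℂ)
    (hdata : Bsq.IsScatteringData r1 r2 Z c)
    (ε : ℝ) (hε : Bsq.AdmissibleRadius Z ε)
    (x t : ℝ) (ht : 0 ≤ t) (htT : (t : EReal) < Bsq.Tmax r1)
    (n : ℂ → Fin 3 → ℂ)
    (hn : Bsq.IsHomogeneousSolution r1 r2 Z c ε x t n) :
    ∀ k ∉ Bsq.GammaTilde Z ε, n k = 0 := by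
  exact fun _ hk => Bsq.eq_zero_of_isHomogeneousSolution hdata hε hn hk
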